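/- Let $y_1<y_2$ be real numbers, let $\beta\in\mathbb R$, and let $u$ be a real function satisfying (H1) $u\in H^4(y_1,y_2)$ (so that $u\in C^3([y_1,y_2])$, with one-sided derivatives at the endpoints), and $u''(y)\neq0$ at every $y\in[y_1,y_2]$ with $u'(y)=0$. Put $u_{\min}=\min_{[y_1,y_2]}u$, $u_{\max}=\max_{[y_1,y_2]}u$, and $$\kappa_+=\min\{u''(y): y\in[y_1,y_2],\ u'(y)=0,\ u(y)=u_{\min}\},\qquad \kappa_-=\max\{u''(y): y\in[y_1,y_2],\ u'(y)=0,\ u(y)=u_{\max}\},$$ with $\kappa_+=+\infty$, respectively $\kappa_-=-\infty$, if there is no such $y$. For $c\in\mathbb R\setminus[u_{\min},u_{\max}]$ let $\lambda_1(c)<\lambda_2(c)<\cdots$ be the eigenvalues of the Rayleigh–Kuo boundary value problem $$-\phi''+\frac{u''-\beta}{u-c}\,\phi=\lambda\phi,\qquad \phi(y_1)=\phi(y_2)=0,\qquad \phi\in H^1_0\cap H^2(y_1,y_2)$$ (they do form such an infinite strictly increasing sequence of real numbers). For $\beta>0$ define $$m_\beta=\#\{a\in(y_1,y_2): u(a)=u_{\min},\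 u''(a)-\beta<0\},\qquad M_\beta=-\inf_{c<u_{\min}}\lambda_{m_\beta+1}(c),$$ and for $\beta<0$ define $$m_\beta=\#\{a\in(y_1,y_2): u(a)=u_{\max},\ u''(a)-\beta>0\},\qquad M_\beta=-\inf_{c>u_{\max}}\lambda_{m_\beta+1}(c).$$ Then: (1) If $0<\beta\le\frac98\kappa_+$, then (i) $\lim_{c\to u_{\min}^-}\lambda_n(c)=-\infty$ for $1\le n\le m_\beta$; (ii) $M_\beta$ is finite; (iii) there is an integer $N_\beta>m_\beta$ with $\inf_{c<u_{\min}}\lambda_{N_\beta}(c)\ge0$. (2) If $\frac98\kappa_-\le\beta<0$, then (i) $\lim_{c\to u_{\max}^+}\lambda_n(c)=-\infty$ for $1\le n\le m_\beta$; (ii) $M_\beta$ is finite; (iii) there is an integer $N_\beta>m_\beta$ with $\inf_{c>u_{\max}}\lambda_{N_\beta}(c)\ge0$. (3) If $\beta>\frac98\kappa_+$, then $\lim_{c\to u_{\min}^-}\lambda_n(c)=-\infty$ for every $n\ge1$. (4) If $\beta<\frac98\kappa_-$, then $\lim_{c\to u_{\max}^+}\lambda_n(c)=-\infty$ for every $n\ge1$.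 -/

import Mathlib

open Set Filter Topology MeasureTheory

namespace RayleighKuo

noncomputable section

/-- `f ∈ H^{k+1}(a,b)` with (weak) derivative `f^{(k+1)} = g`: the function `f`, taken to be its
`C^k` representative on `[a,b]`, is `C^k` there (one-sided derivatives at the endpoints), and
`f^{(k)}` is absolutely continuous with derivative `g ∈ L²(a,b)`, i.e.
`f^{(k)}(y) = f^{(k)}(a) + ∫_a^y g`. -/
def HasSobolevDeriv (a b : ℝ) (k : ℕ) (f g : ℝ → ℝ) : Prop :=
  ContDiffOn ℝ k f (Icc a b) ∧
  MemLp g 2 (volume.restrict (Icc a b)) ∧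
  ∀ y ∈ Icc a b, iteratedDerivWithin k f (Icc a b) y =
    iteratedDerivWithin k f (Icc a b) a + ∫ t in a..y, g t

variable (y₁ y₂ : ℝ) (u : ℝ → ℝ) (β : ℝ)

/-- `u'` on `[y₁,y₂]` (one-sided at the endpoints). -/
def d1 (y : ℝ) : ℝ := derivWithin u (Icc y₁ y₂) y

/-- `u''` on `[y₁,y₂]` (one-sided at the endpoints). -/
def d2 (y : ℝ) : ℝ := iteratedDerivWithin 2 u (Icc y₁ y₂) y

/-- `u ∈ H⁴(y₁,y₂)`, and `u'' ≠ 0` at every critical point of `u` in `[y₁,y₂]`. -/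
def H1 : Prop :=
  (∃ g, HasSobolevDeriv y₁ y₂ 3 u g) ∧
  ∀ y ∈ Icc y₁ y₂, d1 y₁ y₂ u y = 0 → d2 y₁ y₂ u y ≠ 0

def uMin : ℝ := sInf (u '' Icc y₁ y₂)

def uMax : ℝ := sSup (u '' Icc y₁ y₂)

/-- The minimum of `u''` over the critical points at which `u = u_min`, and `+∞` if there is
no such point (the infimum of the empty set in `EReal` is `⊤`). -/
def kappaPlus : EReal :=
  ⨅ y ∈ {y ∈ Icc y₁ y₂ | d1 y₁ y₂ u y = 0 ∧ u y = uMin y₁ y₂ u}, (d2 y₁ y₂ u y : EReal)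

/-- The maximum of `u''` over the critical points at which `u = u_max`, and `-∞` if there is
no such point (the supremum of the empty set in `EReal` is `⊥`). -/
def kappaMinus : EReal :=
  ⨆ y ∈ {y ∈ Icc y₁ y₂ | d1 y₁ y₂ u y = 0 ∧ u y = uMax y₁ y₂ u}, (d2 y₁ y₂ u y : EReal)

/-- `μ` is an eigenvalue of the Rayleigh–Kuo boundary value problem
`-φ'' + (u'' - β)/(u - c) φ = μ φ`, `φ(y₁) = φ(y₂) = 0`: there is a nontrivial
`φ ∈ H²(y₁,y₂) ∩ H¹₀(y₁,y₂)`, with second derivative `ψ ∈ L²`, solving the equation almost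
everywhere. -/
def IsEigenvalue (c μ : ℝ) : Prop :=
  ∃ φ ψ : ℝ → ℝ, HasSobolevDeriv y₁ y₂ 1 φ ψ ∧ φ y₁ = 0 ∧ φ y₂ = 0 ∧
    (∃ y ∈ Icc y₁ y₂, φ y ≠ 0) ∧
    ∀ᵐ y ∂(volume.restrict (Icc y₁ y₂)),
      -ψ y + (d2 y₁ y₂ u y - β) / (u y - c) * φ y = μ * φ y

/-- The `n`-th eigenvalue (`n ≥ 1`) of the Rayleigh–Kuo boundary value problem: the least `Λ` such
that at least `n` eigenvalues are `≤ Λ`. (All eigenvalues of this problem are simple, so there is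
no difference between counting them with and without multiplicity.) -/
def eig (n : ℕ) (c : ℝ) : ℝ :=
  sInf {Λ : ℝ | ∃ s : Finset ℝ, s.card = n ∧ ∀ x ∈ s, IsEigenvalue y₁ y₂ u β c x ∧ x ≤ Λ}

/-- The number `m_β`; the first value is the one for `β > 0`, the second the one for `β < 0`. -/
def mBeta : ℕ :=
  if 0 < β then
    {a ∈ Ioo y₁ y₂ | u a = uMin y₁ y₂ u ∧ d2 y₁ y₂ u a - β < 0}.ncard
  else
    {a ∈ Ioo y₁ y₂ | u a = uMax y₁ y₂ u ∧ d2 y₁ y₂ u a - β > 0}.ncard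

/-- The quantity `M_β`, as an extended real number; the first value is the one for `β > 0`, the
second the one for `β < 0`. -/
def MBeta : EReal :=
  if 0 < β then
    -(⨅ c ∈ Iio (uMin y₁ y₂ u), (eig y₁ y₂ u β (mBeta y₁ y₂ u β + 1) c : EReal))
  else
    -(⨅ c ∈ Ioi (uMax y₁ y₂ u), (eig y₁ y₂ u β (mBeta y₁ y₂ u β + 1) c : EReal))

end

end RayleighKuo

open RayleighKuo

/-! Only the behaviour near points where `u = u_min` matters as `c → u_min⁻`. At such a point `p`
with `u'(p) = 0`, minimality and nondegeneracy give `κ = u''(p) > 0`. With `r = |y - p|`, the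
denominator `u - c` is about `κ r²/2 + (u_min - c)`, so the limiting potential is about `-(2(β -
κ)/κ) / r²`. Hardy's constant `1/4` is reached exactly when `β = 9κ/8`. If `u' ≠ 0` at a minimum
point, which is then an endpoint, the singularity is only of order `1/r`.

Upper bounds on eigenvalues come from counting zeros. The Prüfer angle at the right endpoint is
continuous and strictly increasing in the spectral parameter, and `λ_n` is the parameter at which it
equals `nπ`; hence `n` zeros at level `l` force `λ_n ≤ l`. In the supercritical case the potential
lies below `-γ/r²` with `γ > 1/4` on logarithmically long intervals, so the number of zeros is
unbounded (`tendsto_eig_atBot_of_supercritical`). At an interior minimum point with `u'' < β` the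
potential is a well of depth of order `1/(u_min - c)` and width of order `√(u_min - c)`, which
forces a zero near the point at any fixed level (`eventually_exists_sin_eq_zero`).

Lower bounds come from the quadratic form: a bound `-C` on functions vanishing at `m` points gives
`λ_{m+1} ≥ -C` (`neg_le_of_form_bound`). For `β ≤ 9κ_+/8`, Hardy's inequality makes the form
nonnegative on short intervals about any point where the function vanishes. Imposing this at
finitely many points whose intervals cover `[y₁, y₂]` gives (iii). For (ii) it is imposed only at
the `m_β` points, the endpoints being free. At the remaining minimum points `u'' ≥ β`: if `u'' > β`
the potential is nonnegative nearby; if `u'' = β` its `1/r` singularity is odd to leading order and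
is the derivative of a multiple of `log (u - c)` up to an integrable error
(`form_bound_borderline`). This is where the Hölder continuity of `u'''` is used.

The statements at `u_max` follow from the symmetry `(u, β, c) ↦ (-u, -β, -c)`. -/

namespace RayleighKuo

/-! ### One-sided derivatives on a closed interval -/

/-- `f` is differentiable on `[a,b]` (one-sided at the endpoints) with derivative `f'`. -/
def HasDerivOn (a b : ℝ) (f f' : ℝ → ℝ) : Prop :=
  ∀ x ∈ Icc a b, HasDerivWithinAt f (f' x) (Icc a b) x

namespace HasDerivOn

variable {a b : ℝ} {f f' g g' : ℝ → ℝ}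

theorem continuousOn (h : HasDerivOn a b f f') : ContinuousOn f (Icc a b) :=
  fun x hx => (h x hx).continuousWithinAt

theorem hasDerivAt (h : HasDerivOn a b f f') {x : ℝ} (hx : x ∈ Ioo a b) : HasDerivAt f (f' x) x :=
  (h x (Ioo_subset_Icc_self hx)).hasDerivAt (Icc_mem_nhds hx.1 hx.2)

theorem mono (h : HasDerivOn a b f f') {s t : ℝ} (hs : a ≤ s) (ht : t ≤ b) : HasDerivOn s t f f' :=
  fun x hx => (h x ⟨hs.trans hx.1, hx.2.trans ht⟩).mono (Icc_subset_Icc hs ht)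

theorem congr (h : HasDerivOn a b f f') (hg : ∀ x ∈ Icc a b, f' x = g' x) : HasDerivOn a b f g' :=
  fun x hx => hg x hx ▸ h x hx

theorem mul (hf : HasDerivOn a b f f') (hg : HasDerivOn a b g g') :
    HasDerivOn a b (fun x => f x * g x) (fun x => f' x * g x + f x * g' x) :=
  fun x hx => (hf x hx).mul (hg x hx)

theorem add (hf : HasDerivOn a b f f') (hg : HasDerivOn a b g g') :
    HasDerivOn a b (fun x => f x + g x) (fun x => f' x + g' x) :=
  fun x hx => (hf x hx).add (hg x hx)

theorem sub (hf : HasDerivOn a b f f') (hg : HasDerivOn a b g g') :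
    HasDerivOn a b (fun x => f x - g x) (fun x => f' x - g' x) :=
  fun x hx => (hf x hx).sub (hg x hx)

theorem const (a b c : ℝ) : HasDerivOn a b (fun _ => c) (fun _ => 0) :=
  fun x _ => hasDerivWithinAt_const x _ c

theorem const_mul (c : ℝ) (hf : HasDerivOn a b f f') :
    HasDerivOn a b (fun x => c * f x) (fun x => c * f' x) :=
  fun x hx => (hf x hx).const_mul c

theorem neg (hf : HasDerivOn a b f f') : HasDerivOn a b (fun x => -f x) (fun x => -f' x) :=
  fun x hx => (hf x hx).neg

theorem sin (hf : HasDerivOn a b f f') :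
    HasDerivOn a b (fun x => Real.sin (f x)) (fun x => Real.cos (f x) * f' x) :=
  fun x hx => (hf x hx).sin

theorem cos (hf : HasDerivOn a b f f') :
    HasDerivOn a b (fun x => Real.cos (f x)) (fun x => -Real.sin (f x) * f' x) :=
  fun x hx => (hf x hx).cos

theorem exp (hf : HasDerivOn a b f f') :
    HasDerivOn a b (fun x => Real.exp (f x)) (fun x => Real.exp (f x) * f' x) :=
  fun x hx => (hf x hx).exp

theorem hasDerivWithinAt_Ici (h : HasDerivOn a b f f') {x : ℝ} (hx : x ∈ Ico a b) :
    HasDerivWithinAt f (f' x) (Ici x) x := by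
  have h1 := (h x ⟨hx.1, hx.2.le⟩).mono (Icc_subset_Icc_left hx.1)
  exact h1.mono_of_mem_nhdsWithin (Icc_mem_nhdsGE hx.2)

theorem monotoneOn (h : HasDerivOn a b f f') (h0 : ∀ x ∈ Ioo a b, 0 ≤ f' x) :
    MonotoneOn f (Icc a b) := by
  refine monotoneOn_of_deriv_nonneg (convex_Icc a b) h.continuousOn ?_ ?_ <;>
    rw [interior_Icc] <;> intro x hx
  · exact (h.hasDerivAt hx).differentiableAt.differentiableWithinAt
  · rw [(h.hasDerivAt hx).deriv]; exact h0 x hx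

theorem antitoneOn (h : HasDerivOn a b f f') (h0 : ∀ x ∈ Ioo a b, f' x ≤ 0) :
    AntitoneOn f (Icc a b) := by
  have := h.neg.monotoneOn (fun x hx => neg_nonneg.2 (h0 x hx))
  intro x hx y hy hxy
  exact neg_le_neg_iff.1 (this hx hy hxy)

theorem eq_left (h : HasDerivOn a b f f') (h0 : ∀ x ∈ Ioo a b, f' x = 0) {x : ℝ}
    (hx : x ∈ Icc a b) : f x = f a := by
  have ha : a ∈ Icc a b := ⟨le_rfl, hx.1.trans hx.2⟩
  exact le_antisymm (h.antitoneOn (fun x hx => (h0 x hx).le) ha hx hx.1)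
    (h.monotoneOn (fun x hx => (h0 x hx).ge) ha hx hx.1)

theorem integral_eq (h : HasDerivOn a b f f') (hab : a ≤ b) (hc : ContinuousOn f' (Icc a b)) :
    ∫ x in a..b, f' x = f b - f a :=
  intervalIntegral.integral_eq_sub_of_hasDerivAt_of_le hab h.continuousOn
    (fun _ hx => h.hasDerivAt hx) (hc.intervalIntegrable_of_Icc hab)

end HasDerivOn

variable {a b : ℝ}

theorem exists_hasDerivOn {A : ℝ → ℝ} (hA : ContinuousOn A (Icc a b)) :
    ∃ B, HasDerivOn a b B A := by
  refine ⟨fun x => ∫ t in a..x, A t, fun x hx => ?_⟩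
  have : Fact (x ∈ Icc a b) := ⟨hx⟩
  apply intervalIntegral.integral_hasDerivWithinAt_right
  · exact (hA.mono (Icc_subset_Icc_right hx.2)).intervalIntegrable_of_Icc hx.1
  · exact hA.stronglyMeasurableAtFilter_nhdsWithin measurableSet_Icc x
  · exact hA x hx

/-! ### First-order linear equations and positivity -/

section LinearODE

variable {f A p : ℝ → ℝ}

theorem exists_integratingFactor (hA : ContinuousOn A (Icc a b))
    (hf : HasDerivOn a b f (fun x => A x * f x + p x)) :
    ∃ E : ℝ → ℝ, (∀ x, 0 < E x) ∧ HasDerivOn a b (fun x => E x * f x) (fun x => E x * p x) := by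
  obtain ⟨B, hB⟩ := exists_hasDerivOn hA
  refine ⟨fun x => Real.exp (-B x), fun x => Real.exp_pos _, ?_⟩
  exact (hB.neg.exp.mul hf).congr fun x _ => by ring

theorem nonneg_of_linear (hab : a ≤ b) (hA : ContinuousOn A (Icc a b))
    (hf : HasDerivOn a b f (fun x => A x * f x + p x)) (hp : ∀ x ∈ Ioo a b, 0 ≤ p x)
    (h0 : 0 ≤ f a) : 0 ≤ f b := by
  obtain ⟨E, hE, h⟩ := exists_integratingFactor hA hf
  have := h.monotoneOn (fun x hx => mul_nonneg (hE x).le (hp x hx)) (left_mem_Icc.2 hab)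
    (right_mem_Icc.2 hab) hab
  have h2 : 0 ≤ E b * f b := (mul_nonneg (hE a).le h0).trans this
  exact nonneg_of_mul_nonneg_right h2 (hE b)

/-- If `f b` were zero, the nondecreasing function `E f` would vanish on all of `[a,b]`, and so
would its derivative `E p`. -/
theorem pos_of_linear (hab : a < b) (hA : ContinuousOn A (Icc a b))
    (hf : HasDerivOn a b f (fun x => A x * f x + p x)) (hp : ∀ x ∈ Ioo a b, 0 ≤ p x)
    (h0 : 0 ≤ f a) (hne : ∃ x ∈ Ioo a b, p x ≠ 0) : 0 < f b := by
  obtain ⟨E, hE, h⟩ := exists_integratingFactor hA hf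
  have hmono := h.monotoneOn (fun x hx => mul_nonneg (hE x).le (hp x hx))
  refine (nonneg_of_linear hab.le hA hf hp h0).lt_of_ne fun h1 => ?_
  obtain ⟨x, hx, hpx⟩ := hne
  have hconst : ∀ y ∈ Icc a b, E y * f y = 0 := by
    intro y hy
    have h2 := hmono (left_mem_Icc.2 hab.le) hy hy.1
    have h3 := hmono hy (right_mem_Icc.2 hab.le) hy.2
    simp only [← h1, mul_zero] at h3
    exact le_antisymm h3 ((mul_nonneg (hE a).le h0).trans h2)
  have h4 : HasDerivAt (fun y => E y * f y) 0 x := by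
    refine (hasDerivAt_const x (0 : ℝ)).congr_of_eventuallyEq ?_
    filter_upwards [Icc_mem_nhds hx.1 hx.2] with y hy using hconst y hy
  exact (mul_ne_zero (hE x).ne' hpx) ((h.hasDerivAt hx).unique h4)

theorem eq_zero_of_linear (hA : ContinuousOn A (Icc a b))
    (hf : HasDerivOn a b f (fun x => A x * f x)) {c : ℝ} (hc : c ∈ Icc a b) (h0 : f c = 0) {x : ℝ}
    (hx : x ∈ Icc a b) : f x = 0 := by
  obtain ⟨E, hE, h⟩ := exists_integratingFactor (p := fun _ => 0) hA
    (hf.congr fun x _ => by simp)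
  have h1 := h.eq_left (fun x _ => by simp) hx
  have h2 := h.eq_left (fun x _ => by simp) hc
  simp only [h0, mul_zero] at h2
  rw [← h2] at h1
  exact (mul_eq_zero.1 h1).resolve_left (hE x).ne'

end LinearODE

/-! ### The Prüfer angle -/

/-- `θ` is the Prüfer angle of the solution of `-φ'' + qφ = lφ` with `φ(a) = 0`. -/
structure IsPruefer (a b : ℝ) (q : ℝ → ℝ) (l : ℝ) (θ : ℝ → ℝ) : Prop where
  left : θ a = 0
  deriv : HasDerivOn a b θ (fun x => Real.cos (θ x) ^ 2 + (l - q x) * Real.sin (θ x) ^ 2)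

section Pruefer

variable {q : ℝ → ℝ}

/-- Since `sinc` is continuous, this turns differences of Prüfer angles into solutions of linear
equations `f' = A f + p` with continuous `A`, so that the comparison lemmas above apply. -/
theorem sin_eq_sinc_mul (x : ℝ) : Real.sin x = Real.sinc x * x := by
  rcases eq_or_ne x 0 with rfl | h
  · simp
  · rw [Real.sinc_of_ne_zero h]; field_simp

theorem sin_sq_sub_sin_sq (x y : ℝ) :
    Real.sin x ^ 2 - Real.sin y ^ 2 = Real.sin (x + y) * Real.sin (x - y) := by
  rw [Real.sin_add, Real.sin_sub]
  nlinarith [Real.sin_sq_add_cos_sq x, Real.sin_sq_add_cos_sq y]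

theorem lipschitzWith_pruefer (l k M : ℝ) (hM : |l - k| ≤ M) :
    LipschitzWith (Real.toNNReal (1 + M))
      (fun x => Real.cos x ^ 2 + (l - k) * Real.sin x ^ 2) := by
  have hM0 : 0 ≤ M := (abs_nonneg _).trans hM
  refine LipschitzWith.of_dist_le_mul fun x y => ?_
  rw [Real.coe_toNNReal _ (by linarith), Real.dist_eq, Real.dist_eq]
  have : Real.cos x ^ 2 + (l - k) * Real.sin x ^ 2 - (Real.cos y ^ 2 + (l - k) * Real.sin y ^ 2)
      = (l - k - 1) * (Real.sin (x + y) * Real.sin (x - y)) := by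
    rw [← sin_sq_sub_sin_sq, Real.cos_sq', Real.cos_sq']; ring
  rw [this, abs_mul, abs_mul]
  have h1 : |l - k - 1| ≤ 1 + M := by
    rw [abs_le] at *; constructor <;> linarith
  have h2 := Real.abs_sin_le_one (x + y)
  have h3 : |Real.sin (x - y)| ≤ |x - y| := Real.abs_sin_le_abs
  have h4 : |Real.sin (x + y)| * |Real.sin (x - y)| ≤ 1 * |x - y| :=
    mul_le_mul h2 h3 (abs_nonneg _) zero_le_one
  calc _ ≤ (1 + M) * (1 * |x - y|) := mul_le_mul h1 h4 (by positivity) (by linarith)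
    _ = _ := by ring

theorem exists_abs_sub_le (hq : ContinuousOn q (Icc a b)) (l : ℝ) :
    ∃ M, 0 ≤ M ∧ ∀ x ∈ Icc a b, |l - q x| ≤ M := by
  obtain ⟨M, hM⟩ := isCompact_Icc.exists_bound_of_continuousOn
    (continuousOn_const.sub hq : ContinuousOn (fun x => l - q x) (Icc a b))
  exact ⟨max M 0, le_max_right _ _, fun x hx => (hM x hx).trans (le_max_left _ _)⟩

theorem exists_isPruefer (hab : a ≤ b) (hq : ContinuousOn q (Icc a b)) (l : ℝ) :
    ∃ θ, IsPruefer a b q l θ := by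
  obtain ⟨M, hM0, hM⟩ := exists_abs_sub_le hq l
  let F : ℝ → ℝ → ℝ := fun x θ => Real.cos θ ^ 2 + (l - q x) * Real.sin θ ^ 2
  -- The right-hand side is bounded by `1 + M`, so the angle moves by at most `(1 + M)(b - a)`; a
  -- ball of this radius gives existence on the whole interval.
  have hF : IsPicardLindelof F (tmin := a) (tmax := b) ⟨a, left_mem_Icc.2 hab⟩ 0
      (Real.toNNReal ((1 + M) * (b - a))) 0 (Real.toNNReal (1 + M)) (Real.toNNReal (1 + M)) := by
    refine ⟨fun t ht => (lipschitzWith_pruefer l (q t) M (hM t ht)).lipschitzOnWith,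
      fun x _ => ?_, fun t ht x _ => ?_, ?_⟩
    · exact continuousOn_const.add ((continuousOn_const.sub hq).mul continuousOn_const)
    · rw [Real.coe_toNNReal _ (by linarith), Real.norm_eq_abs]
      have h1 := hM t ht
      rw [abs_le] at *
      have h2 := Real.sin_sq_add_cos_sq x
      have h3 := sq_nonneg (Real.sin x)
      have h4 := sq_nonneg (Real.cos x)
      constructor <;> simp only [F] <;> nlinarith
    · simp only [NNReal.coe_zero, sub_zero, sub_self]
      rw [max_eq_left (by linarith), Real.coe_toNNReal _ (by linarith),
        Real.coe_toNNReal _ (mul_nonneg (by linarith) (by linarith))]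
  obtain ⟨θ, h0, h1⟩ := hF.exists_eq_forall_mem_Icc_hasDerivWithinAt₀
  exact ⟨θ, h0, h1⟩

namespace IsPruefer

variable {l m : ℝ} {θ η : ℝ → ℝ}

theorem continuousOn (h : IsPruefer a b q l θ) : ContinuousOn θ (Icc a b) := h.deriv.continuousOn

/-- The Prüfer angle crosses the multiples of `π` upwards. -/
theorem mul_pi_lt (h : IsPruefer a b q l θ) (hq : ContinuousOn q (Icc a b)) {s t : ℝ} (k : ℤ)
    (hs : a ≤ s) (hst : s < t) (ht : t ≤ b) (hk : θ s = k * Real.pi) : k * Real.pi < θ t := by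
  have hd := h.deriv.mono hs ht
  have hc := hd.continuousOn
  -- With `w = θ - kπ` the equation reads `w' = 1 - (1 - l + q) sin² w`, which is `A w + 1`. The
  -- source term `1` pushes `w` upwards from zero.
  let A : ℝ → ℝ := fun x => -((1 - l + q x) * (Real.sin (θ x - k * Real.pi) *
    Real.sinc (θ x - k * Real.pi)))
  have hqc := hq.mono (Icc_subset_Icc hs ht)
  have hA : ContinuousOn A (Icc s t) := by
    have h1 : ContinuousOn (fun x => θ x - k * Real.pi) (Icc s t) := hc.sub continuousOn_const
    exact ((continuousOn_const.add hqc).mul ((Real.continuous_sin.comp_continuousOn h1).mul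
      (Real.continuous_sinc.comp_continuousOn h1))).neg
  have hf : HasDerivOn s t (fun x => θ x - k * Real.pi)
      (fun x => A x * (θ x - k * Real.pi) + 1) := by
    refine (hd.sub (.const _ _ (k * Real.pi))).congr fun x _ => ?_
    have h2 : Real.sin (θ x) ^ 2 = Real.sin (θ x - k * Real.pi) ^ 2 := by
      rw [Real.sin_sub_int_mul_pi, mul_pow]
      rcases Int.even_or_odd k with hk | hk
      · simp [hk.neg_one_zpow]
      · simp [hk.neg_one_zpow]
    have h3 := sin_eq_sinc_mul (θ x - k * Real.pi)
    rw [Real.cos_sq', h2]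
    simp only [A]
    linear_combination -(1 - l + q x) * Real.sin (θ x - k * Real.pi) * h3
  have := pos_of_linear hst hA hf (fun _ _ => zero_le_one) (by simp [hk])
    ⟨(s + t) / 2, ⟨by linarith, by linarith⟩, one_ne_zero⟩
  linarith

theorem pos (h : IsPruefer a b q l θ) (hq : ContinuousOn q (Icc a b)) {t : ℝ} (ha : a < t)
    (ht : t ≤ b) : 0 < θ t := by
  have := h.mul_pi_lt hq 0 le_rfl ha ht (by simp [h.left])
  simpa using this

/-- Sturm comparison: the difference of the angles solves a linear equation with source `(m - l)
sin² θ ≥ 0`. The source cannot vanish identically, because where `sin θ = 0` the angle has slope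
`1`. -/
theorem lt_of_lt (hab : a < b) (h : IsPruefer a b q l θ) (h' : IsPruefer a b q m η)
    (hq : ContinuousOn q (Icc a b)) (hlm : l < m) : θ b < η b := by
  let A : ℝ → ℝ := fun x => -((1 - m + q x) * (Real.sin (η x + θ x) * Real.sinc (η x - θ x)))
  have hA : ContinuousOn A (Icc a b) :=
    ((continuousOn_const.add hq).mul ((Real.continuous_sin.comp_continuousOn
      (h'.continuousOn.add h.continuousOn)).mul (Real.continuous_sinc.comp_continuousOn
      (h'.continuousOn.sub h.continuousOn)))).neg
  have hf : HasDerivOn a b (fun x => η x - θ x)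
      (fun x => A x * (η x - θ x) + (m - l) * Real.sin (θ x) ^ 2) := by
    refine (h'.deriv.sub h.deriv).congr fun x _ => ?_
    have h3 := sin_eq_sinc_mul (η x - θ x)
    have h4 := sin_sq_sub_sin_sq (η x) (θ x)
    rw [Real.cos_sq', Real.cos_sq']
    simp only [A]
    linear_combination (m - 1 - q x) * h4 + (m - 1 - q x) * Real.sin (η x + θ x) * h3
  have hne : ∃ x ∈ Ioo a b, (m - l) * Real.sin (θ x) ^ 2 ≠ 0 := by
    by_contra! hcon
    have hz : ∀ x ∈ Ioo a b, Real.sin (θ x) = 0 := by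
      intro x hx
      have := hcon x hx
      simpa [sub_eq_zero, hlm.ne'] using this
    have hx : (a + b) / 2 ∈ Ioo a b := ⟨by linarith, by linarith⟩
    have h1 := h.deriv.sin.hasDerivAt hx
    have h2 : HasDerivAt (fun y => Real.sin (θ y)) 0 ((a + b) / 2) := by
      refine (hasDerivAt_const _ (0 : ℝ)).congr_of_eventuallyEq ?_
      filter_upwards [Ioo_mem_nhds hx.1 hx.2] with y hy using hz y hy
    have h3 := h1.unique h2
    have h4 := Real.sin_sq_add_cos_sq (θ ((a + b) / 2))
    rw [hz _ hx] at h3 h4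
    have h5 : Real.cos (θ ((a + b) / 2)) ^ 2 = 1 := by linarith
    rw [h5] at h3
    have h6 : Real.cos (θ ((a + b) / 2)) = 0 := by linarith
    rw [h6] at h5; norm_num at h5
  have := pos_of_linear hab hA hf (fun x _ => mul_nonneg (by linarith) (sq_nonneg _))
    (by simp [h.left, h'.left]) hne
  linarith

/-- For `l ≤ q` the value `π/2` is a barrier, since there `θ' = l - q ≤ 0`. This supplies a
parameter below the whole spectrum. -/
theorem le_pi_div_two (hab : a ≤ b) (h : IsPruefer a b q l θ)
    (hl : ∀ x ∈ Icc a b, l ≤ q x) : θ b ≤ Real.pi / 2 := by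
  let A : ℝ → ℝ := fun x => -(Real.sin (Real.pi / 2 - θ x) * Real.sinc (Real.pi / 2 - θ x))
  have hc : ContinuousOn (fun x => Real.pi / 2 - θ x) (Icc a b) :=
    continuousOn_const.sub h.continuousOn
  have hA : ContinuousOn A (Icc a b) :=
    ((Real.continuous_sin.comp_continuousOn hc).mul (Real.continuous_sinc.comp_continuousOn hc)).neg
  have hf : HasDerivOn a b (fun x => Real.pi / 2 - θ x)
      (fun x => A x * (Real.pi / 2 - θ x) + (q x - l) * Real.sin (θ x) ^ 2) := by
    refine ((HasDerivOn.const _ _ (Real.pi / 2)).sub h.deriv).congr fun x _ => ?_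
    have h3 := sin_eq_sinc_mul (Real.pi / 2 - θ x)
    have h4 := Real.sin_pi_div_two_sub (θ x)
    rw [← h4]
    simp only [A]
    linear_combination -Real.sin (Real.pi / 2 - θ x) * h3
  have := nonneg_of_linear hab hA hf
    (fun x hx => mul_nonneg (by linarith [hl x (Ioo_subset_Icc_self hx)]) (sq_nonneg _))
    (by rw [h.left]; linarith [Real.pi_pos])
  linarith

/-- Counting zeros of the solution by means of the Prüfer angle. -/
theorem card_mul_pi_le (hab : a < b) (h : IsPruefer a b q l θ) (hq : ContinuousOn q (Icc a b))
    (S : Finset ℝ)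
    (hS : ∀ x ∈ S, x ∈ Ioc a b ∧ Real.sin (θ x) = 0) : S.card * Real.pi ≤ θ b := by
  have hk : ∀ x ∈ S, ∃ k : ℤ, (k : ℝ) * Real.pi = θ x := fun x hx =>
    Real.sin_eq_zero_iff.1 (hS x hx).2
  choose! k hk using hk
  have hle : ∀ x ∈ S, θ x ≤ θ b := by
    intro x hx
    rcases (hS x hx).1.2.eq_or_lt with h1 | h1
    · rw [h1]
    · have := h.mul_pi_lt hq (k x) (hS x hx).1.1.le h1 le_rfl (hk x hx).symm
      rw [hk x hx] at this; exact this.le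
  have hlt : ∀ x ∈ S, ∀ y ∈ S, x < y → k x < k y := by
    intro x hx y hy hxy
    have := h.mul_pi_lt hq (k x) (hS x hx).1.1.le hxy (hS y hy).1.2 (hk x hx).symm
    rw [← hk y hy] at this
    exact_mod_cast lt_of_mul_lt_mul_right this Real.pi_pos.le
  have hinj : Set.InjOn k S := by
    intro x hx y hy hxy
    rcases lt_trichotomy x y with h1 | h1 | h1
    · exact absurd hxy (hlt x hx y hy h1).ne
    · exact h1
    · exact absurd hxy (hlt y hy x hx h1).ne'
  -- The angle is positive to the right of `a`, so the multiples start at `1`; the zero at `a`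
  -- itself is not counted.
  have hsub : S.image k ⊆ Finset.Icc 1 ⌊θ b / Real.pi⌋ := by
    intro j hj
    obtain ⟨x, hx, rfl⟩ := Finset.mem_image.1 hj
    rw [Finset.mem_Icc]
    constructor
    · have h1 := h.pos hq (hS x hx).1.1 (hS x hx).1.2
      rw [← hk x hx] at h1
      have : (0 : ℝ) < k x := pos_of_mul_pos_left h1 Real.pi_pos.le
      exact_mod_cast this
    · rw [Int.le_floor, le_div_iff₀ Real.pi_pos, hk x hx]
      exact hle x hx
  have hcard := Finset.card_le_card hsub
  rw [Finset.card_image_of_injOn hinj, Int.card_Icc] at hcard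
  rcases S.eq_empty_or_nonempty with rfl | ⟨x, hx⟩
  · simpa using (h.pos hq hab le_rfl).le
  · have h0 : 0 ≤ θ b / Real.pi := by
      have := (h.pos hq (hS x hx).1.1 (hS x hx).1.2).le.trans (hle x hx)
      positivity
    have h1 : 0 ≤ ⌊θ b / Real.pi⌋ := Int.floor_nonneg.2 h0
    have h2 : (S.card : ℤ) ≤ ⌊θ b / Real.pi⌋ := by omega
    have h3 : (S.card : ℝ) ≤ θ b / Real.pi := by
      have := Int.le_floor.1 h2
      exact_mod_cast this
    rwa [le_div_iff₀ Real.pi_pos] at h3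

end IsPruefer
end Pruefer

/-! ### Eigenfunctions in Prüfer coordinates -/

theorem HasDerivOn.comp_affine {f f' : ℝ → ℝ} {s t c τ : ℝ} (h : HasDerivOn a b f f')
    (hm : ∀ x ∈ Icc s t, c + τ * x ∈ Icc a b) :
    HasDerivOn s t (fun x => f (c + τ * x)) (fun x => τ * f' (c + τ * x)) := by
  intro x hx
  have h1 : HasDerivWithinAt (fun x => c + τ * x) τ (Icc s t) x := by
    simpa using ((hasDerivWithinAt_id x (Icc s t)).const_mul τ).const_add c
  have := (h _ (hm x hx)).comp x h1 hm
  rwa [mul_comm] at this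

/-- `φ` is an eigenfunction of `-φ'' + qφ = lφ`, `φ(a) = φ(b) = 0`, with derivative `φ'`. -/
structure IsEigenfunction (a b : ℝ) (q : ℝ → ℝ) (l : ℝ) (φ φ' : ℝ → ℝ) : Prop where
  deriv : HasDerivOn a b φ φ'
  deriv₂ : HasDerivOn a b φ' (fun x => (q x - l) * φ x)
  left : φ a = 0
  right : φ b = 0
  ne_zero : ∃ x ∈ Icc a b, φ x ≠ 0

section Pruefer

variable {q : ℝ → ℝ} {l : ℝ} {θ : ℝ → ℝ}

namespace IsPruefer

theorem exists_isEigenfunction (hab : a < b) (h : IsPruefer a b q l θ)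
    (hq : ContinuousOn q (Icc a b)) (hb : Real.sin (θ b) = 0) :
    ∃ φ φ', IsEigenfunction a b q l φ φ' := by
  have hA : ContinuousOn (fun x => (1 + q x - l) * (Real.sin (θ x) * Real.cos (θ x)))
      (Icc a b) :=
    ((continuousOn_const.add hq).sub continuousOn_const).mul
      (h.deriv.sin.continuousOn.mul h.deriv.cos.continuousOn)
  -- `exp B` is the Prüfer amplitude: `φ = e^B sin θ` and `φ' = e^B cos θ`. It is nontrivial because
  -- `sin θ` has only finitely many zeros.
  obtain ⟨B, hB⟩ := exists_hasDerivOn hA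
  have hr := hB.exp
  refine ⟨fun x => Real.exp (B x) * Real.sin (θ x), fun x => Real.exp (B x) * Real.cos (θ x),
    (hr.mul h.deriv.sin).congr fun x _ => ?_, (hr.mul h.deriv.cos).congr fun x _ => ?_,
    by simp [h.left], by simp [hb], ?_⟩
  · linear_combination Real.exp (B x) * Real.cos (θ x) * Real.sin_sq_add_cos_sq (θ x)
  · linear_combination (q x - l) * Real.exp (B x) * Real.sin (θ x) * Real.sin_sq_add_cos_sq (θ x)
  · by_contra! hcon
    have hz : ∀ x ∈ Icc a b, Real.sin (θ x) = 0 := fun x hx =>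
      (mul_eq_zero.1 (hcon x hx)).resolve_left (Real.exp_pos _).ne'
    have hcard := h.card_mul_pi_le hab hq
    obtain ⟨n, hn⟩ := exists_nat_gt (θ b / Real.pi)
    obtain ⟨S, hS, hSn⟩ := (Set.Ioc_infinite hab).exists_subset_card_eq n
    have := hcard S fun x hx => ⟨hS hx, hz x (Ioc_subset_Icc_self (hS hx))⟩
    rw [hSn] at this
    rw [div_lt_iff₀ Real.pi_pos] at hn
    linarith

theorem sin_eq_zero_of_isEigenfunction (h : IsPruefer a b q l θ)
    (hq : ContinuousOn q (Icc a b)) {φ φ' : ℝ → ℝ} (hφ : IsEigenfunction a b q l φ φ') :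
    Real.sin (θ b) = 0 := by
  obtain ⟨x₀, hx₀, hne⟩ := hφ.ne_zero
  have hab : a ≤ b := hx₀.1.trans hx₀.2
  have hA : ContinuousOn (fun x => (1 + q x - l) * (Real.sin (θ x) * Real.cos (θ x)))
      (Icc a b) :=
    ((continuousOn_const.add hq).sub continuousOn_const).mul
      (h.deriv.sin.continuousOn.mul h.deriv.cos.continuousOn)
  -- The vector `(φ, φ')` is parallel to `(sin θ, cos θ)`: their determinant solves a homogeneous
  -- linear equation and vanishes at `a`.
  have hW : ∀ x ∈ Icc a b, φ x * Real.cos (θ x) - φ' x * Real.sin (θ x) = 0 := by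
    intro x hx
    refine eq_zero_of_linear (f := fun x => φ x * Real.cos (θ x) - φ' x * Real.sin (θ x))
      hA.neg (((hφ.deriv.mul h.deriv.cos).sub (hφ.deriv₂.mul h.deriv.sin)).congr
        fun x _ => ?_) (left_mem_Icc.2 hab) (by simp [hφ.left, h.left]) hx
    simp only [Pi.neg_apply]
    linear_combination (φ x * Real.sin (θ x) * (q x - l) - φ' x * Real.cos (θ x)) *
      Real.sin_sq_add_cos_sq (θ x)
  by_contra hb
  -- If `sin θ(b) ≠ 0`, then `φ` and `φ'` both vanish at `b`; the amplitude, which also solves a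
  -- homogeneous linear equation, is then zero everywhere.
  have hk : φ x₀ * Real.sin (θ x₀) + φ' x₀ * Real.cos (θ x₀) = 0 := by
    refine eq_zero_of_linear (f := fun x => φ x * Real.sin (θ x) + φ' x * Real.cos (θ x))
      hA (((hφ.deriv.mul h.deriv.sin).add (hφ.deriv₂.mul h.deriv.cos)).congr
        fun x hx => ?_) (right_mem_Icc.2 hab) ?_ hx₀
    · have := hW x hx
      linear_combination (1 + q x - l) * (Real.cos (θ x) ^ 2 - Real.sin (θ x) ^ 2) * this -
        (φ' x * Real.sin (θ x) + φ x * Real.cos (θ x) * (q x - l)) * Real.sin_sq_add_cos_sq (θ x)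
    · have h1 := hW b (right_mem_Icc.2 hab)
      rw [hφ.right] at h1 ⊢
      have h2 : φ' b = 0 := by
        have : φ' b * Real.sin (θ b) = 0 := by linarith
        exact (mul_eq_zero.1 this).resolve_right hb
      simp [h2]
  have h2 := hW x₀ hx₀
  apply hne
  linear_combination Real.sin (θ x₀) * hk + Real.cos (θ x₀) * h2 -
    φ x₀ * Real.sin_sq_add_cos_sq (θ x₀)

/-- On an interval free of zeros, the logarithmic derivative solves the Riccati equation. -/
theorem exists_riccati (h : IsPruefer a b q l θ) {s t c τ : ℝ} (hτ : τ ^ 2 = 1)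
    (hm : ∀ x ∈ Icc s t, c + τ * x ∈ Icc a b)
    (hne : ∀ x ∈ Icc s t, Real.sin (θ (c + τ * x)) ≠ 0) :
    ∃ g, HasDerivOn s t g (fun x => q (c + τ * x) - l - g x ^ 2) := by
  have h1 := h.deriv.comp_affine hm
  refine ⟨fun x => τ * (Real.cos (θ (c + τ * x)) / Real.sin (θ (c + τ * x))), fun x hx => ?_⟩
  have h2 := ((h1.cos x hx).div (h1.sin x hx) (hne x hx)).const_mul τ
  refine h2.congr_deriv ?_
  have h3 := hne x hx
  field_simp
  rw [hτ]
  linear_combination -(Real.cos (θ (c + τ * x)) ^ 2 +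
    Real.sin (θ (c + τ * x)) ^ 2 * (l - q (c + τ * x))) *
      Real.sin_sq_add_cos_sq (θ (c + τ * x))

end IsPruefer

end Pruefer

/-! ### Consequences of a zero-free solution -/

section Riccati

variable {V g : ℝ → ℝ} {s t : ℝ}

/-- Completing the square: `(g φ²)' = φ'² + V φ² - (φ' - g φ)²`, and `g φ²` vanishes at both ends.
Used in the contrapositive: a test function with negative form forces a zero. -/
theorem HasDerivOn.integral_nonneg_of_riccati (hst : s ≤ t)
    (hg : HasDerivOn s t g (fun x => V x - g x ^ 2)) (hV : ContinuousOn V (Icc s t))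
    {φ φ' : ℝ → ℝ} (hφ : HasDerivOn s t φ φ') (hφ' : ContinuousOn φ' (Icc s t))
    (hs : φ s = 0) (ht : φ t = 0) : 0 ≤ ∫ x in s..t, φ' x ^ 2 + V x * φ x ^ 2 := by
  have h1 := hg.mul (hφ.mul hφ)
  have h2 := intervalIntegral.sub_le_integral_of_hasDeriv_right_of_le
    (φ := fun x => φ' x ^ 2 + V x * φ x ^ 2) hst h1.continuousOn
    (fun x hx => (h1.hasDerivAt hx).hasDerivWithinAt)
    (((hφ'.pow 2).add (hV.mul (hφ.continuousOn.pow 2))).integrableOn_Icc)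
    (fun x _ => by nlinarith [sq_nonneg (φ' x - g x * φ x)])
  simpa [hs, ht] using h2

/-- Comparison with the Euler equation. For `h = x g - 1/2` the Riccati equation gives `x h' ≤ -(σ²
+ h²)`, so `arctan (h/σ) + σ log x` is nonincreasing, while the arctangent varies by less than `π`.
-/
theorem HasDerivOn.mul_log_div_lt_pi (hs : 0 < s) (hst : s ≤ t)
    (hg : HasDerivOn s t g (fun x => V x - g x ^ 2)) {σ : ℝ} (hσ : 0 < σ)
    (hV : ∀ x ∈ Icc s t, V x ≤ -(1 / 4 + σ ^ 2) / x ^ 2) : σ * Real.log (t / s) < Real.pi := by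
  have h1 : HasDerivOn s t (fun x => Real.arctan ((x * g x - 1 / 2) / σ) + σ * Real.log x)
      (fun x => 1 / (1 + ((x * g x - 1 / 2) / σ) ^ 2) *
        ((g x + x * (V x - g x ^ 2)) / σ) + σ * x⁻¹) := by
    intro x hx
    have h2 := (((hasDerivWithinAt_id x (Icc s t)).mul (hg x hx)).sub_const (1 / 2)).div_const σ
    have h3 := h2.arctan.add
      ((Real.hasDerivAt_log (hs.trans_le hx.1).ne').hasDerivWithinAt.const_mul σ)
    refine h3.congr_deriv ?_
    simp
  have h2 := h1.antitoneOn (fun x hx => ?_) (left_mem_Icc.2 hst) (right_mem_Icc.2 hst) hst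
  · have h3 := Real.arctan_lt_pi_div_two ((s * g s - 1 / 2) / σ)
    have h4 := Real.neg_pi_div_two_lt_arctan ((t * g t - 1 / 2) / σ)
    rw [Real.log_div (hs.trans_le hst).ne' hs.ne']
    simp only at h2
    linarith
  · have hx0 : 0 < x := hs.trans hx.1
    have h3 := hV x (Ioo_subset_Icc_self hx)
    rw [le_div_iff₀ (by positivity)] at h3
    have h5 : 1 / (1 + ((x * g x - 1 / 2) / σ) ^ 2) * ((g x + x * (V x - g x ^ 2)) / σ) + σ * x⁻¹
        = σ * (x * (g x + x * (V x - g x ^ 2)) + (σ ^ 2 + (x * g x - 1 / 2) ^ 2)) /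
          (x * (σ ^ 2 + (x * g x - 1 / 2) ^ 2)) := by
      have : σ ^ 2 + (x * g x - 1 / 2) ^ 2 ≠ 0 := by positivity
      field_simp
    rw [h5]
    apply div_nonpos_of_nonpos_of_nonneg _ (by positivity)
    apply mul_nonpos_of_nonneg_of_nonpos hσ.le
    nlinarith

end Riccati

/-! ### Zero counting and the sequence of eigenvalues -/

section Sequence

variable {q : ℝ → ℝ}

theorem IsPruefer.exists_sin_eq_zero {l : ℝ} {θ : ℝ → ℝ} (h : IsPruefer a b q l θ)
    {s t c τ σ : ℝ} (hτ : τ ^ 2 = 1) (hs : 0 < s) (hst : s ≤ t) (hσ : 0 < σ)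
    (hlog : Real.pi ≤ σ * Real.log (t / s))
    (hm : ∀ x ∈ Icc s t, c + τ * x ∈ Icc a b)
    (hV : ∀ x ∈ Icc s t, q (c + τ * x) - l ≤ -(1 / 4 + σ ^ 2) / x ^ 2) :
    ∃ x ∈ Icc s t, Real.sin (θ (c + τ * x)) = 0 := by
  by_contra! hne
  obtain ⟨g, hg⟩ := h.exists_riccati hτ hm hne
  have := HasDerivOn.mul_log_div_lt_pi (V := fun x => q (c + τ * x) - l) hs hst hg hσ hV
  linarith

/-- If the potential lies below a supercritical inverse square potential on a long enough
(logarithmic) interval, then the solution has many zeros. -/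
theorem IsPruefer.mul_pi_le_of_hardy (hab : a < b) {l : ℝ} {θ : ℝ → ℝ} (h : IsPruefer a b q l θ)
    (hq : ContinuousOn q (Icc a b)) {c τ σ r : ℝ} (hτ : τ ^ 2 = 1) (hr : 0 < r) (hσ : 0 < σ)
    (n : ℕ)
    (hm : ∀ x ∈ Icc (r * Real.exp (-(2 * n * (Real.pi / σ)))) r, c + τ * x ∈ Ioc a b)
    (hV : ∀ x ∈ Icc (r * Real.exp (-(2 * n * (Real.pi / σ)))) r,
      q (c + τ * x) - l ≤ -(1 / 4 + σ ^ 2) / x ^ 2) : n * Real.pi ≤ θ b := by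
  have hp : 0 < Real.pi / σ := div_pos Real.pi_pos hσ
  -- Each interval `[s i, t i]` has logarithmic length `π/σ`, just enough to force a zero. Gaps of
  -- the same length between them make the zeros distinct.
  let s : ℕ → ℝ := fun i => r * Real.exp (-((2 * i + 1) * (Real.pi / σ)))
  let t : ℕ → ℝ := fun i => r * Real.exp (-(2 * i * (Real.pi / σ)))
  have hst : ∀ i, s i ≤ t i := fun i =>
    mul_le_mul_of_nonneg_left (Real.exp_le_exp.2 (by nlinarith)) hr.le
  have hts : ∀ i j, i < j → t j < s i := by
    intro i j hij
    have : (i : ℝ) + 1 ≤ j := by exact_mod_cast hij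
    exact mul_lt_mul_of_pos_left (Real.exp_lt_exp.2 (by nlinarith)) hr
  have hsub : ∀ i < n, Icc (s i) (t i) ⊆ Icc (r * Real.exp (-(2 * n * (Real.pi / σ)))) r := by
    intro i hi
    have : (i : ℝ) + 1 ≤ n := by exact_mod_cast hi
    refine Icc_subset_Icc (mul_le_mul_of_nonneg_left (Real.exp_le_exp.2 (by nlinarith)) hr.le) ?_
    have : Real.exp (-(2 * i * (Real.pi / σ))) ≤ 1 := Real.exp_le_one_iff.2 (by
      have : (0 : ℝ) ≤ i := Nat.cast_nonneg i
      nlinarith)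
    simpa [t] using mul_le_mul_of_nonneg_left this hr.le
  have hz : ∀ i < n, ∃ x ∈ Icc (s i) (t i), Real.sin (θ (c + τ * x)) = 0 := by
    intro i hi
    refine h.exists_sin_eq_zero hτ (by positivity) (hst i) hσ ?_
      (fun x hx => Ioc_subset_Icc_self (hm x (hsub i hi hx))) (fun x hx => hV x (hsub i hi hx))
    have : t i / s i = Real.exp (Real.pi / σ) := by
      rw [div_eq_iff (by positivity)]
      simp only [t, s]
      rw [mul_left_comm, ← Real.exp_add]
      ring_nf
    rw [this, Real.log_exp, mul_div_cancel₀ _ hσ.ne']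
  choose! x hx hx0 using hz
  have hinj : Set.InjOn (fun i => c + τ * x i) (Finset.range n : Set ℕ) := by
    have key : ∀ i < n, ∀ j < n, i < j → x j < x i := fun i hi j hj hij =>
      (hx j hj).2.trans_lt ((hts i j hij).trans_le (hx i hi).1)
    intro i hi j hj hij
    simp only [Finset.coe_range, mem_Iio] at hi hj
    have hτ0 : τ ≠ 0 := by rintro rfl; norm_num at hτ
    have hxx : x i = x j := mul_left_cancel₀ hτ0 (add_left_cancel hij)
    rcases lt_trichotomy i j with h1 | h1 | h1
    · exact absurd hxx (key i hi j hj h1).ne'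
    · exact h1
    · exact absurd hxx (key j hj i hi h1).ne
  have := h.card_mul_pi_le hab hq ((Finset.range n).image fun i => c + τ * x i) (by
    intro y hy
    obtain ⟨i, hi, rfl⟩ := Finset.mem_image.1 hy
    rw [Finset.mem_range] at hi
    exact ⟨hm _ (hsub i hi (hx i hi)), hx0 i hi⟩)
  rwa [Finset.card_image_of_injOn hinj, Finset.card_range] at this

/-- `Θ m` is an approximate trajectory, with error `|m - l|`, of the equation at `l` with the same
initial value; Grönwall's inequality concludes. -/
theorem IsPruefer.continuous_param (hab : a ≤ b) (hq : ContinuousOn q (Icc a b)) {Θ : ℝ → ℝ → ℝ}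
    (h : ∀ l, IsPruefer a b q l (Θ l)) : Continuous fun l => Θ l b := by
  rw [continuous_iff_continuousAt]
  intro l
  obtain ⟨M, hM0, hM⟩ := exists_abs_sub_le hq l
  have hd : ∀ m, dist (Θ m b) (Θ l b) ≤
      gronwallBound 0 (Real.toNNReal (1 + M)) (|m - l| + 0) (b - a) := by
    intro m
    refine dist_le_of_approx_trajectories_ODE_of_mem (s := fun _ => univ)
      (v := fun x θ => Real.cos θ ^ 2 + (l - q x) * Real.sin θ ^ 2)
      (fun t ht => (lipschitzWith_pruefer l (q t) M (hM t (Ico_subset_Icc_self ht))).lipschitzOnWith)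
      (h m).continuousOn (fun t ht => (h m).deriv.hasDerivWithinAt_Ici ht) (fun t _ => ?_)
      (fun _ _ => trivial) (h l).continuousOn (fun t ht => (h l).deriv.hasDerivWithinAt_Ici ht)
      (fun t _ => ?_) (fun _ _ => trivial) (by simp [(h m).left, (h l).left]) b
      (right_mem_Icc.2 hab)
    · rw [Real.dist_eq]
      have : Real.cos (Θ m t) ^ 2 + (m - q t) * Real.sin (Θ m t) ^ 2 -
          (Real.cos (Θ m t) ^ 2 + (l - q t) * Real.sin (Θ m t) ^ 2) =
          (m - l) * Real.sin (Θ m t) ^ 2 := by ring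
      rw [this, abs_mul, abs_of_nonneg (sq_nonneg (Real.sin _))]
      exact mul_le_of_le_one_right (abs_nonneg _) (Real.sin_sq_le_one _)
    · simp
  have hlim : Tendsto (fun m => gronwallBound 0 (Real.toNNReal (1 + M)) (|m - l| + 0) (b - a))
      (𝓝 l) (𝓝 0) := by
    have hc : Continuous fun m : ℝ =>
        gronwallBound 0 (Real.toNNReal (1 + M)) (|m - l| + 0) (b - a) :=
      (gronwallBound_continuous_ε _ _ _).comp (by fun_prop)
    have := hc.tendsto l
    simpa [gronwallBound_ε0_δ0] using this
  exact tendsto_iff_dist_tendsto_zero.2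
    (squeeze_zero (fun _ => dist_nonneg) hd hlim)

/-- The angle at `b` is a continuous, strictly increasing, unbounded function of `l` that starts
below `π`, so it takes each value `(n + 1)π` exactly once. The last clause turns lower bounds on the
angle into upper bounds on eigenvalues. -/
theorem exists_eigenvalue_seq (hab : a < b) (hq : ContinuousOn q (Icc a b)) :
    ∃ e : ℕ → ℝ, StrictMono e ∧
      (∀ l, (∃ φ φ', IsEigenfunction a b q l φ φ') ↔ l ∈ range e) ∧
      ∀ n l θ, IsPruefer a b q l θ → ((n + 1 : ℕ) : ℝ) * Real.pi ≤ θ b → e n ≤ l := by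
  choose Θ hΘ using exists_isPruefer hab.le hq
  have hcont := IsPruefer.continuous_param hab.le hq hΘ
  have hmono : StrictMono fun l => Θ l b := fun l m hlm => (hΘ l).lt_of_lt hab (hΘ m) hq hlm
  obtain ⟨M, hM⟩ := isCompact_Icc.exists_bound_of_continuousOn hq
  have hM0 : 0 ≤ M := (norm_nonneg _).trans (hM a (left_mem_Icc.2 hab.le))
  have hlow : Θ (-M) b ≤ Real.pi / 2 := (hΘ (-M)).le_pi_div_two hab.le fun x hx =>
    (abs_le.1 (hM x hx)).1
  have hhigh : ∀ n : ℕ, ∃ l, n * Real.pi ≤ Θ l b := by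
    intro n
    let s := (b - a) * Real.exp (-(2 * n * (Real.pi / 1)))
    have hs : 0 < s := mul_pos (by linarith) (Real.exp_pos _)
    -- At this level `q - l ≤ -(5/4)/x²` for all `x ≥ s`, so the zero count applies with `σ = 1`.
    refine ⟨M + (1 / 4 + 1 ^ 2) / s ^ 2, ?_⟩
    have hm : ∀ x ∈ Icc s (b - a), a + 1 * x ∈ Ioc a b := fun x hx =>
      ⟨by linarith [hs.trans_le hx.1], by linarith [hx.2]⟩
    refine (hΘ _).mul_pi_le_of_hardy hab hq (c := a) (τ := 1) (σ := 1) (by norm_num)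
      (sub_pos.2 hab) one_pos n hm (fun x hx => ?_)
    have h1 := (abs_le.1 (hM _ (Ioc_subset_Icc_self (hm x hx)))).2
    have h2 : (1 / 4 + 1 ^ 2) / x ^ 2 ≤ (1 / 4 + 1 ^ 2) / s ^ 2 := by
      have := hx.1
      gcongr
    rw [neg_div]
    linarith
  have hsurj : ∀ n : ℕ, ∃ l, Θ l b = ((n + 1 : ℕ) : ℝ) * Real.pi := by
    intro n
    obtain ⟨L, hL⟩ := hhigh (n + 1)
    have h1 : Θ (-M) b ≤ ((n + 1 : ℕ) : ℝ) * Real.pi := by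
      have : (0 : ℝ) ≤ n := Nat.cast_nonneg n
      push_cast
      nlinarith [Real.pi_pos]
    exact mem_range_of_exists_le_of_exists_ge hcont ⟨_, h1⟩ ⟨_, hL⟩
  choose e he using hsurj
  refine ⟨e, ?_, ?_, ?_⟩
  · intro m n hmn
    rw [← hmono.lt_iff_lt]
    simp only [he]
    have : (m : ℝ) < n := by exact_mod_cast hmn
    exact mul_lt_mul_of_pos_right (by push_cast; linarith) Real.pi_pos
  · intro l
    constructor
    · rintro ⟨φ, φ', hφ⟩
      obtain ⟨k, hk⟩ := Real.sin_eq_zero_iff.1 ((hΘ l).sin_eq_zero_of_isEigenfunction hq hφ)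
      have hpos := (hΘ l).pos hq hab le_rfl
      rw [← hk] at hpos
      have hk0 : 0 < k := by exact_mod_cast pos_of_mul_pos_left hpos Real.pi_pos.le
      obtain ⟨n, rfl⟩ : ∃ n : ℕ, k = (n + 1 : ℕ) := ⟨(k - 1).toNat, by omega⟩
      refine ⟨n, hmono.injective ?_⟩
      simp only [he, ← hk]
      push_cast; rfl
    · rintro ⟨n, rfl⟩
      refine (hΘ (e n)).exists_isEigenfunction hab hq ?_
      rw [he]
      exact Real.sin_nat_mul_pi _
  · intro n l θ hθ hn
    have : θ b = Θ l b := by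
      by_contra hne
      have hEq := ODE_solution_unique_of_mem_Icc_right (s := fun _ => univ) (K := _)
        (v := fun x θ => Real.cos θ ^ 2 + (l - q x) * Real.sin θ ^ 2) (f := θ) (g := Θ l)
        (fun t ht => (lipschitzWith_pruefer l (q t) _
          ((exists_abs_sub_le hq l).choose_spec.2 t (Ico_subset_Icc_self ht))).lipschitzOnWith)
        hθ.continuousOn (fun t ht => hθ.deriv.hasDerivWithinAt_Ici ht) (fun _ _ => trivial)
        (hΘ l).continuousOn (fun t ht => (hΘ l).deriv.hasDerivWithinAt_Ici ht)
        (fun _ _ => trivial) (by rw [hθ.left, (hΘ l).left])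
      exact hne (hEq (right_mem_Icc.2 hab.le))
    rw [← hmono.le_iff_le]
    simp only [he]
    rwa [← this]

end Sequence

/-! ### Lower bounds for eigenvalues by a dimension count -/

theorem intervalIntegrable_finsetSum {ι : Type*} (s : Finset ι) {f : ι → ℝ → ℝ}
    (h : ∀ i ∈ s, IntervalIntegrable (f i) volume a b) :
    IntervalIntegrable (fun x => ∑ i ∈ s, f i x) volume a b := by
  simpa only [Finset.sum_fn] using IntervalIntegrable.sum s h

section LowerBound

variable {q : ℝ → ℝ}

theorem IsEigenfunction.continuousOn_deriv {l : ℝ} {φ φ' : ℝ → ℝ}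
    (h : IsEigenfunction a b q l φ φ') : ContinuousOn φ' (Icc a b) := h.deriv₂.continuousOn

theorem IsEigenfunction.integral_mul (hab : a ≤ b) (hq : ContinuousOn q (Icc a b)) {l m : ℝ}
    {φ φ' χ χ' : ℝ → ℝ} (hφ : IsEigenfunction a b q l φ φ') (hχ : IsEigenfunction a b q m χ χ') :
    ∫ x in a..b, φ' x * χ' x + q x * (φ x * χ x) = l * ∫ x in a..b, φ x * χ x := by
  have h1 := (hφ.deriv₂.mul hχ.deriv)
  have c1 := hφ.deriv.continuousOn
  have c2 := hχ.deriv.continuousOn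
  have c3 := hφ.continuousOn_deriv
  have c4 := hχ.continuousOn_deriv
  have h2 := h1.integral_eq hab ((((hq.sub continuousOn_const).mul c1).mul c2).add (c3.mul c4))
  rw [hχ.left, hχ.right, mul_zero, mul_zero, sub_zero] at h2
  rw [← intervalIntegral.integral_const_mul, ← sub_eq_zero, ← intervalIntegral.integral_sub]
  · rw [← h2]
    congr 1; ext x; ring
  · exact ((c3.mul c4).add (hq.mul (c1.mul c2))).intervalIntegrable_of_Icc hab
  · exact (continuousOn_const.mul (c1.mul c2)).intervalIntegrable_of_Icc hab

theorem IsEigenfunction.integral_sq_pos (hab : a < b) {l : ℝ} {φ φ' : ℝ → ℝ}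
    (hφ : IsEigenfunction a b q l φ φ') : 0 < ∫ x in a..b, φ x * φ x := by
  obtain ⟨c, hc, hne⟩ := hφ.ne_zero
  exact intervalIntegral.integral_pos hab (hφ.deriv.continuousOn.mul hφ.deriv.continuousOn)
    (fun x _ => mul_self_nonneg _) ⟨c, hc, mul_self_pos.2 hne⟩

/-- If the quadratic form is bounded below by `-C` on the functions which vanish at finitely many
points, then so is the corresponding eigenvalue. -/
theorem neg_le_of_form_bound (hab : a < b) (hq : ContinuousOn q (Icc a b)) {e : ℕ → ℝ}
    (he : StrictMono e) (hev : ∀ n, ∃ φ φ', IsEigenfunction a b q (e n) φ φ') (P : Finset ℝ)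
    (C : ℝ)
    (hform : ∀ φ φ', HasDerivOn a b φ φ' → ContinuousOn φ' (Icc a b) → φ a = 0 → φ b = 0 →
      (∀ x ∈ P, φ x = 0) →
      -C * ∫ x in a..b, φ x ^ 2 ≤ ∫ x in a..b, φ' x ^ 2 + q x * φ x ^ 2) :
    -C ≤ e P.card := by
  -- If `e m < -C`, the form is strictly below `-C ‖·‖²` on nonzero elements of the span of the
  -- first `m + 1` eigenfunctions. That span contains a nonzero function vanishing at the `m`
  -- points.
  by_contra! hlt
  choose φ φ' hφ using hev
  set m := P.card with hm
  -- a nontrivial combination of `m + 1` eigenfunctions vanishes at the `m` points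
  obtain ⟨α, hα0, hα⟩ : ∃ α : Fin (m + 1) → ℝ, α ≠ 0 ∧ ∀ p ∈ P, ∑ i, α i * φ i p = 0 := by
    let T := Matrix.mulVecLin (Matrix.of fun (p : P) (i : Fin (m + 1)) => φ i p)
    have hT : LinearMap.ker T ≠ ⊥ := LinearMap.ker_ne_bot_of_finrank_lt (by simp [hm])
    obtain ⟨α, hα, hα0⟩ := Submodule.exists_mem_ne_zero_of_ne_bot hT
    refine ⟨α, hα0, fun p hp => ?_⟩
    have := congrFun (LinearMap.mem_ker.1 hα) ⟨p, hp⟩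
    simpa [T, Matrix.mulVec, dotProduct, mul_comm] using this
  have hint : ∀ i j, IntervalIntegrable (fun x => φ i x * φ j x) volume a b := fun i j =>
    ((hφ i).deriv.continuousOn.mul (hφ j).deriv.continuousOn).intervalIntegrable_of_Icc hab.le
  have hint' : ∀ i j, IntervalIntegrable
      (fun x => φ' i x * φ' j x + q x * (φ i x * φ j x)) volume a b := fun i j =>
    (((hφ i).continuousOn_deriv.mul (hφ j).continuousOn_deriv).add
      (hq.mul ((hφ i).deriv.continuousOn.mul (hφ j).deriv.continuousOn))).intervalIntegrable_of_Icc
        hab.le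
  have horth : ∀ i j, i ≠ j → ∫ x in a..b, φ i x * φ j x = 0 := by
    intro i j hij
    have h1 := (hφ i).integral_mul hab.le hq (hφ j)
    have h2 := (hφ j).integral_mul hab.le hq (hφ i)
    simp only [mul_comm (φ' j _), mul_comm (φ j _)] at h2
    have h3 : (e i - e j) * ∫ x in a..b, φ i x * φ j x = 0 := by rw [sub_mul, ← h1, ← h2, sub_self]
    exact (mul_eq_zero.1 h3).resolve_left (sub_ne_zero.2 (he.injective.ne hij))
  have hderiv : HasDerivOn a b (fun x => ∑ i : Fin (m + 1), α i * φ i x)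
      (fun x => ∑ i : Fin (m + 1), α i * φ' i x) := fun x hx =>
    HasDerivWithinAt.fun_sum fun i _ => ((hφ i).deriv x hx).const_mul (α i)
  have h1 := hform _ _ hderiv
    (continuousOn_finsetSum _ fun i _ => continuousOn_const.mul (hφ i).continuousOn_deriv)
    (by simp [(hφ _).left]) (by simp [(hφ _).right]) hα
  have hsq : ∫ x in a..b, (∑ i : Fin (m + 1), α i * φ i x) ^ 2 =
      ∑ i : Fin (m + 1), ∑ j : Fin (m + 1), α i * α j * ∫ x in a..b, φ i x * φ j x := by
    simp_rw [← intervalIntegral.integral_const_mul]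
    rw [← intervalIntegral.integral_congr (f := fun x => ∑ i : Fin (m + 1), ∑ j : Fin (m + 1),
      α i * α j * (φ i x * φ j x)), intervalIntegral.integral_finsetSum]
    · refine Finset.sum_congr rfl fun i _ => ?_
      rw [intervalIntegral.integral_finsetSum]
      exact fun j _ => (hint i j).const_mul _
    · exact fun i _ => intervalIntegrable_finsetSum _ fun j _ => (hint i j).const_mul _
    · intro x _
      simp only [sq, Finset.sum_mul_sum]
      exact Finset.sum_congr rfl fun i _ => Finset.sum_congr rfl fun j _ => by ring
  have hfo : ∫ x in a..b, (∑ i : Fin (m + 1), α i * φ' i x) ^ 2 +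
        q x * (∑ i : Fin (m + 1), α i * φ i x) ^ 2 =
      ∑ i : Fin (m + 1), ∑ j : Fin (m + 1), α i * α j * (e i * ∫ x in a..b, φ i x * φ j x) := by
    simp_rw [← (hφ _).integral_mul hab.le hq (hφ _), ← intervalIntegral.integral_const_mul]
    rw [← intervalIntegral.integral_congr (f := fun x => ∑ i : Fin (m + 1), ∑ j : Fin (m + 1),
      α i * α j * (φ' i x * φ' j x + q x * (φ i x * φ j x))),
      intervalIntegral.integral_finsetSum]
    · refine Finset.sum_congr rfl fun i _ => ?_
      rw [intervalIntegral.integral_finsetSum]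
      exact fun j _ => (hint' i j).const_mul _
    · exact fun i _ => intervalIntegrable_finsetSum _ fun j _ => (hint' i j).const_mul _
    · intro x _
      simp only [sq, Finset.sum_mul_sum]
      rw [Finset.mul_sum, ← Finset.sum_add_distrib]
      refine Finset.sum_congr rfl fun i _ => ?_
      rw [Finset.mul_sum, ← Finset.sum_add_distrib]
      exact Finset.sum_congr rfl fun j _ => by ring
  -- Orthogonality diagonalises both double sums: `w = e` gives the form and `w = 1` the squared
  -- norm.
  have hdiag : ∀ (w : Fin (m + 1) → ℝ), ∑ i : Fin (m + 1), ∑ j : Fin (m + 1),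
      α i * α j * (w i * ∫ x in a..b, φ i x * φ j x) =
      ∑ i : Fin (m + 1), α i ^ 2 * (w i * ∫ x in a..b, φ i x * φ i x) := by
    intro w
    refine Finset.sum_congr rfl fun i _ => ?_
    rw [Finset.sum_eq_single i]
    · ring
    · intro j _ hji
      rw [horth i j fun h => hji (Fin.ext h).symm]; ring
    · simp
  rw [hsq, hfo, hdiag] at h1
  have h2 := hdiag fun _ => 1
  simp only [one_mul] at h2
  rw [h2, Finset.mul_sum] at h1
  obtain ⟨i₀, hi₀⟩ := Function.ne_iff.1 hα0
  refine absurd h1 (not_le.2 (Finset.sum_lt_sum (fun i _ => ?_) ⟨i₀, Finset.mem_univ _, ?_⟩))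
  · have h3 : e i < -C := (he.monotone (Nat.lt_succ_iff.1 i.2)).trans_lt hlt
    have h4 := (hφ i).integral_sq_pos hab
    have : 0 ≤ α i ^ 2 * ((-C - e i) * ∫ x in a..b, φ i x * φ i x) :=
      mul_nonneg (sq_nonneg _) (mul_nonneg (by linarith) h4.le)
    linarith
  · have h3 : e i₀ < -C := (he.monotone (Nat.lt_succ_iff.1 i₀.2)).trans_lt hlt
    have h4 := (hφ i₀).integral_sq_pos hab
    have h5 : 0 < α i₀ ^ 2 := by have := hi₀; simp only [Pi.zero_apply] at this; positivity
    have : 0 < α i₀ ^ 2 * ((-C - e i₀) * ∫ x in a..b, φ i₀ x * φ i₀ x) :=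
      mul_pos h5 (mul_pos (by linarith) h4)
    linarith

end LowerBound

/-! ### Identification of `eig` with the classical eigenvalues -/

/-- At least `n + 1` eigenvalues are `≤ Λ` exactly when `e n ≤ Λ`; the shift arises because `eig`
counts from one and `e` from zero. -/
theorem eig_eq_of_seq {y₁ y₂ : ℝ} {u : ℝ → ℝ} {β c : ℝ} {e : ℕ → ℝ} (he : StrictMono e)
    (hr : range e = {μ | IsEigenvalue y₁ y₂ u β c μ}) (n : ℕ) : eig y₁ y₂ u β (n + 1) c = e n := by
  have : {Λ : ℝ | ∃ s : Finset ℝ, s.card = n + 1 ∧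
      ∀ x ∈ s, IsEigenvalue y₁ y₂ u β c x ∧ x ≤ Λ} = Ici (e n) := by
    ext Λ
    constructor
    · rintro ⟨s, hs, hsΛ⟩
      by_contra hcon
      rw [mem_Ici, not_le] at hcon
      have hsub : s ⊆ (Finset.range n).image e := by
        intro x hx
        obtain ⟨k, rfl⟩ : x ∈ range e := by rw [hr]; exact (hsΛ x hx).1
        have := he.lt_iff_lt.1 ((hsΛ _ hx).2.trans_lt hcon)
        exact Finset.mem_image_of_mem _ (Finset.mem_range.2 this)
      have := (Finset.card_le_card hsub).trans Finset.card_image_le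
      rw [hs, Finset.card_range] at this
      omega
    · intro h
      refine ⟨(Finset.range (n + 1)).image e, ?_, fun x hx => ?_⟩
      · rw [Finset.card_image_of_injective _ he.injective, Finset.card_range]
      · obtain ⟨k, hk, rfl⟩ := Finset.mem_image.1 hx
        rw [Finset.mem_range, Nat.lt_succ_iff] at hk
        refine ⟨?_, (he.monotone hk).trans h⟩
        have : e k ∈ range e := mem_range_self k
        rwa [hr] at this
  rw [eig, this, csInf_Ici]

theorem HasDerivOn.derivWithin_eq (hab : a < b) {f f' : ℝ → ℝ} (h : HasDerivOn a b f f') {x : ℝ}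
    (hx : x ∈ Icc a b) : derivWithin f (Icc a b) x = f' x :=
  (h x hx).derivWithin (uniqueDiffOn_Icc hab x hx)

/-- Regularity: `ψ` agrees almost everywhere with the continuous function `(q - l) φ`, so `φ'` is a
classical primitive of it. -/
theorem isEigenvalue_iff {y₁ y₂ : ℝ} (hy : y₁ < y₂) {u : ℝ → ℝ} {β c : ℝ}
    (hq : ContinuousOn (fun y => (d2 y₁ y₂ u y - β) / (u y - c)) (Icc y₁ y₂)) (l : ℝ) :
    IsEigenvalue y₁ y₂ u β c l ↔
      ∃ φ φ', IsEigenfunction y₁ y₂ (fun y => (d2 y₁ y₂ u y - β) / (u y - c)) l φ φ' := by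
  constructor
  · rintro ⟨φ, ψ, ⟨hc, -, hψ⟩, h1, h2, h3, hae⟩
    have hφ : HasDerivOn y₁ y₂ φ (derivWithin φ (Icc y₁ y₂)) := fun x hx =>
      ((hc.differentiableOn (by simp)) x hx).hasDerivWithinAt
    refine ⟨φ, derivWithin φ (Icc y₁ y₂), hφ, ?_, h1, h2, h3⟩
    have hA : ContinuousOn (fun x => ((d2 y₁ y₂ u x - β) / (u x - c) - l) * φ x) (Icc y₁ y₂) :=
      (hq.sub continuousOn_const).mul hφ.continuousOn
    obtain ⟨B, hB⟩ := exists_hasDerivOn hA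
    have key : ∀ y ∈ Icc y₁ y₂, derivWithin φ (Icc y₁ y₂) y =
        (derivWithin φ (Icc y₁ y₂) y₁ - B y₁) + B y := by
      intro y hy'
      have h4 := hψ y hy'
      rw [iteratedDerivWithin_one] at h4
      rw [h4]
      have h5 := (hB.mono le_rfl hy'.2).integral_eq hy'.1 (hA.mono (Icc_subset_Icc_right hy'.2))
      have h6 : ∫ t in y₁..y, ψ t = B y - B y₁ := by
        rw [← h5]
        refine intervalIntegral.integral_congr_ae_restrict ?_
        rw [uIoc_of_le hy'.1]
        have hsub : Ioc y₁ y ⊆ Icc y₁ y₂ := Ioc_subset_Icc_self.trans (Icc_subset_Icc_right hy'.2)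
        filter_upwards [ae_restrict_of_ae_restrict_of_subset hsub hae] with x hx
        linear_combination -hx
      rw [h6]; ring
    intro x hx
    exact ((hB x hx).const_add _).congr key (key x hx)
  · rintro ⟨φ, φ', h⟩
    have hA : ContinuousOn (fun x => ((d2 y₁ y₂ u x - β) / (u x - c) - l) * φ x) (Icc y₁ y₂) :=
      (hq.sub continuousOn_const).mul h.deriv.continuousOn
    have hd : ∀ x ∈ Icc y₁ y₂, derivWithin φ (Icc y₁ y₂) x = φ' x :=
      fun x hx => h.deriv.derivWithin_eq hy hx
    refine ⟨φ, fun x => ((d2 y₁ y₂ u x - β) / (u x - c) - l) * φ x, ⟨?_, ?_, ?_⟩, h.left, h.right,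
      h.ne_zero, ae_of_all _ fun x => by ring⟩
    · rw [Nat.cast_one, contDiffOn_one_iff_derivWithin (uniqueDiffOn_Icc hy)]
      exact ⟨fun x hx => (h.deriv x hx).differentiableWithinAt,
        h.continuousOn_deriv.congr hd⟩
    · obtain ⟨M, hM⟩ := isCompact_Icc.exists_bound_of_continuousOn hA
      refine MemLp.of_bound (hA.aestronglyMeasurable measurableSet_Icc) M ?_
      exact (ae_restrict_iff' measurableSet_Icc).2 (ae_of_all _ hM)
    · intro y hy'
      rw [iteratedDerivWithin_one, hd y hy', hd y₁ (left_mem_Icc.2 hy.le),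
        (h.deriv₂.mono le_rfl hy'.2).integral_eq hy'.1 (hA.mono (Icc_subset_Icc_right hy'.2))]
      ring

/-! ### Regularity and Taylor expansions of the profile -/

theorem HasDerivOn.abs_sub_le {f f' : ℝ → ℝ} (h : HasDerivOn a b f f') {c y B : ℝ}
    (hc : c ∈ Icc a b) (hy : y ∈ Icc a b)
    (hB : ∀ x ∈ Icc a b, |x - c| ≤ |y - c| → |f' x| ≤ B) : |f y - f c| ≤ B * |y - c| := by
  have hsub : uIcc c y ⊆ Icc a b := uIcc_subset_Icc hc hy
  have := (convex_uIcc c y).norm_image_sub_le_of_norm_hasDerivWithin_le (f := f) (f' := f')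
    (C := B) (fun x hx => (h x (hsub hx)).mono hsub) (fun x hx => ?_) left_mem_uIcc right_mem_uIcc
  · simpa [Real.norm_eq_abs] using this
  · exact hB x (hsub hx) (abs_sub_left_of_mem_uIcc hx)

/-- `u` is `C³` on `[a,b]` with derivatives `u₁`, `u₂`, `u₃`, where `u₃` is Hölder continuous of
exponent `1/2`. -/
structure IsProfile (a b : ℝ) (u u₁ u₂ u₃ : ℝ → ℝ) : Prop where
  lt : a < b
  deriv₁ : HasDerivOn a b u u₁
  deriv₂ : HasDerivOn a b u₁ u₂
  deriv₃ : HasDerivOn a b u₂ u₃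
  continuousOn₃ : ContinuousOn u₃ (Icc a b)
  holder : ∃ K, 0 ≤ K ∧ ∀ x ∈ Icc a b, ∀ y ∈ Icc a b, |u₃ y - u₃ x| ≤ K * √|y - x|
  nondegenerate : ∀ x ∈ Icc a b, u₁ x = 0 → u₂ x ≠ 0

/-- The embedding of `H¹` into Hölder functions of exponent `1/2`. In place of Cauchy–Schwarz, `|g|
≤ τ g²/2 + 1/(2τ)` is integrated with `τ = √(y - x)`. -/
theorem exists_holder_of_sobolev {f g : ℝ → ℝ} (hg : MemLp g 2 (volume.restrict (Icc a b)))
    (hf : ∀ y ∈ Icc a b, f y = f a + ∫ t in a..y, g t) :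
    ∃ K, 0 ≤ K ∧ ∀ x ∈ Icc a b, ∀ y ∈ Icc a b, |f y - f x| ≤ K * √|y - x| := by
  have hg2 : IntegrableOn (fun t => g t ^ 2) (Icc a b) := hg.integrable_sq
  have hg1 : IntegrableOn g (Icc a b) := hg.integrable (by norm_num)
  set G := ∫ t in Icc a b, g t ^ 2 with hG
  have hG0 : 0 ≤ G := integral_nonneg fun _ => sq_nonneg _
  refine ⟨(G + 1) / 2, by positivity, ?_⟩
  have key : ∀ x ∈ Icc a b, ∀ y ∈ Icc a b, x < y → |f y - f x| ≤ (G + 1) / 2 * √|y - x| := by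
    intro x hx y hy hxy
    have hsub : Icc x y ⊆ Icc a b := Icc_subset_Icc hx.1 hy.2
    have hI : ∀ {s t : ℝ}, s ∈ Icc a b → t ∈ Icc a b → IntervalIntegrable g volume s t := by
      intro s t hs ht
      exact (hg1.mono_set (uIcc_subset_Icc hs ht)).intervalIntegrable
    have ha : a ∈ Icc a b := ⟨le_rfl, hx.1.trans hx.2⟩
    have h1 : f y - f x = ∫ t in x..y, g t := by
      rw [hf y hy, hf x hx, ← intervalIntegral.integral_interval_sub_left (hI ha hy) (hI ha hx)]
      ring
    set τ := √(y - x) with hτ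
    have hτ0 : 0 < τ := Real.sqrt_pos.2 (sub_pos.2 hxy)
    have hτ2 : τ ^ 2 = y - x := Real.sq_sqrt (sub_pos.2 hxy).le
    have hi2 : IntervalIntegrable (fun t => g t ^ 2) volume x y :=
      (hg2.mono_set (by rwa [uIcc_of_le hxy.le])).intervalIntegrable
    have h2 : |f y - f x| ≤ ∫ t in x..y, (τ / 2 * g t ^ 2 + 1 / (2 * τ)) := by
      rw [h1]
      refine (intervalIntegral.abs_integral_le_integral_abs hxy.le).trans
        (intervalIntegral.integral_mono_on hxy.le (hI hx hy).abs
          ((hi2.const_mul _).add intervalIntegrable_const) fun t _ => ?_)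
      have h3 : 0 ≤ (τ * |g t| - 1) ^ 2 / (2 * τ) := by positivity
      have h4 : (τ * |g t| - 1) ^ 2 / (2 * τ) = τ / 2 * |g t| ^ 2 + 1 / (2 * τ) - |g t| := by
        field_simp; ring
      rw [sq_abs] at h4
      linarith
    rw [intervalIntegral.integral_add (hi2.const_mul _) intervalIntegrable_const,
      intervalIntegral.integral_const_mul, intervalIntegral.integral_const, smul_eq_mul, ← hτ2] at h2
    have h5 : ∫ t in x..y, g t ^ 2 ≤ G := by
      rw [intervalIntegral.integral_of_le hxy.le]
      exact setIntegral_mono_set hg2 (ae_of_all _ fun _ => sq_nonneg _)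
        (Ioc_subset_Icc_self.trans hsub).eventuallyLE
    rw [abs_of_pos (sub_pos.2 hxy), ← hτ]
    have h6 : τ ^ 2 * (1 / (2 * τ)) = τ / 2 := by field_simp
    rw [h6] at h2
    have h7 := mul_le_mul_of_nonneg_left h5 (by positivity : 0 ≤ τ / 2)
    linarith
  intro x hx y hy
  rcases lt_trichotomy x y with h | h | h
  · exact key x hx y hy h
  · simp [h]
  · rw [abs_sub_comm, abs_sub_comm y x]; exact key y hy x hx h

theorem H1.isProfile {y₁ y₂ : ℝ} (hy : y₁ < y₂) {u : ℝ → ℝ} (hu : H1 y₁ y₂ u) :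
    IsProfile y₁ y₂ u (d1 y₁ y₂ u) (d2 y₁ y₂ u) (iteratedDerivWithin 3 u (Icc y₁ y₂)) := by
  obtain ⟨⟨g, hc, hg, hint⟩, hnd⟩ := hu
  have hU := uniqueDiffOn_Icc hy
  have hD : ∀ k : ℕ, k < 3 → HasDerivOn y₁ y₂ (iteratedDerivWithin k u (Icc y₁ y₂))
      (iteratedDerivWithin (k + 1) u (Icc y₁ y₂)) := by
    intro k hk x hx
    rw [iteratedDerivWithin_succ]
    exact (hc.differentiableOn_iteratedDerivWithin (by exact_mod_cast hk) hU x hx).hasDerivWithinAt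
  refine ⟨hy, ?_, ?_, hD 2 (by norm_num), hc.continuousOn_iteratedDerivWithin le_rfl hU,
    exists_holder_of_sobolev hg hint, hnd⟩
  · have := hD 0 (by norm_num)
    rw [iteratedDerivWithin_zero, zero_add, iteratedDerivWithin_one] at this
    exact this
  · have := hD 1 (by norm_num)
    rw [iteratedDerivWithin_one] at this
    exact this

namespace IsProfile

variable {u u₁ u₂ u₃ : ℝ → ℝ}

/-- Taylor expansions about a point, with a common constant. -/
theorem exists_taylor (h : IsProfile a b u u₁ u₂ u₃) : ∃ L, 0 < L ∧ ∀ c ∈ Icc a b, ∀ y ∈ Icc a b,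
    |u₂ y - u₂ c| ≤ L * |y - c| ∧
    |u₁ y - u₁ c - u₂ c * (y - c)| ≤ L * |y - c| ^ 2 ∧
    |u y - u c - u₁ c * (y - c) - u₂ c / 2 * (y - c) ^ 2| ≤ L * |y - c| ^ 3 ∧
    |u₂ y - u₂ c - u₃ c * (y - c)| ≤ L * (√|y - c| * |y - c|) := by
  obtain ⟨M, hM⟩ := isCompact_Icc.exists_bound_of_continuousOn h.continuousOn₃
  obtain ⟨K, hK0, hK⟩ := h.holder
  have hMle : M ≤ max M K + 1 := (le_max_left _ _).trans (by linarith)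
  have hKle : K ≤ max M K + 1 := (le_max_right _ _).trans (by linarith)
  have hL : 0 < max M K + 1 := by linarith [le_max_right M K]
  refine ⟨max M K + 1, hL, fun c hc y hy => ?_⟩
  -- Each remainder is bounded by applying the mean value inequality to the previous one, hence the
  -- common unsharp constant; only `t3` uses the Hölder bound.
  have t2 : ∀ y ∈ Icc a b, |u₂ y - u₂ c| ≤ (max M K + 1) * |y - c| := fun y hy =>
    h.deriv₃.abs_sub_le hc hy fun x hx _ => (hM x hx).trans hMle
  have hid : ∀ k : ℝ, HasDerivOn a b (fun x => k * (x - c)) (fun _ => k) := fun k x _ => by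
    simpa using ((hasDerivWithinAt_id x (Icc a b)).sub_const c).const_mul k
  have hsq : ∀ k : ℝ, HasDerivOn a b (fun x => k / 2 * (x - c) ^ 2) (fun x => k * (x - c)) :=
    fun k x _ => by
    have := ((((hasDerivAt_id' x).sub_const c).fun_pow 2).const_mul (k / 2)).hasDerivWithinAt (s := Icc a b)
    exact this.congr_deriv (by push_cast; ring)
  have t1 : ∀ y ∈ Icc a b, |u₁ y - u₁ c - u₂ c * (y - c)| ≤ (max M K + 1) * |y - c| ^ 2 := by
    intro y hy
    have := (h.deriv₂.sub (hid (u₂ c))).abs_sub_le (B := (max M K + 1) * |y - c|) hc hy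
      fun x hx hxy => (t2 x hx).trans (mul_le_mul_of_nonneg_left hxy hL.le)
    rw [show u₁ y - u₁ c - u₂ c * (y - c) = u₁ y - u₂ c * (y - c) - (u₁ c - u₂ c * (c - c)) by ring]
    exact this.trans_eq (by ring)
  have t0 : |u y - u c - u₁ c * (y - c) - u₂ c / 2 * (y - c) ^ 2| ≤ (max M K + 1) * |y - c| ^ 3 := by
    have := ((h.deriv₁.sub (hid (u₁ c))).sub (hsq (u₂ c))).abs_sub_le
      (B := (max M K + 1) * |y - c| ^ 2) hc hy
      fun x hx hxy => (t1 x hx).trans (by gcongr)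
    rw [show u y - u c - u₁ c * (y - c) - u₂ c / 2 * (y - c) ^ 2 = u y - u₁ c * (y - c) -
      u₂ c / 2 * (y - c) ^ 2 - (u c - u₁ c * (c - c) - u₂ c / 2 * (c - c) ^ 2) by ring]
    exact this.trans_eq (by ring)
  have t3 : |u₂ y - u₂ c - u₃ c * (y - c)| ≤ (max M K + 1) * (√|y - c| * |y - c|) := by
    have := (h.deriv₃.sub (hid (u₃ c))).abs_sub_le (B := (max M K + 1) * √|y - c|) hc hy
      fun x hx hxy => (hK c hc x hx).trans (by gcongr)
    rw [show u₂ y - u₂ c - u₃ c * (y - c) = u₂ y - u₃ c * (y - c) - (u₂ c - u₃ c * (c - c)) by ring]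
    exact this.trans_eq (by ring)
  exact ⟨t2 y hy, t1 y hy, t0, t3⟩

end IsProfile

/-! ### From local to global on an interval -/

/-- A property of intervals which is additive and holds for all short intervals about each point
holds for the whole interval. -/
theorem interval_induction {P : ℝ → ℝ → Prop} (hab : a < b)
    (hadd : ∀ r s t, a ≤ r → r < s → s < t → t ≤ b → P r s → P s t → P r t)
    (hloc : ∀ y ∈ Icc a b, ∃ δ > 0, ∀ s t, a ≤ s → t ≤ b → s < t → s ≤ y → y ≤ t → y - δ < s →
      t < y + δ → (s < y ∨ y = a) → (y < t ∨ y = b) → P s t) : P a b := by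
  -- Only points strictly to the left of `x` are required: the local hypothesis wants `y` interior
  -- to `[s,t]` unless it is an endpoint of `[a,b]`. The supremum `T` must therefore be jumped over,
  -- from some `s < T` to `t > T`, rather than reached.
  let U := {x ∈ Ioo a b | ∃ η > 0, ∀ x' ∈ Ioo (x - η) x, a < x' → P a x'}
  have hbdd : BddAbove U := ⟨b, fun x hx => hx.1.2.le⟩
  obtain ⟨x₀, hx₀⟩ : U.Nonempty := by
    obtain ⟨δ, hδ, h⟩ := hloc a (left_mem_Icc.2 hab.le)
    have h1 := min_le_left (a + δ / 2) ((a + b) / 2)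
    have h2 := min_le_right (a + δ / 2) ((a + b) / 2)
    refine ⟨min (a + δ / 2) ((a + b) / 2), ⟨lt_min (by linarith) (by linarith), by linarith⟩, 1,
      one_pos, fun x hx hax => ?_⟩
    have h3 := hx.2
    exact h a x le_rfl (by linarith) hax le_rfl hax.le (by linarith) (by linarith) (Or.inr rfl)
      (Or.inl hax)
  set T := sSup U with hT
  have haT : a < T := hx₀.1.1.trans_le (le_csSup hbdd hx₀)
  have hTb : T ≤ b := csSup_le ⟨x₀, hx₀⟩ fun x hx => hx.1.2.le
  obtain ⟨δ, hδ, h⟩ := hloc T ⟨haT.le, hTb⟩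
  obtain ⟨x, hx, hxT⟩ := exists_lt_of_lt_csSup ⟨x₀, hx₀⟩ (show T - δ < sSup U by linarith)
  obtain ⟨⟨hax, hxb⟩, η, hη, hP⟩ := hx
  have hxT' : x ≤ T := le_csSup hbdd ⟨⟨hax, hxb⟩, η, hη, hP⟩
  obtain ⟨s, hs1, hs2⟩ := exists_between
    (show max (x - η) (max (T - δ) a) < x from max_lt (by linarith) (max_lt hxT hax))
  have hs3 := (le_max_left _ _).trans_lt hs1
  have hs4 := ((le_max_left _ _).trans (le_max_right _ _)).trans_lt hs1
  have hs5 := ((le_max_right _ _).trans (le_max_right _ _)).trans_lt hs1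
  have hPs := hP s ⟨hs3, hs2⟩ hs5
  rcases hTb.eq_or_lt with hTb | hTb
  · have := h s b hs5.le le_rfl (by linarith) (by linarith) hTb.le hs4 (by linarith)
      (Or.inl (by linarith)) (Or.inr hTb)
    exact hadd a s b le_rfl hs5 (by linarith) le_rfl hPs this
  · exfalso
    have h1 := min_le_left (T + δ / 2) ((T + b) / 2)
    have h2 := min_le_right (T + δ / 2) ((T + b) / 2)
    have h3 : T < min (T + δ / 2) ((T + b) / 2) := lt_min (by linarith) (by linarith)
    refine absurd (le_csSup hbdd (a := min (T + δ / 2) ((T + b) / 2))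
      ⟨⟨by linarith, by linarith⟩, min (T + δ / 2) ((T + b) / 2) - T, by linarith,
        fun t ht hat => ?_⟩) (not_le.2 h3)
    have h4 : T < t := by linarith [ht.1]
    have h5 := ht.2
    exact hadd a s t le_rfl hs5 (by linarith) (by linarith) hPs
      (h s t hs5.le (by linarith) (by linarith) (by linarith) h4.le hs4 (by linarith)
        (Or.inl (by linarith)) (Or.inl h4))

/-! ### Hardy's inequality with a Coulomb term -/

section Hardy

variable {φ φ' V : ℝ → ℝ}

/-- The function `g = 1/(2x) - 1/(2h)` satisfies `g' + g² ≤ -1/(4x²) - 1/(4hx)` on `(0,h)`, which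
leaves room for `C/x` on short intervals. Since `g h = 0`, no condition on `φ` at `h` is needed; at
`0` the bound `|φ| ≤ M x` removes the boundary term. -/
theorem hardy_zero {h C : ℝ} (hh : 0 < h) (hφ : HasDerivOn 0 h φ φ')
    (hφ' : ContinuousOn φ' (Icc 0 h)) (h0 : φ 0 = 0) (hV : ContinuousOn V (Icc 0 h))
    (hVC : ∀ x ∈ Ioo 0 h, -(1 / (4 * x ^ 2)) - C / x ≤ V x) (hC : 4 * h * C ≤ 1) :
    0 ≤ ∫ x in 0..h, φ' x ^ 2 + V x * φ x ^ 2 := by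
  obtain ⟨M, hM⟩ := isCompact_Icc.exists_bound_of_continuousOn hφ'
  have h00 : (0 : ℝ) ∈ Icc 0 h := left_mem_Icc.2 hh.le
  have hφM : ∀ x ∈ Icc 0 h, |φ x| ≤ M * x := by
    intro x hx
    have := hφ.abs_sub_le h00 hx fun y hy _ => hM y hy
    simpa [h0, abs_of_nonneg hx.1] using this
  let F : ℝ → ℝ := fun x => (1 / (2 * x) - 1 / (2 * h)) * φ x ^ 2
  have hFd : ∀ x ∈ Ioo 0 h, HasDerivAt F (-(1 / (2 * x ^ 2)) * φ x ^ 2 +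
      (1 / (2 * x) - 1 / (2 * h)) * (2 * φ x * φ' x)) x := by
    intro x hx
    have hx0 : x ≠ 0 := hx.1.ne'
    have h1 : HasDerivAt (fun x : ℝ => 1 / (2 * x) - 1 / (2 * h)) (-(1 / (2 * x ^ 2))) x := by
      have := (((hasDerivAt_id' x).const_mul 2).fun_inv (by simpa using hx0)).sub_const (1 / (2 * h))
      simp only [one_div] at this ⊢
      refine this.congr_deriv ?_
      field_simp
    refine (h1.mul ((hφ.hasDerivAt hx).fun_pow 2)).congr_deriv ?_
    norm_num
  have hFc : ContinuousOn F (Icc 0 h) := by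
    intro x hx
    rcases hx.1.eq_or_lt with rfl | hx0
    · have hF0 : F 0 = 0 := by simp [F, h0]
      rw [ContinuousWithinAt, hF0]
      have hb : ∀ x ∈ Icc 0 h, ‖F x‖ ≤ (x / 2 + x ^ 2 / (2 * h)) * M ^ 2 := by
        intro x hx
        rcases hx.1.eq_or_lt with rfl | hx0
        · simp [hF0]
        have h1 : φ x ^ 2 ≤ (M * x) ^ 2 := sq_le_sq' (abs_le.1 (hφM x hx)).1 (abs_le.1 (hφM x hx)).2
        have h2 : |1 / (2 * x) - 1 / (2 * h)| ≤ 1 / (2 * x) + 1 / (2 * h) := by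
          rw [abs_le]
          have : 0 < 1 / (2 * x) := by positivity
          have : 0 < 1 / (2 * h) := by positivity
          constructor <;> linarith
        rw [Real.norm_eq_abs, abs_mul, abs_of_nonneg (sq_nonneg (φ x))]
        calc _ ≤ (1 / (2 * x) + 1 / (2 * h)) * (M * x) ^ 2 := by gcongr
          _ = _ := by field_simp
      have hlim : Tendsto (fun x : ℝ => (x / 2 + x ^ 2 / (2 * h)) * M ^ 2) (𝓝[Icc 0 h] 0) (𝓝 0) := by
        have : Continuous fun x : ℝ => (x / 2 + x ^ 2 / (2 * h)) * M ^ 2 := by fun_prop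
        simpa using (this.tendsto 0).mono_left nhdsWithin_le_nhds
      exact squeeze_zero_norm' (eventually_nhdsWithin_of_forall hb) hlim
    · have h1 : ContinuousWithinAt (fun x : ℝ => 1 / (2 * x) - 1 / (2 * h)) (Icc 0 h) x := by
        apply ContinuousAt.continuousWithinAt
        have : 2 * x ≠ 0 := by positivity
        fun_prop (disch := assumption)
      exact h1.mul ((hφ.continuousOn x hx).pow 2)
  have := intervalIntegral.sub_le_integral_of_hasDeriv_right_of_le
    (φ := fun x => φ' x ^ 2 + V x * φ x ^ 2) hh.le hFc
    (fun x hx => (hFd x hx).hasDerivWithinAt)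
    (((hφ'.pow 2).add (hV.mul (hφ.continuousOn.pow 2))).integrableOn_Icc) (fun x hx => ?_)
  · simpa [F, h0] using this
  · have hx0 : 0 < x := hx.1
    have h1 := hVC x hx
    have h2 : 0 ≤ (φ' x - (1 / (2 * x) - 1 / (2 * h)) * φ x) ^ 2 := sq_nonneg _
    have h3 : -(1 / (2 * x ^ 2)) + (1 / (2 * x) - 1 / (2 * h)) ^ 2 ≤ V x := by
      refine le_trans ?_ h1
      have h4 : -(1 / (4 * x ^ 2)) - C / x - (-(1 / (2 * x ^ 2)) + (1 / (2 * x) - 1 / (2 * h)) ^ 2)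
          = (2 * h - x - 4 * h * C * h) / (4 * h ^ 2 * x) := by
        field_simp; ring
      have h5 : 0 ≤ (2 * h - x - 4 * h * C * h) / (4 * h ^ 2 * x) := by
        apply div_nonneg _ (by positivity)
        nlinarith [hx.2]
      linarith
    nlinarith [mul_le_mul_of_nonneg_right h3 (sq_nonneg (φ x))]

theorem hardy_right {s t C : ℝ} (hst : s ≤ t) (hφ : HasDerivOn s t φ φ')
    (hφ' : ContinuousOn φ' (Icc s t)) (h0 : φ s = 0) (hV : ContinuousOn V (Icc s t))
    (hVC : ∀ x ∈ Ioo s t, -(1 / (4 * (x - s) ^ 2)) - C / |x - s| ≤ V x)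
    (hC : 4 * (t - s) * C ≤ 1) : 0 ≤ ∫ x in s..t, φ' x ^ 2 + V x * φ x ^ 2 := by
  rcases hst.eq_or_lt with rfl | hst
  · simp
  have hm : ∀ x ∈ Icc 0 (t - s), s + 1 * x ∈ Icc s t := fun x hx =>
    ⟨by linarith [hx.1], by linarith [hx.2]⟩
  have hmc : ContinuousOn (fun x : ℝ => s + 1 * x) (Icc 0 (t - s)) := by fun_prop
  have := hardy_zero (φ := fun x => φ (s + 1 * x)) (φ' := fun x => 1 * φ' (s + 1 * x))
    (V := fun x => V (s + 1 * x)) (C := C) (sub_pos.2 hst) (hφ.comp_affine hm)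
    (continuousOn_const.mul (hφ'.comp hmc hm)) (by simp [h0]) (hV.comp hmc hm)
    (fun x hx => by
      have := hVC (s + 1 * x) ⟨by linarith [hx.1], by linarith [hx.2]⟩
      simpa [abs_of_pos hx.1] using this) hC
  simp only [one_mul] at this
  rw [intervalIntegral.integral_comp_add_left (fun x => φ' x ^ 2 + V x * φ x ^ 2)] at this
  simpa using this

theorem hardy_left {s t C : ℝ} (hst : s ≤ t) (hφ : HasDerivOn s t φ φ')
    (hφ' : ContinuousOn φ' (Icc s t)) (h0 : φ t = 0) (hV : ContinuousOn V (Icc s t))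
    (hVC : ∀ x ∈ Ioo s t, -(1 / (4 * (x - t) ^ 2)) - C / |x - t| ≤ V x)
    (hC : 4 * (t - s) * C ≤ 1) : 0 ≤ ∫ x in s..t, φ' x ^ 2 + V x * φ x ^ 2 := by
  rcases hst.eq_or_lt with rfl | hst
  · simp
  have hm : ∀ x ∈ Icc 0 (t - s), t + (-1) * x ∈ Icc s t := fun x hx =>
    ⟨by linarith [hx.2], by linarith [hx.1]⟩
  have hmc : ContinuousOn (fun x : ℝ => t + (-1) * x) (Icc 0 (t - s)) := by fun_prop
  have := hardy_zero (φ := fun x => φ (t + (-1) * x)) (φ' := fun x => (-1) * φ' (t + (-1) * x))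
    (V := fun x => V (t + (-1) * x)) (C := C) (sub_pos.2 hst) (hφ.comp_affine hm)
    (continuousOn_const.mul (hφ'.comp hmc hm)) (by simp [h0]) (hV.comp hmc hm)
    (fun x hx => by
      have := hVC (t + (-1) * x) ⟨by linarith [hx.2], by linarith [hx.1]⟩
      simpa [abs_of_pos hx.1] using this) hC
  simp only [neg_mul, one_mul, neg_sq, ← sub_eq_add_neg] at this
  rw [intervalIntegral.integral_comp_sub_left (fun x => φ' x ^ 2 + V x * φ x ^ 2)] at this
  simpa using this

end Hardy

/-! ### Sobolev inequality and singular potentials of derivative type -/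

section Sobolev

variable {φ φ' : ℝ → ℝ} {s t : ℝ}

/-- The minimum of `φ²` is at most its mean, and the variation of `φ²` is at most `∫ |2 φ φ'|`,
split by the weighted arithmetic–geometric inequality. -/
theorem sq_le_of_hasDerivOn (hst : s < t) (hφ : HasDerivOn s t φ φ')
    (hφ' : ContinuousOn φ' (Icc s t)) {η : ℝ} (hη : 0 < η) {x : ℝ} (hx : x ∈ Icc s t) :
    φ x ^ 2 ≤ η * (∫ y in s..t, φ' y ^ 2) + (1 / η + 1 / (t - s)) * ∫ y in s..t, φ y ^ 2 := by
  have hc := hφ.continuousOn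
  have hi1 : IntervalIntegrable (fun y => φ' y ^ 2) volume s t :=
    (hφ'.pow 2).intervalIntegrable_of_Icc hst.le
  have hi2 : IntervalIntegrable (fun y => φ y ^ 2) volume s t :=
    (hc.pow 2).intervalIntegrable_of_Icc hst.le
  obtain ⟨z, hz, hmin⟩ := isCompact_Icc.exists_isMinOn (nonempty_Icc.2 hst.le) (hc.pow 2)
  have h1 : φ z ^ 2 ≤ 1 / (t - s) * ∫ y in s..t, φ y ^ 2 := by
    have : ∫ y in s..t, φ z ^ 2 ≤ ∫ y in s..t, φ y ^ 2 :=
      intervalIntegral.integral_mono_on hst.le intervalIntegrable_const hi2 fun y hy => hmin hy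
    rw [intervalIntegral.integral_const, smul_eq_mul] at this
    rw [one_div, ← div_eq_inv_mul, le_div_iff₀ (sub_pos.2 hst)]
    linarith
  have hA : ContinuousOn (fun y => η * φ' y ^ 2 + 1 / η * φ y ^ 2) (Icc s t) :=
    (continuousOn_const.mul (hφ'.pow 2)).add (continuousOn_const.mul (hc.pow 2))
  obtain ⟨B, hB⟩ := exists_hasDerivOn hA
  have hAM : ∀ y, |2 * φ y * φ' y| ≤ η * φ' y ^ 2 + 1 / η * φ y ^ 2 := by
    intro y
    have e1 : η * φ' y ^ 2 + 1 / η * φ y ^ 2 - 2 * φ y * φ' y = (η * φ' y - φ y) ^ 2 / η := by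
      field_simp; ring
    have e2 : η * φ' y ^ 2 + 1 / η * φ y ^ 2 + 2 * φ y * φ' y = (η * φ' y + φ y) ^ 2 / η := by
      field_simp; ring
    have p1 : 0 ≤ (η * φ' y - φ y) ^ 2 / η := by positivity
    have p2 : 0 ≤ (η * φ' y + φ y) ^ 2 / η := by positivity
    rw [abs_le]; constructor <;> linarith
  have hsq := hφ.mul hφ
  have m0 := hB.monotoneOn fun y _ => (abs_nonneg _).trans (hAM y)
  have m1 := (hB.sub hsq).monotoneOn fun y _ => by linarith [(abs_le.1 (hAM y)).2]
  have m2 := (hB.add hsq).monotoneOn fun y _ => by linarith [(abs_le.1 (hAM y)).1]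
  have hs : s ∈ Icc s t := left_mem_Icc.2 hst.le
  have ht : t ∈ Icc s t := right_mem_Icc.2 hst.le
  have hint : ∫ y in s..t, (η * φ' y ^ 2 + 1 / η * φ y ^ 2) = B t - B s := hB.integral_eq hst.le hA
  rw [intervalIntegral.integral_add (hi1.const_mul _) (hi2.const_mul _),
    intervalIntegral.integral_const_mul, intervalIntegral.integral_const_mul] at hint
  have h2 : φ x ^ 2 - φ z ^ 2 ≤ B t - B s := by
    have b1 := m0 hs hx hx.1
    have b2 := m0 hx ht hx.2
    have b3 := m0 hs hz hz.1
    have b4 := m0 hz ht hz.2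
    rcases le_total z x with h | h
    · have := m1 hz hx h
      simp only at this
      nlinarith
    · have := m2 hx hz h
      simp only at this
      nlinarith
  linarith

/-- A lower bound for the quadratic form of a potential whose singular part is a derivative. -/
theorem form_bound_of_singular {q G G' ρ : ℝ → ℝ} {p Γ : ℝ} (hst : s < t)
    (hq : ContinuousOn q (Icc s t)) (hG : HasDerivOn s t G G') (hG' : ContinuousOn G' (Icc s t))
    (hρ : IntervalIntegrable ρ volume s t) (hρ0 : ∀ x ∈ Icc s t, 0 ≤ ρ x) (hs : |G s| ≤ Γ)
    (ht : |G t| ≤ Γ) (hqG : ∀ x ∈ Icc s t, x ≠ p → G' x - ρ x ≤ q x)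
    (hGρ : ∀ x ∈ Icc s t, x ≠ p → G x ^ 2 ≤ ρ x)
    (hφ : HasDerivOn s t φ φ') (hφ' : ContinuousOn φ' (Icc s t)) :
    -((2 * Γ + 3 * (∫ x in s..t, ρ x) + 1) *
      (2 * (2 * Γ + 3 * (∫ x in s..t, ρ x) + 1) + 1 / (t - s))) * ∫ x in s..t, φ x ^ 2 ≤
      ∫ x in s..t, φ' x ^ 2 + q x * φ x ^ 2 := by
  have hc := hφ.continuousOn
  set R := ∫ x in s..t, ρ x with hR
  have hR0 : 0 ≤ R := intervalIntegral.integral_nonneg hst.le hρ0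
  have hΓ0 : 0 ≤ Γ := (abs_nonneg _).trans hs
  -- `N` collects the coefficients of `sup φ²` in all error terms. The Sobolev weight `1/(2N)` makes
  -- them cost only half of `∫ φ'²`.
  set N := 2 * Γ + 3 * R + 1 with hN
  have hN0 : 0 < N := by positivity
  set S := 1 / (2 * N) * (∫ y in s..t, φ' y ^ 2) +
    (1 / (1 / (2 * N)) + 1 / (t - s)) * ∫ y in s..t, φ y ^ 2 with hS
  have hφS : ∀ x ∈ Icc s t, φ x ^ 2 ≤ S := fun x hx =>
    sq_le_of_hasDerivOn hst hφ hφ' (by positivity) hx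
  have hi1 : IntervalIntegrable (fun y => φ' y ^ 2) volume s t :=
    (hφ'.pow 2).intervalIntegrable_of_Icc hst.le
  have hi2 : IntervalIntegrable (fun y => q y * φ y ^ 2) volume s t :=
    (hq.mul (hc.pow 2)).intervalIntegrable_of_Icc hst.le
  have hd := hG.mul (hφ.mul hφ)
  have hdc : ContinuousOn (fun x => G' x * (φ x * φ x) + G x * (φ' x * φ x + φ x * φ' x))
      (Icc s t) :=
    (hG'.mul (hc.mul hc)).add (hG.continuousOn.mul ((hφ'.mul hc).add (hc.mul hφ')))
  have hint := hd.integral_eq hst.le hdc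
  -- Pointwise `(G φ²)' ≤ (q + ρ) φ² + φ'²/2 + 2 G² φ²` and `G² ≤ ρ`, so the total error is `3 ρ φ²
  -- ≤ 3 S ρ`. The singular point `p` is a null set.
  have hle : ∫ x in s..t, (G' x * (φ x * φ x) + G x * (φ' x * φ x + φ x * φ' x)) ≤
      ∫ x in s..t, (1 / 2 * φ' x ^ 2 + q x * φ x ^ 2 + 3 * S * ρ x) := by
    refine intervalIntegral.integral_mono_ae_restrict hst.le (hdc.intervalIntegrable_of_Icc hst.le)
      (((hi1.const_mul _).add hi2).add (hρ.const_mul _)) ?_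
    have hae : ∀ᵐ x ∂(volume.restrict (Icc s t)), x ≠ p :=
      ae_restrict_of_ae (compl_mem_ae_iff.2 (measure_singleton p))
    filter_upwards [hae, ae_restrict_mem measurableSet_Icc] with x hxp hx
    have h1 := hqG x hx hxp
    have h2 := hGρ x hx hxp
    have h3 := hφS x hx
    have h4 := hρ0 x hx
    have h5 := sq_nonneg (φ x)
    have h6 : ρ x * φ x ^ 2 ≤ ρ x * S := mul_le_mul_of_nonneg_left h3 h4
    have h7 := mul_le_mul_of_nonneg_right h1 h5
    have h8 := mul_le_mul_of_nonneg_right h2 h5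
    nlinarith [sq_nonneg (φ' x - 2 * G x * φ x)]
  rw [hint, intervalIntegral.integral_add ((hi1.const_mul _).add hi2) (hρ.const_mul _),
    intervalIntegral.integral_add (hi1.const_mul _) hi2, intervalIntegral.integral_const_mul,
    intervalIntegral.integral_const_mul, ← hR] at hle
  rw [intervalIntegral.integral_add hi1 hi2]
  have hb1 : -(Γ * S) ≤ G t * (φ t * φ t) := by
    have h1 := hφS t (right_mem_Icc.2 hst.le)
    have h2 := mul_le_mul_of_nonneg_right (abs_le.1 ht).1 (sq_nonneg (φ t))
    nlinarith
  have hb2 : G s * (φ s * φ s) ≤ Γ * S := by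
    have h1 := hφS s (left_mem_Icc.2 hst.le)
    have h2 := mul_le_mul_of_nonneg_right (abs_le.1 hs).2 (sq_nonneg (φ s))
    nlinarith
  have hS0 : 0 ≤ S := (sq_nonneg _).trans (hφS s (left_mem_Icc.2 hst.le))
  have hNS : N * S = 1 / 2 * (∫ y in s..t, φ' y ^ 2) +
      N * (2 * N + 1 / (t - s)) * ∫ y in s..t, φ y ^ 2 := by
    rw [hS]; field_simp
  have : N * S = 2 * Γ * S + 3 * S * R + S := by rw [hN]; ring
  linarith

end Sobolev

/-! ### Pointwise estimates of the potential -/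

/-- The potential of the Rayleigh–Kuo problem. -/
noncomputable def pot (u u₂ : ℝ → ℝ) (β c y : ℝ) : ℝ := (u₂ y - β) / (u y - c)

theorem neg_div_le_div {w v N D : ℝ} (hN : 0 ≤ N) (hw : -N ≤ w) (hD : 0 < D) (hv : D ≤ v) :
    -(N / D) ≤ w / v := by
  have hv0 : 0 < v := hD.trans_le hv
  have h1 : N / v ≤ N / D := by gcongr
  have h2 : -N / v ≤ w / v := by gcongr
  rw [neg_div] at h2
  linarith

theorem exists_mem_Icc_near (hab : a < b) {p δ : ℝ} (hp : p ∈ Icc a b) (hδ : 0 < δ) :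
    ∃ y ∈ Icc a b, 0 < |y - p| ∧ |y - p| < δ := by
  rcases hp.2.eq_or_lt with rfl | hpb
  · have h1 : 0 < min (δ / 2) (p - a) := lt_min (by linarith) (by linarith)
    refine ⟨p - min (δ / 2) (p - a), ⟨by linarith [min_le_right (δ / 2) (p - a)], by linarith⟩, ?_⟩
    rw [sub_sub_cancel_left, abs_neg, abs_of_pos h1]
    exact ⟨h1, by linarith [min_le_left (δ / 2) (p - a)]⟩
  · have h1 : 0 < min (δ / 2) (b - p) := lt_min (by linarith) (by linarith)
    refine ⟨p + min (δ / 2) (b - p), ⟨by linarith [hp.1], by linarith [min_le_right (δ / 2) (b - p)]⟩,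
      ?_⟩
    rw [add_sub_cancel_left, abs_of_pos h1]
    exact ⟨h1, by linarith [min_le_left (δ / 2) (b - p)]⟩

namespace IsProfile

variable {u u₁ u₂ u₃ : ℝ → ℝ} {β μ : ℝ}

theorem continuousOn (h : IsProfile a b u u₁ u₂ u₃) : ContinuousOn u (Icc a b) :=
  h.deriv₁.continuousOn

theorem continuousOn₂ (h : IsProfile a b u u₁ u₂ u₃) : ContinuousOn u₂ (Icc a b) :=
  h.deriv₃.continuousOn

theorem continuousOn_pot (h : IsProfile a b u u₁ u₂ u₃) {c : ℝ} (hc : ∀ y ∈ Icc a b, u y ≠ c) :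
    ContinuousOn (pot u u₂ β c) (Icc a b) :=
  (h.continuousOn₂.sub continuousOn_const).div (h.continuousOn.sub continuousOn_const)
    fun y hy => sub_ne_zero.2 (hc y hy)

theorem continuousOn_pot_of_lt (h : IsProfile a b u u₁ u₂ u₃) (hμ : ∀ y ∈ Icc a b, μ ≤ u y) {c : ℝ}
    (hc : c < μ) : ContinuousOn (pot u u₂ β c) (Icc a b) :=
  h.continuousOn_pot fun y hy => (hc.trans_le (hμ y hy)).ne'

theorem exists_bound (h : IsProfile a b u u₁ u₂ u₃) (β : ℝ) :
    ∃ M, 0 ≤ M ∧ ∀ y ∈ Icc a b, |u₂ y - β| ≤ M := by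
  obtain ⟨M, hM0, hM⟩ := exists_abs_sub_le h.continuousOn₂ β
  exact ⟨M, hM0, fun y hy => by rw [abs_sub_comm]; exact hM y hy⟩

theorem deriv_eq_zero (h : IsProfile a b u u₁ u₂ u₃) (hμ : ∀ y ∈ Icc a b, μ ≤ u y) {p : ℝ}
    (hp : p ∈ Ioo a b) (hup : u p = μ) : u₁ p = 0 := by
  have hmin : IsLocalMin u p := by
    filter_upwards [Icc_mem_nhds hp.1 hp.2] with y hy
    rw [hup]; exact hμ y hy
  exact hmin.hasDerivAt_eq_zero (h.deriv₁.hasDerivAt hp)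

/-- A negative second derivative at a critical point would push `u` below `μ` nearby. The Taylor
argument also covers endpoints, where one side is enough. -/
theorem second_pos (h : IsProfile a b u u₁ u₂ u₃) (hμ : ∀ y ∈ Icc a b, μ ≤ u y) {p : ℝ}
    (hp : p ∈ Icc a b) (hup : u p = μ) (h1 : u₁ p = 0) : 0 < u₂ p := by
  refine lt_of_le_of_ne ?_ (h.nondegenerate p hp h1).symm
  by_contra! hneg
  obtain ⟨L, hL, hT⟩ := h.exists_taylor
  obtain ⟨y, hy, hy0, hyδ⟩ := exists_mem_Icc_near h.lt hp (δ := -u₂ p / (2 * L))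
    (div_pos (by linarith) (by linarith))
  have h3 := (abs_le.1 (hT p hp y hy).2.2.1).2
  rw [h1, hup] at h3
  have h4 := hμ y hy
  rw [lt_div_iff₀ (by linarith)] at hyδ
  have h5 : (y - p) ^ 2 = |y - p| ^ 2 := (sq_abs _).symm
  rw [h5] at h3
  nlinarith [pow_pos hy0 2]

theorem quadratic_lower (h : IsProfile a b u u₁ u₂ u₃) (hμ : ∀ y ∈ Icc a b, μ ≤ u y) {p : ℝ}
    (hp : p ∈ Icc a b) (hup : u p = μ) (h1 : u₁ p = 0) :
    ∃ δ > 0, ∀ y ∈ Icc a b, |y - p| < δ → u₂ p / 4 * |y - p| ^ 2 ≤ u y - μ := by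
  obtain ⟨L, hL, hT⟩ := h.exists_taylor
  have hκ := h.second_pos hμ hp hup h1
  refine ⟨u₂ p / (4 * L), by positivity, fun y hy hyδ => ?_⟩
  have h3 := (abs_le.1 (hT p hp y hy).2.2.1).1
  rw [h1, hup] at h3
  rw [lt_div_iff₀ (by linarith)] at hyδ
  have h5 : (y - p) ^ 2 = |y - p| ^ 2 := (sq_abs _).symm
  rw [h5] at h3
  have h6 : |y - p| * (4 * L) * |y - p| ^ 2 ≤ u₂ p * |y - p| ^ 2 := by gcongr
  nlinarith

/-- Away from the minimum points the potentials are uniformly bounded below. -/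
theorem pot_bounded_below (h : IsProfile a b u u₁ u₂ u₃) (β : ℝ) {p : ℝ} (hp : p ∈ Icc a b)
    (hup : μ < u p) : ∃ δ > 0, ∃ C, 0 ≤ C ∧ ∀ c < μ, ∀ y ∈ Icc a b, |y - p| < δ →
      -C ≤ pot u u₂ β c y := by
  obtain ⟨M, hM0, hM⟩ := h.exists_bound β
  obtain ⟨δ, hδ, hd⟩ := Metric.continuousWithinAt_iff.1 (h.continuousOn p hp) ((u p - μ) / 2)
    (by linarith)
  refine ⟨δ, hδ, M / ((u p - μ) / 2), div_nonneg hM0 (by linarith), fun c hc y hy hyδ => ?_⟩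
  refine neg_div_le_div hM0 (abs_le.1 (hM y hy)).1 (by linarith) ?_
  have := (abs_lt.1 (hd hy hyδ)).1
  linarith

/-- The Hardy type lower bound for the potentials in the subcritical regime. -/
theorem pot_hardy (h : IsProfile a b u u₁ u₂ u₃) (hμ : ∀ y ∈ Icc a b, μ ≤ u y)
    (hβ : ∀ y ∈ Icc a b, u₁ y = 0 → u y = μ → β ≤ 9 / 8 * u₂ y) {p : ℝ} (hp : p ∈ Icc a b) :
    ∃ δ > 0, ∃ C, 0 ≤ C ∧ ∀ c < μ, ∀ y ∈ Icc a b, y ≠ p → |y - p| < δ →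
      -(1 / (4 * (y - p) ^ 2)) - C / |y - p| ≤ pot u u₂ β c y := by
  obtain ⟨M, hM0, hM⟩ := h.exists_bound β
  obtain ⟨L, hL, hT⟩ := h.exists_taylor
  rcases (hμ p hp).lt_or_eq with hup | hup
  · obtain ⟨δ, hδ, C, hC0, hC⟩ := h.pot_bounded_below β hp hup
    refine ⟨min δ 1, lt_min hδ one_pos, C, hC0, fun c hc y hy hyp hyδ => ?_⟩
    have h1 := hC c hc y hy (hyδ.trans_le (min_le_left _ _))
    have h2 := hyδ.trans_le (min_le_right _ _)
    have h3 : 0 < |y - p| := abs_pos.2 (sub_ne_zero.2 hyp)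
    have h4 : C ≤ C / |y - p| := le_div_self hC0 h3 h2.le
    have h5 : 0 ≤ 1 / (4 * (y - p) ^ 2) := by positivity
    linarith
  by_cases hu1 : u₁ p = 0
  · have hκ := h.second_pos hμ hp hup.symm hu1
    have hβp := hβ p hp hu1 hup.symm
    refine ⟨u₂ p / (4 * L), by positivity, 5 * L / u₂ p, by positivity,
      fun c hc y hy hyp hyδ => ?_⟩
    have hr : 0 < |y - p| := abs_pos.2 (sub_ne_zero.2 hyp)
    obtain ⟨t2, -, t0, -⟩ := hT p hp y hy
    have t0 := (abs_le.1 t0).1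
    have t2 := (abs_le.1 t2).1
    rw [hu1, ← hup] at t0
    have hsq : (y - p) ^ 2 = |y - p| ^ 2 := (sq_abs _).symm
    rw [hsq] at t0 ⊢
    generalize |y - p| = r at *
    rw [lt_div_iff₀ (by linarith)] at hyδ
    have hD : 0 < u₂ p / 2 - L * r := by nlinarith
    -- From `β ≤ 9κ/8` the numerator is at least `-(κ/8 + L r)`, and the leading quotient `(κ/8)/(κ
    -- r²/2)` is exactly `1/(4r²)`. The Taylor errors contribute a term of order `1/r`, absorbed by
    -- `C = 5L/κ`.
    have hle := neg_div_le_div (w := u₂ y - β) (v := u y - c) (N := u₂ p / 8 + L * r)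
      (D := r ^ 2 * (u₂ p / 2 - L * r)) (by positivity) (by linarith) (by positivity)
      (by nlinarith)
    refine le_trans ?_ hle
    have e1 : 1 / (4 * r ^ 2) + 5 * L / u₂ p / r - (u₂ p / 8 + L * r) /
        (r ^ 2 * (u₂ p / 2 - L * r)) = (5 * L * (u₂ p / 4 - L * r)) /
        (u₂ p * r * (u₂ p / 2 - L * r)) := by
      obtain ⟨D, hDe⟩ : ∃ D, D = u₂ p / 2 - L * r := ⟨_, rfl⟩
      have hκD : u₂ p = 2 * (D + L * r) := by rw [hDe]; ring
      rw [← hDe] at hD ⊢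
      field_simp
      rw [hκD]
      ring
    have e2 : 0 ≤ (5 * L * (u₂ p / 4 - L * r)) / (u₂ p * r * (u₂ p / 2 - L * r)) := by
      have : 0 ≤ u₂ p / 4 - L * r := by linarith
      positivity
    linarith
  -- A minimum point with nonzero slope: `u - μ` grows linearly, so the potential is at worst of
  -- order `-1/r`.
  · have hK : 0 < |u₂ p| / 2 + L := by positivity
    have hu1' : 0 < |u₁ p| := abs_pos.2 hu1
    refine ⟨min 1 (|u₁ p| / (2 * (|u₂ p| / 2 + L))), lt_min one_pos (by positivity),
      M / (|u₁ p| / 2), by positivity, fun c hc y hy hyp hyδ => ?_⟩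
    have hr : 0 < |y - p| := abs_pos.2 (sub_ne_zero.2 hyp)
    have hr1 := hyδ.trans_le (min_le_left _ _)
    have hr2 := hyδ.trans_le (min_le_right _ _)
    rw [lt_div_iff₀ (by positivity)] at hr2
    have t0 := (hT p hp y hy).2.2.1
    rw [← hup] at t0
    have hlow : |u₁ p| / 2 * |y - p| ≤ u y - μ := by
      have h0 := hμ y hy
      have h1 : |u₁ p * (y - p)| ≤ |u y - μ| + |u₂ p / 2 * (y - p) ^ 2| + L * |y - p| ^ 3 := by
        have : u₁ p * (y - p) = (u y - μ) - u₂ p / 2 * (y - p) ^ 2 -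
          (u y - μ - u₁ p * (y - p) - u₂ p / 2 * (y - p) ^ 2) := by ring
        calc _ ≤ |(u y - μ) - u₂ p / 2 * (y - p) ^ 2| +
              |u y - μ - u₁ p * (y - p) - u₂ p / 2 * (y - p) ^ 2| := by
                conv_lhs => rw [this]
                exact abs_sub _ _
          _ ≤ _ := add_le_add (abs_sub _ _) t0
      rw [abs_mul, abs_mul, abs_div, abs_of_nonneg (sub_nonneg.2 h0), abs_pow, abs_two] at h1
      have h2 : |y - p| ^ 3 ≤ |y - p| ^ 2 := pow_le_pow_of_le_one hr.le hr1.le (by norm_num)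
      have h3 : |y - p| * (2 * (|u₂ p| / 2 + L)) * |y - p| ≤ |u₁ p| * |y - p| := by gcongr
      nlinarith
    have hle := neg_div_le_div (w := u₂ y - β) (v := u y - c) hM0 (abs_le.1 (hM y hy)).1
      (by positivity) (show |u₁ p| / 2 * |y - p| ≤ u y - c by linarith)
    refine le_trans ?_ hle
    rw [div_div]
    have : 0 ≤ 1 / (4 * (y - p) ^ 2) := by positivity
    linarith

/-- Supercritical upper bound for the potentials near a minimum point. -/
theorem pot_supercritical (h : IsProfile a b u u₁ u₂ u₃) (hμ : ∀ y ∈ Icc a b, μ ≤ u y) {p : ℝ}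
    (hp : p ∈ Icc a b) (hup : u p = μ) (h1 : u₁ p = 0) (hβ : 9 / 8 * u₂ p < β) :
    ∃ γ > 1 / 4, ∃ δ > 0, ∀ r₀ > 0, ∃ ε > 0, ∀ c < μ, μ - ε < c → ∀ y ∈ Icc a b, r₀ ≤ |y - p| →
      |y - p| ≤ δ → pot u u₂ β c y ≤ -γ / |y - p| ^ 2 := by
  obtain ⟨L, hL, hT⟩ := h.exists_taylor
  have hκ := h.second_pos hμ hp hup h1
  set κ := u₂ p
  -- `2(β - κ)/κ` is the coefficient of the limiting inverse square potential; it exceeds `1/4`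
  -- exactly when `β > 9κ/8`.
  obtain ⟨γ, hγ1, hγ2⟩ := exists_between
    (show (1 : ℝ) / 4 < 2 * (β - κ) / κ by rw [lt_div_iff₀ hκ]; linarith)
  rw [lt_div_iff₀ hκ] at hγ2
  have hγ0 : 0 < γ := by linarith
  -- the available slack
  set A := β - κ - γ * κ / 2 with hA
  have hA0 : 0 < A := by linarith
  -- Half of the slack pays for the Taylor errors, which fixes `δ`; the other half pays for `μ - c`
  -- when `r ≥ r₀`, which fixes `ε`.
  refine ⟨γ, hγ1, A / (2 * (γ + 1) * L), by positivity, fun r₀ hr₀ =>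
    ⟨A / (2 * γ) * r₀ ^ 2, by positivity, fun c hc hcε y hy hy0 hyδ => ?_⟩⟩
  obtain ⟨t2, -, t0, -⟩ := hT p hp y hy
  have t0 := (abs_le.1 t0).2
  have t2 := (abs_le.1 t2).2
  rw [h1, hup] at t0
  have hsq : (y - p) ^ 2 = |y - p| ^ 2 := (sq_abs _).symm
  rw [hsq] at t0
  have hv : 0 < u y - c := by linarith [hμ y hy]
  generalize |y - p| = r at *
  have hr : 0 < r := hr₀.trans_le hy0
  rw [le_div_iff₀ (by positivity)] at hyδ
  have hr0 : r₀ ^ 2 ≤ r ^ 2 := by gcongr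
  have hε : γ * (μ - c) ≤ A / 2 * r ^ 2 := by
    have : γ * (μ - c) ≤ γ * (A / (2 * γ) * r₀ ^ 2) := by gcongr; linarith
    have e : γ * (A / (2 * γ) * r₀ ^ 2) = A / 2 * r₀ ^ 2 := by field_simp
    have : A / 2 * r₀ ^ 2 ≤ A / 2 * r ^ 2 := by gcongr
    linarith
  have hu : u y - c ≤ κ / 2 * r ^ 2 + L * r ^ 3 + (μ - c) := by linarith
  rw [pot, div_le_div_iff₀ hv (by positivity)]
  have h3 : γ * (u y - c) ≤ γ * (κ / 2 * r ^ 2 + L * r ^ 3 + (μ - c)) := by gcongr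
  have h4 : r * (2 * (γ + 1) * L) * r ^ 2 ≤ A * r ^ 2 := by gcongr
  have h5 : (u₂ y - β) * r ^ 2 ≤ (κ + L * r - β) * r ^ 2 := by gcongr; linarith
  nlinarith

end IsProfile

/-! ### Form bounds uniform in `c` -/

theorem intervalIntegrable_inv_sqrt_abs (p s t : ℝ) :
    IntervalIntegrable (fun x => 1 / √|x - p|) volume s t := by
  have h0 : ∀ r, 0 ≤ r → IntervalIntegrable (fun x : ℝ => 1 / √|x|) volume 0 r := by
    intro r hr
    refine (intervalIntegral.intervalIntegrable_rpow' (r := -(1 / 2)) (by norm_num)).congr ?_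
    intro x hx
    rw [uIoc_of_le hr] at hx
    simp only
    rw [abs_of_pos hx.1, Real.rpow_neg hx.1.le, ← Real.sqrt_eq_rpow, one_div]
  have h1 : ∀ r, IntervalIntegrable (fun x : ℝ => 1 / √|x|) volume 0 r := by
    intro r
    rcases le_total 0 r with hr | hr
    · exact h0 r hr
    · have := IntervalIntegrable.comp_sub_left (h0 (-r) (by linarith)) 0
      simpa using this
  have h2 := ((h1 (s - p)).symm.trans (h1 (t - p))).comp_sub_right p
  simpa using h2

/-- For `v ≤ 1`, write `log v = -8 log (1/v)^{1/8}` and use `log w ≤ w`. The resulting power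
`(1/v)^{1/4}` becomes `r^{-1/2}` when `v` is at least a multiple of `r²`, matching the Hölder error.
-/
theorem sq_log_le {v E : ℝ} (hv : 0 < v) (hvE : v ≤ E) :
    Real.log v ^ 2 ≤ E ^ 2 + 64 * √√(1 / v) := by
  rcases le_total 1 v with h1 | h1
  · have h2 := Real.log_nonneg h1
    have h3 : Real.log v ≤ E := (Real.log_le_self hv.le).trans hvE
    have h4 : 0 ≤ √√(1 / v) := Real.sqrt_nonneg _
    nlinarith
  · have h2 : Real.log v = -(8 * Real.log √√√(1 / v)) := by
      rw [Real.log_sqrt (by positivity), Real.log_sqrt (by positivity), Real.log_sqrt (by positivity),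
        one_div, Real.log_inv]
      ring
    have h3 : Real.log √√√(1 / v) ≤ √√√(1 / v) := Real.log_le_self (by positivity)
    have h4 : 0 ≤ Real.log √√√(1 / v) := by linarith [Real.log_nonpos hv.le h1]
    have h5 : √√√(1 / v) ^ 2 = √√(1 / v) := Real.sq_sqrt (by positivity)
    rw [h2]
    nlinarith [sq_nonneg E]

/-- The form bound on short intervals about a point at which the test functions vanish. -/
theorem form_nonneg_of_hardy {V φ φ' : ℝ → ℝ} {p δ C s t : ℝ} (hC0 : 0 ≤ C)
    (hs : a ≤ s) (ht : t ≤ b) (hsp : s ≤ p) (hpt : p ≤ t) (hsδ : p - δ < s) (htδ : t < p + δ)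
    (hδC : 4 * δ * C ≤ 1) (hV : ContinuousOn V (Icc a b))
    (hVC : ∀ y ∈ Icc a b, y ≠ p → |y - p| < δ → -(1 / (4 * (y - p) ^ 2)) - C / |y - p| ≤ V y)
    (hφ : HasDerivOn a b φ φ') (hφ' : ContinuousOn φ' (Icc a b)) (h0 : φ p = 0) :
    0 ≤ ∫ x in s..t, φ' x ^ 2 + V x * φ x ^ 2 := by
  have hc : ContinuousOn (fun x => φ' x ^ 2 + V x * φ x ^ 2) (Icc a b) :=
    (hφ'.pow 2).add (hV.mul (hφ.continuousOn.pow 2))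
  have hi : ∀ {r r' : ℝ}, a ≤ r → r ≤ r' → r' ≤ b →
      IntervalIntegrable (fun x => φ' x ^ 2 + V x * φ x ^ 2) volume r r' := fun h1 h2 h3 =>
    (hc.mono (Icc_subset_Icc h1 h3)).intervalIntegrable_of_Icc h2
  have hpb := hpt.trans ht
  have hap := hs.trans hsp
  rw [← intervalIntegral.integral_add_adjacent_intervals (hi hs hsp hpb) (hi hap hpt ht)]
  refine add_nonneg
    (hardy_left hsp (hφ.mono hs hpb) (hφ'.mono (Icc_subset_Icc hs hpb)) h0
      (hV.mono (Icc_subset_Icc hs hpb)) (fun x hx => hVC x ⟨hs.trans hx.1.le, hx.2.le.trans hpb⟩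
        hx.2.ne ?_) ?_)
    (hardy_right hpt (hφ.mono hap ht) (hφ'.mono (Icc_subset_Icc hap ht)) h0
      (hV.mono (Icc_subset_Icc hap ht)) (fun x hx => hVC x ⟨hap.trans hx.1.le, hx.2.le.trans ht⟩
        hx.1.ne' ?_) ?_)
  · rw [abs_lt]; constructor <;> linarith [hx.1, hx.2]
  · nlinarith
  · rw [abs_lt]; constructor <;> linarith [hx.1, hx.2]
  · nlinarith

theorem form_bound_of_bounded_below {V φ φ' : ℝ → ℝ} {C s t : ℝ} (hst : s ≤ t)
    (hV : ContinuousOn V (Icc s t)) (hVC : ∀ y ∈ Icc s t, -C ≤ V y)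
    (hφ : HasDerivOn s t φ φ') (hφ' : ContinuousOn φ' (Icc s t)) :
    -C * ∫ x in s..t, φ x ^ 2 ≤ ∫ x in s..t, φ' x ^ 2 + V x * φ x ^ 2 := by
  rw [← intervalIntegral.integral_const_mul]
  refine intervalIntegral.integral_mono_on hst
    ((continuousOn_const.mul (hφ.continuousOn.pow 2)).intervalIntegrable_of_Icc hst)
    (((hφ'.pow 2).add (hV.mul (hφ.continuousOn.pow 2))).intervalIntegrable_of_Icc hst)
    fun x hx => ?_
  nlinarith [mul_le_mul_of_nonneg_right (hVC x hx) (sq_nonneg (φ x)), sq_nonneg (φ' x)]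

namespace IsProfile

variable {u u₁ u₂ u₃ : ℝ → ℝ} {β μ : ℝ}

/-- With finitely many vanishing conditions the form becomes nonnegative. -/
theorem exists_finset_form_nonneg (h : IsProfile a b u u₁ u₂ u₃) (hμ : ∀ y ∈ Icc a b, μ ≤ u y)
    (hβ : ∀ y ∈ Icc a b, u₁ y = 0 → u y = μ → β ≤ 9 / 8 * u₂ y) :
    ∃ F : Finset ℝ, ∀ c < μ, ∀ φ φ', HasDerivOn a b φ φ' → ContinuousOn φ' (Icc a b) →
      (∀ x ∈ F, φ x = 0) → 0 ≤ ∫ x in a..b, φ' x ^ 2 + pot u u₂ β c x * φ x ^ 2 := by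
  classical
  refine interval_induction (P := fun s t => ∃ F : Finset ℝ, ∀ c < μ, ∀ φ φ', HasDerivOn a b φ φ' →
    ContinuousOn φ' (Icc a b) → (∀ x ∈ F, φ x = 0) →
    0 ≤ ∫ x in s..t, φ' x ^ 2 + pot u u₂ β c x * φ x ^ 2) h.lt ?_ ?_
  · rintro r s t hr hrs hst ht ⟨F, hF⟩ ⟨F', hF'⟩
    refine ⟨F ∪ F', fun c hc φ φ' hφ hφ' h0 => ?_⟩
    have hcont : ContinuousOn (fun x => φ' x ^ 2 + pot u u₂ β c x * φ x ^ 2) (Icc a b) :=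
      (hφ'.pow 2).add ((h.continuousOn_pot_of_lt hμ hc).mul (hφ.continuousOn.pow 2))
    rw [← intervalIntegral.integral_add_adjacent_intervals (b := s)]
    · exact add_nonneg (hF c hc φ φ' hφ hφ' fun x hx => h0 x (Finset.mem_union_left _ hx))
        (hF' c hc φ φ' hφ hφ' fun x hx => h0 x (Finset.mem_union_right _ hx))
    · exact (hcont.mono (Icc_subset_Icc hr (by linarith))).intervalIntegrable_of_Icc hrs.le
    · exact (hcont.mono (Icc_subset_Icc (by linarith) ht)).intervalIntegrable_of_Icc hst.le
  · intro p hp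
    obtain ⟨δ, hδ, C, hC0, hC⟩ := h.pot_hardy hμ hβ hp
    -- One vanishing condition per short interval suffices; the second bound on the length ensures
    -- `4 δ C ≤ 1` for Hardy's inequality.
    refine ⟨min δ (1 / (4 * (C + 1))), lt_min hδ (by positivity),
      fun s t hs ht _ hsp hpt hsδ htδ _ _ => ⟨{p}, fun c hc φ φ' hφ hφ' h0 => ?_⟩⟩
    refine form_nonneg_of_hardy hC0 hs ht hsp hpt hsδ htδ ?_ (h.continuousOn_pot_of_lt hμ hc)
      (fun y hy hyp hyδ => hC c hc y hy hyp (hyδ.trans_le (min_le_left _ _))) hφ hφ'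
      (h0 p (Finset.mem_singleton_self p))
    have h1 := min_le_right δ (1 / (4 * (C + 1)))
    rw [le_div_iff₀ (by positivity)] at h1
    have h2 : 0 < min δ (1 / (4 * (C + 1))) := lt_min hδ (by positivity)
    nlinarith

/-- Near an interior minimum point `p` with `u''(p) = β`, the potential is the derivative of a
logarithm up to an integrable error. -/
theorem exists_log_majorant (h : IsProfile a b u u₁ u₂ u₃) (hμ : ∀ y ∈ Icc a b, μ ≤ u y) {p : ℝ}
    (hp : p ∈ Ioo a b) (hup : u p = μ) (hβ : u₂ p = β) :
    ∃ δ > 0, ∃ B K, 0 ≤ K ∧ ∀ c < μ, ∀ x ∈ Icc a b, x ≠ p → |x - p| < δ →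
      (μ - 1 < c → (B * Real.log (u x - c)) ^ 2 ≤ K * (1 / √|x - p|)) ∧
      B * (u₁ x / (u x - c)) - K * (1 / √|x - p|) ≤ pot u u₂ β c x := by
  have hp' := Ioo_subset_Icc_self hp
  obtain ⟨L, hL, hT⟩ := h.exists_taylor
  have hu1 := h.deriv_eq_zero hμ hp hup
  have hκ := h.second_pos hμ hp' hup hu1
  obtain ⟨δ, hδ, hquad⟩ := h.quadratic_lower hμ hp' hup hu1
  obtain ⟨D, hD0, hD⟩ := exists_abs_sub_le h.continuousOn μ
  set κ := u₂ p with hκdef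
  -- `u₂ - β` is about `u₃(p)(x - p)` and `u₁` about `κ(x - p)`, so this `B` cancels the linear
  -- terms of `u₂ - β - B u₁`. The remainder `O(r^{3/2})` divided by `u - c ≥ κ r²/4` is
  -- `O(r^{-1/2})`, which is integrable.
  set B := u₃ p / κ with hB
  -- the constant in the majorant
  set K₁ := 4 * (1 + |B|) * L / κ with hK₁
  set K₂ := B ^ 2 * ((D + 1) ^ 2 + 64 * √√(4 / κ)) with hK₂
  have hK₁0 : 0 ≤ K₁ := by positivity
  have hK₂0 : 0 ≤ K₂ := by positivity
  -- bound of the logarithm for `c` close to `μ`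
  have hGsq : ∀ c < μ, μ - 1 < c → ∀ x ∈ Icc a b, x ≠ p → |x - p| < min δ 1 → (B * Real.log (u x - c)) ^ 2 ≤
      K₂ * (1 / √|x - p|) := by
    intro c hc hc1 x hx hxp hxδ
    have hr : 0 < |x - p| := abs_pos.2 (sub_ne_zero.2 hxp)
    have hr1 := hxδ.trans_le (min_le_left _ _)
    have hr2 := hxδ.trans_le (min_le_right _ _)
    have h1 := hquad x hx hr1
    have hv : κ / 4 * |x - p| ^ 2 ≤ u x - c := by linarith
    have hv0 : 0 < u x - c := lt_of_lt_of_le (by positivity) hv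
    have hvE : u x - c ≤ D + 1 := by linarith [(abs_le.1 (hD x hx)).1]
    have h2 := sq_log_le hv0 hvE
    have h3 : √√(1 / (u x - c)) ≤ √√(4 / κ) * (1 / √|x - p|) := by
      have h4 : 1 / (u x - c) ≤ 4 / κ * (1 / |x - p|) ^ 2 := by
        have : 1 / (u x - c) ≤ 1 / (κ / 4 * |x - p| ^ 2) := by gcongr
        refine this.trans_eq ?_
        field_simp
      calc √√(1 / (u x - c)) ≤ √√(4 / κ * (1 / |x - p|) ^ 2) := by gcongr
        _ = _ := by
          rw [Real.sqrt_mul (by positivity), Real.sqrt_sq (by positivity),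
            Real.sqrt_mul (by positivity), Real.sqrt_div zero_le_one, Real.sqrt_one]
    have h5 : 1 ≤ 1 / √|x - p| := by
      rw [le_div_iff₀ (Real.sqrt_pos.2 hr), one_mul]
      exact Real.sqrt_le_one.2 hr2.le
    have h6 : Real.log (u x - c) ^ 2 ≤ ((D + 1) ^ 2 + 64 * √√(4 / κ)) * (1 / √|x - p|) := by
      have : (D + 1) ^ 2 * 1 ≤ (D + 1) ^ 2 * (1 / √|x - p|) := by gcongr
      linarith
    rw [mul_pow, hK₂, mul_assoc]
    gcongr
  have hqG : ∀ c < μ, ∀ x ∈ Icc a b, x ≠ p → |x - p| < min δ 1 →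
      B * (u₁ x / (u x - c)) - K₁ * (1 / √|x - p|) ≤ pot u u₂ β c x := by
    intro c hc x hx hxp hxδ
    have hr : 0 < |x - p| := abs_pos.2 (sub_ne_zero.2 hxp)
    have hr1 := hxδ.trans_le (min_le_left _ _)
    have hr2 := hxδ.trans_le (min_le_right _ _)
    have h1 := hquad x hx hr1
    have hv : κ / 4 * |x - p| ^ 2 ≤ u x - c := by linarith
    obtain ⟨-, t1, -, t3⟩ := hT p hp' x hx
    rw [hu1, sub_zero] at t1
    have hsr : √|x - p| * √|x - p| = |x - p| := Real.mul_self_sqrt hr.le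
    have hs0 : 0 < √|x - p| := Real.sqrt_pos.2 hr
    have hs1 : √|x - p| ≤ 1 := Real.sqrt_le_one.2 hr2.le
    have hnum : |u₂ x - β - B * u₁ x| ≤ (1 + |B|) * L * (√|x - p| * |x - p|) := by
      have e : u₂ x - β - B * u₁ x = (u₂ x - u₂ p - u₃ p * (x - p)) -
          B * (u₁ x - u₂ p * (x - p)) := by
        rw [← hβ, hB, ← hκdef]; field_simp; ring
      rw [e]
      have h2 : |B * (u₁ x - u₂ p * (x - p))| ≤ |B| * (L * |x - p| ^ 2) := by
        rw [abs_mul]; gcongr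
      have h3 : |x - p| ^ 2 ≤ √|x - p| * |x - p| := by nlinarith
      have h4 : |B| * (L * |x - p| ^ 2) ≤ |B| * (L * (√|x - p| * |x - p|)) := by gcongr
      have h5 := abs_sub (u₂ x - u₂ p - u₃ p * (x - p)) (B * (u₁ x - u₂ p * (x - p)))
      linarith
    have h2 := neg_div_le_div (w := u₂ x - β - B * u₁ x) (v := u x - c)
      (N := (1 + |B|) * L * (√|x - p| * |x - p|)) (D := κ / 4 * |x - p| ^ 2) (by positivity)
      (abs_le.1 hnum).1 (by positivity) hv
    have e1 : (1 + |B|) * L * (√|x - p| * |x - p|) / (κ / 4 * |x - p| ^ 2) =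
        K₁ * (1 / √|x - p|) := by
      rw [hK₁]
      generalize √|x - p| = w at *
      rw [← hsr]
      field_simp
    rw [e1, sub_div, mul_div_assoc] at h2
    rw [pot]
    linarith
  refine ⟨min δ 1, lt_min hδ one_pos, B, K₁ + K₂, by positivity, fun c hc x hx hxp hxδ =>
    ⟨fun hc1 => ?_, ?_⟩⟩
  · refine (hGsq c hc hc1 x hx hxp hxδ).trans ?_
    have : 0 ≤ K₁ * (1 / √|x - p|) := by positivity
    linarith
  · refine le_trans ?_ (hqG c hc x hx hxp hxδ)
    have : 0 ≤ K₂ * (1 / √|x - p|) := by positivity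
    linarith

/-- The potentials near an interior minimum point `p` with `u''(p) = β`. -/
theorem form_bound_borderline (h : IsProfile a b u u₁ u₂ u₃) (hμ : ∀ y ∈ Icc a b, μ ≤ u y) {p : ℝ}
    (hp : p ∈ Ioo a b) (hup : u p = μ) (hβ : u₂ p = β) :
    ∃ δ > 0, ∀ s t, a ≤ s → t ≤ b → s < p → p < t → p - δ < s → t < p + δ →
      ∃ C, 0 ≤ C ∧ ∀ c < μ, ∀ φ φ', HasDerivOn a b φ φ' → ContinuousOn φ' (Icc a b) →
        -C * ∫ x in s..t, φ x ^ 2 ≤ ∫ x in s..t, φ' x ^ 2 + pot u u₂ β c x * φ x ^ 2 := by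
  obtain ⟨δ, hδ, B, K, hK, hBK⟩ := h.exists_log_majorant hμ hp hup hβ
  obtain ⟨M, hM0, hM⟩ := h.exists_bound β
  refine ⟨δ, hδ, fun s t hs ht hsp hpt hsδ htδ => ?_⟩
  have hst : s < t := hsp.trans hpt
  have hsub : Icc s t ⊆ Icc a b := Icc_subset_Icc hs ht
  have hnear : ∀ x ∈ Icc s t, |x - p| < δ := by
    intro x hx
    rw [abs_lt]; constructor <;> linarith [hx.1, hx.2]
  obtain ⟨ρ, hρdef⟩ : ∃ ρ : ℝ → ℝ, ∀ x, ρ x = K * (1 / √|x - p|) := ⟨_, fun _ => rfl⟩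
  have hρ : IntervalIntegrable ρ volume s t := by
    rw [funext hρdef]; exact (intervalIntegrable_inv_sqrt_abs p s t).const_mul _
  have hρ0 : ∀ x, 0 ≤ ρ x := fun x => by rw [hρdef]; positivity
  simp only [← hρdef] at hBK
  obtain ⟨R, hR⟩ : ∃ R, R = ∫ x in s..t, ρ x := ⟨_, rfl⟩
  have hR0 : 0 ≤ R := hR ▸ intervalIntegral.integral_nonneg hst.le fun x _ => hρ0 x
  -- The boundary values obey `|G| ≤ G² + 1 ≤ ρ + 1`, uniformly in `c`; this needs `s` and `t` to
  -- differ from `p`.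
  obtain ⟨Γ, hΓ⟩ : ∃ Γ, Γ = max (ρ s) (ρ t) + 1 := ⟨_, rfl⟩
  have hΓ0 : 0 ≤ Γ := by rw [hΓ]; have := (hρ0 s).trans (le_max_left _ (ρ t)); linarith
  set C₀ := (2 * Γ + 3 * R + 1) * (2 * (2 * Γ + 3 * R + 1) + 1 / (t - s)) with hC₀
  have hts : 0 < t - s := sub_pos.2 hst
  refine ⟨max C₀ M, le_max_of_le_right hM0, fun c hc φ φ' hφ hφ' => ?_⟩
  have hφst := hφ.mono hs ht
  have hφ'st := hφ'.mono hsub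
  have hV := (h.continuousOn_pot_of_lt (β := β) hμ hc).mono hsub
  have hsq : 0 ≤ ∫ x in s..t, φ x ^ 2 :=
    intervalIntegral.integral_nonneg hst.le fun x _ => sq_nonneg _
  -- For `c ≤ μ - 1` the denominator is at least `1` and the potential at least `-M`. Excluding this
  -- range keeps the logarithm bounded above.
  rcases le_or_gt c (μ - 1) with hc1 | hc1
  · have := form_bound_of_bounded_below (C := M) hst.le hV (fun y hy => ?_) hφst hφ'st
    · nlinarith [mul_le_mul_of_nonneg_right (le_max_right C₀ M) hsq]
    · have h1 := neg_div_le_div (w := u₂ y - β) (v := u y - c) hM0 (abs_le.1 (hM y (hsub hy))).1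
        one_pos (by linarith [hμ y (hsub hy)])
      rwa [div_one] at h1
  · have hpos : ∀ x ∈ Icc s t, 0 < u x - c := fun x hx => by linarith [hμ x (hsub hx)]
    have hG : HasDerivOn s t (fun x => B * Real.log (u x - c))
        (fun x => B * (u₁ x / (u x - c))) := fun x hx =>
      ((((h.deriv₁.mono hs ht) x hx).sub_const c).log (hpos x hx).ne').const_mul B
    have hG' : ContinuousOn (fun x => B * (u₁ x / (u x - c))) (Icc s t) :=
      continuousOn_const.mul ((h.deriv₂.continuousOn.mono hsub).div
        ((h.continuousOn.mono hsub).sub continuousOn_const) fun x hx => (hpos x hx).ne')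
    have hend : ∀ x ∈ Icc s t, x ≠ p → |B * Real.log (u x - c)| ≤ ρ x + 1 := by
      intro x hx hxp
      have h1 := (hBK c hc x (hsub hx) hxp (hnear x hx)).1 hc1
      rw [← sq_abs] at h1
      nlinarith [sq_nonneg (|B * Real.log (u x - c)| - 1), abs_nonneg (B * Real.log (u x - c))]
    have := form_bound_of_singular (p := p) (Γ := Γ) hst hV hG hG' hρ (fun x _ => hρ0 x)
      ((hend s (left_mem_Icc.2 hst.le) hsp.ne).trans (by rw [hΓ]; gcongr; exact le_max_left _ _))
      ((hend t (right_mem_Icc.2 hst.le) hpt.ne').trans (by rw [hΓ]; gcongr; exact le_max_right _ _))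
      (fun x hx hxp => (hBK c hc x (hsub hx) hxp (hnear x hx)).2)
      (fun x hx hxp => (hBK c hc x (hsub hx) hxp (hnear x hx)).1 hc1) hφst hφ'st
    rw [← hR] at this
    nlinarith [mul_le_mul_of_nonneg_right (le_max_left C₀ M) hsq]

/-- The form is bounded below, uniformly in `c`, on the functions which vanish at the interior
minimum points where `u'' < β`. -/
theorem exists_form_bound (h : IsProfile a b u u₁ u₂ u₃) (hμ : ∀ y ∈ Icc a b, μ ≤ u y)
    (hβ : ∀ y ∈ Icc a b, u₁ y = 0 → u y = μ → β ≤ 9 / 8 * u₂ y) :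
    ∃ C, 0 ≤ C ∧ ∀ c < μ, ∀ φ φ', HasDerivOn a b φ φ' → ContinuousOn φ' (Icc a b) →
      φ a = 0 → φ b = 0 → (∀ x ∈ Ioo a b, u x = μ → u₂ x - β < 0 → φ x = 0) →
      -C * ∫ x in a..b, φ x ^ 2 ≤ ∫ x in a..b, φ' x ^ 2 + pot u u₂ β c x * φ x ^ 2 := by
  refine interval_induction (P := fun s t => ∃ C, 0 ≤ C ∧ ∀ c < μ, ∀ φ φ', HasDerivOn a b φ φ' →
    ContinuousOn φ' (Icc a b) → φ a = 0 → φ b = 0 →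
    (∀ x ∈ Ioo a b, u x = μ → u₂ x - β < 0 → φ x = 0) →
    -C * ∫ x in s..t, φ x ^ 2 ≤ ∫ x in s..t, φ' x ^ 2 + pot u u₂ β c x * φ x ^ 2) h.lt ?_ ?_
  · rintro r s t hr hrs hst ht ⟨C, hC0, hC⟩ ⟨C', hC0', hC'⟩
    refine ⟨max C C', le_max_of_le_left hC0, fun c hc φ φ' hφ hφ' ha hb h0 => ?_⟩
    have hcont : ContinuousOn (fun x => φ' x ^ 2 + pot u u₂ β c x * φ x ^ 2) (Icc a b) :=
      (hφ'.pow 2).add ((h.continuousOn_pot_of_lt hμ hc).mul (hφ.continuousOn.pow 2))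
    have hsq := hφ.continuousOn.pow 2
    have hsub1 : Icc r s ⊆ Icc a b := Icc_subset_Icc hr (by linarith)
    have hsub2 : Icc s t ⊆ Icc a b := Icc_subset_Icc (by linarith) ht
    rw [← intervalIntegral.integral_add_adjacent_intervals (b := s) (c := t)
        (f := fun x => φ' x ^ 2 + pot u u₂ β c x * φ x ^ 2)
        ((hcont.mono hsub1).intervalIntegrable_of_Icc hrs.le)
        ((hcont.mono hsub2).intervalIntegrable_of_Icc hst.le),
      ← intervalIntegral.integral_add_adjacent_intervals (b := s) (c := t)
        (f := fun x => φ x ^ 2)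
        ((hsq.mono hsub1).intervalIntegrable_of_Icc hrs.le)
        ((hsq.mono hsub2).intervalIntegrable_of_Icc hst.le)]
    have h1 := hC c hc φ φ' hφ hφ' ha hb h0
    have h2 := hC' c hc φ φ' hφ hφ' ha hb h0
    have h3 : 0 ≤ ∫ x in r..s, φ x ^ 2 :=
      intervalIntegral.integral_nonneg hrs.le fun x _ => sq_nonneg _
    have h4 : 0 ≤ ∫ x in s..t, φ x ^ 2 :=
      intervalIntegral.integral_nonneg hst.le fun x _ => sq_nonneg _
    nlinarith [mul_le_mul_of_nonneg_right (le_max_left C C') h3,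
      mul_le_mul_of_nonneg_right (le_max_right C C') h4]
  · intro p hp
    -- Exactly the points where `φ` is known to vanish, so that Hardy's inequality applies.
    by_cases hcase : p = a ∨ p = b ∨ (p ∈ Ioo a b ∧ u p = μ ∧ u₂ p - β < 0)
    · obtain ⟨δ, hδ, C, hC0, hC⟩ := h.pot_hardy hμ hβ hp
      refine ⟨min δ (1 / (4 * (C + 1))), lt_min hδ (by positivity),
        fun s t hs ht _ hsp hpt hsδ htδ _ _ => ⟨0, le_rfl, fun c hc φ φ' hφ hφ' ha hb h0 => ?_⟩⟩
      rw [neg_zero, zero_mul]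
      refine form_nonneg_of_hardy hC0 hs ht hsp hpt hsδ htδ ?_ (h.continuousOn_pot_of_lt hμ hc)
        (fun y hy hyp hyδ => hC c hc y hy hyp (hyδ.trans_le (min_le_left _ _))) hφ hφ' ?_
      · have h1 := min_le_right δ (1 / (4 * (C + 1)))
        rw [le_div_iff₀ (by positivity)] at h1
        have h2 : 0 < min δ (1 / (4 * (C + 1))) := lt_min hδ (by positivity)
        nlinarith
      · rcases hcase with rfl | rfl | ⟨h1, h2, h3⟩
        · exact ha
        · exact hb
        · exact h0 p h1 h2 h3
    push Not at hcase
    obtain ⟨hpa, hpb, hcase⟩ := hcase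
    have hpI : p ∈ Ioo a b := ⟨lt_of_le_of_ne hp.1 (Ne.symm hpa), lt_of_le_of_ne hp.2 hpb⟩
    -- a uniform lower bound near `p` suffices
    have key : (∃ δ > 0, ∃ C, 0 ≤ C ∧ ∀ c < μ, ∀ y ∈ Icc a b, |y - p| < δ →
        -C ≤ pot u u₂ β c y) → ∃ δ > 0, ∀ s t, a ≤ s → t ≤ b → s < t → s ≤ p → p ≤ t → p - δ < s →
        t < p + δ → (s < p ∨ p = a) → (p < t ∨ p = b) →
        ∃ C, 0 ≤ C ∧ ∀ c < μ, ∀ φ φ', HasDerivOn a b φ φ' →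
        ContinuousOn φ' (Icc a b) → φ a = 0 → φ b = 0 →
        (∀ x ∈ Ioo a b, u x = μ → u₂ x - β < 0 → φ x = 0) →
        -C * ∫ x in s..t, φ x ^ 2 ≤ ∫ x in s..t, φ' x ^ 2 + pot u u₂ β c x * φ x ^ 2 := by
      rintro ⟨δ, hδ, C, hC0, hC⟩
      refine ⟨δ, hδ, fun s t hs ht hst hsp hpt hsδ htδ _ _ => ⟨C, hC0,
        fun c hc φ φ' hφ hφ' _ _ _ => ?_⟩⟩
      have hsub : Icc s t ⊆ Icc a b := Icc_subset_Icc hs ht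
      refine form_bound_of_bounded_below hst.le ((h.continuousOn_pot_of_lt hμ hc).mono hsub)
        (fun y hy => hC c hc y (hsub hy) ?_) (hφ.mono hs ht) (hφ'.mono hsub)
      rw [abs_lt]; constructor <;> linarith [hy.1, hy.2]
    rcases (hμ p hp).lt_or_eq with hup | hup
    · exact key (h.pot_bounded_below β hp hup)
    have h2 : β ≤ u₂ p := by linarith [hcase hpI hup.symm]
    -- At an interior minimum point with `u'' > β` the potential is nonnegative nearby; equality is
    -- the borderline case.
    rcases h2.lt_or_eq with h2 | h2
    · refine key ?_
      obtain ⟨δ, hδ, hd⟩ := Metric.continuousWithinAt_iff.1 (h.continuousOn₂ p hp) (u₂ p - β)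
        (by linarith)
      refine ⟨δ, hδ, 0, le_rfl, fun c hc y hy hyδ => ?_⟩
      rw [neg_zero]
      have h3 := (abs_lt.1 (hd hy hyδ)).1
      exact div_nonneg (by linarith) (by linarith [hμ y hy])
    · obtain ⟨δ, hδ, H⟩ := h.form_bound_borderline hμ hpI hup.symm h2.symm
      refine ⟨δ, hδ, fun s t hs ht hst hsp hpt hsδ htδ h3 h4 => ?_⟩
      obtain ⟨C, hC0, hC⟩ := H s t hs ht (h3.resolve_right hpa) (h4.resolve_right hpb) hsδ htδ
      exact ⟨C, hC0, fun c hc φ φ' hφ hφ' _ _ _ => hC c hc φ φ' hφ hφ'⟩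

end IsProfile

/-! ### Bounds for `eig` from angles and from forms -/

section Eig

variable {y₁ y₂ : ℝ} {u : ℝ → ℝ} {β c : ℝ}

theorem exists_eig_seq (hy : y₁ < y₂) (hq : ContinuousOn (pot u (d2 y₁ y₂ u) β c) (Icc y₁ y₂)) :
    ∃ e : ℕ → ℝ, StrictMono e ∧ range e = {μ | IsEigenvalue y₁ y₂ u β c μ} ∧
      (∀ n, eig y₁ y₂ u β (n + 1) c = e n) ∧
      (∀ n, ∃ φ φ', IsEigenfunction y₁ y₂ (pot u (d2 y₁ y₂ u) β c) (e n) φ φ') ∧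
      ∀ n l θ, IsPruefer y₁ y₂ (pot u (d2 y₁ y₂ u) β c) l θ →
        ((n + 1 : ℕ) : ℝ) * Real.pi ≤ θ y₂ → e n ≤ l := by
  obtain ⟨e, he, hev, hle⟩ := exists_eigenvalue_seq hy hq
  have hr : range e = {μ | IsEigenvalue y₁ y₂ u β c μ} := by
    ext l
    rw [← hev l]
    exact (isEigenvalue_iff hy hq l).symm
  exact ⟨e, he, hr, fun n => eig_eq_of_seq he hr n, fun n => (hev _).2 (mem_range_self n), hle⟩

theorem eig_le_of_isPruefer (hy : y₁ < y₂)
    (hq : ContinuousOn (pot u (d2 y₁ y₂ u) β c) (Icc y₁ y₂)) {n : ℕ} (hn : 1 ≤ n) {l : ℝ}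
    (h : ∀ θ, IsPruefer y₁ y₂ (pot u (d2 y₁ y₂ u) β c) l θ → n * Real.pi ≤ θ y₂) :
    eig y₁ y₂ u β n c ≤ l := by
  obtain ⟨e, -, -, heig, -, hle⟩ := exists_eig_seq hy hq
  obtain ⟨n, rfl⟩ := Nat.exists_eq_add_of_le' hn
  obtain ⟨θ, hθ⟩ := exists_isPruefer hy.le hq l
  rw [heig]
  exact hle n l θ hθ (h θ hθ)

theorem neg_le_eig_of_form_bound (hy : y₁ < y₂)
    (hq : ContinuousOn (pot u (d2 y₁ y₂ u) β c) (Icc y₁ y₂)) (P : Finset ℝ) (C : ℝ)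
    (hform : ∀ φ φ', HasDerivOn y₁ y₂ φ φ' → ContinuousOn φ' (Icc y₁ y₂) → φ y₁ = 0 → φ y₂ = 0 →
      (∀ x ∈ P, φ x = 0) → -C * ∫ x in y₁..y₂, φ x ^ 2 ≤
        ∫ x in y₁..y₂, φ' x ^ 2 + pot u (d2 y₁ y₂ u) β c x * φ x ^ 2)
    {n : ℕ} (hn : P.card + 1 ≤ n) : -C ≤ eig y₁ y₂ u β n c := by
  obtain ⟨e, he, -, heig, hef, -⟩ := exists_eig_seq hy hq
  obtain ⟨n, rfl⟩ := Nat.exists_eq_add_of_le' (show 1 ≤ n by omega)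
  rw [heig]
  exact (neg_le_of_form_bound hy hq he hef P C hform).trans (he.monotone (by omega))

end Eig

/-! ### Zeros forced by a concentrated well -/

/-- For the test function `δ² - x²`, the well of depth `k/r²` and width `2r` contributes at most
`-2k(δ⁴/4)/r`, while everything else is at most `2δ(4δ² + |l| δ⁴)`. Small `r` wins. -/
theorem integral_neg_of_concentrated {V : ℝ → ℝ} {δ r k l : ℝ} (hδ : 0 < δ) (hr0 : 0 < r)
    (hr1 : r ≤ δ / 2) (hk : 0 ≤ k) (hVc : ContinuousOn V (Icc (-δ) δ))
    (hV0 : ∀ x ∈ Icc (-δ) δ, V x ≤ 0) (hVk : ∀ x ∈ Icc (-r) r, V x ≤ -(k / r ^ 2))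
    (hsmall : δ * (4 * δ ^ 2 + |l| * δ ^ 4) * r < k * (δ ^ 4 / 4)) :
    ∫ x in (-δ)..δ, ((-(2 * x)) ^ 2 + (V x - l) * (δ ^ 2 - x ^ 2) ^ 2) < 0 := by
  set N₀ := 4 * δ ^ 2 + |l| * δ ^ 4 with hN₀
  set f : ℝ → ℝ := fun x => (-(2 * x)) ^ 2 + (V x - l) * (δ ^ 2 - x ^ 2) ^ 2
    with hf
  have hfc : ContinuousOn f (Icc (-δ) δ) :=
    ContinuousOn.add (by fun_prop) ((hVc.sub continuousOn_const).mul (by fun_prop))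
  have hbase : ∀ x ∈ Icc (-δ) δ, f x ≤ N₀ + V x * (δ ^ 2 - x ^ 2) ^ 2 := by
    intro x hx
    have h1 : x ^ 2 ≤ δ ^ 2 := sq_le_sq' hx.1 hx.2
    have h2 : (δ ^ 2 - x ^ 2) ^ 2 ≤ δ ^ 4 := by nlinarith [sq_nonneg x]
    have h3 : -l * (δ ^ 2 - x ^ 2) ^ 2 ≤ |l| * δ ^ 4 :=
      mul_le_mul (neg_le_abs l) h2 (sq_nonneg _) (abs_nonneg l)
    simp only [hf, hN₀]
    nlinarith
  have hout : ∀ x ∈ Icc (-δ) δ, f x ≤ N₀ := fun x hx =>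
    (hbase x hx).trans (by nlinarith [hV0 x hx, sq_nonneg (δ ^ 2 - x ^ 2)])
  have hin : ∀ x ∈ Icc (-r) r, f x ≤ N₀ - k * (δ ^ 4 / 4) / r ^ 2 := by
    intro x hx
    have hx' : x ∈ Icc (-δ) δ := ⟨by linarith [hx.1], by linarith [hx.2]⟩
    have h1 := hVk x hx
    have h2 : x ^ 2 ≤ r ^ 2 := sq_le_sq' hx.1 hx.2
    have h3 : δ ^ 2 / 2 ≤ δ ^ 2 - x ^ 2 := by nlinarith
    have h4 : δ ^ 4 / 4 ≤ (δ ^ 2 - x ^ 2) ^ 2 := by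
      have : (δ ^ 2 / 2) ^ 2 ≤ (δ ^ 2 - x ^ 2) ^ 2 := by gcongr
      linarith
    have h5 : k / r ^ 2 * (δ ^ 4 / 4) = k * (δ ^ 4 / 4) / r ^ 2 := by ring
    have h6 : k / r ^ 2 * (δ ^ 4 / 4) ≤
        k / r ^ 2 * (δ ^ 2 - x ^ 2) ^ 2 := by gcongr
    have h7 := mul_le_mul_of_nonneg_right h1 (sq_nonneg (δ ^ 2 - x ^ 2))
    linarith [hbase x hx']
  have hi : ∀ {s t : ℝ}, -δ ≤ s → s ≤ t → t ≤ δ → IntervalIntegrable f volume s t :=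
    fun h1 h2 h3 => (hfc.mono (Icc_subset_Icc h1 h3)).intervalIntegrable_of_Icc h2
  have hle : ∀ {s t N : ℝ}, -δ ≤ s → s ≤ t → t ≤ δ → (∀ x ∈ Icc s t, f x ≤ N) →
      ∫ x in s..t, f x ≤ (t - s) * N := by
    intro s t N h1 h2 h3 h4
    have := intervalIntegral.integral_mono_on h2 (hi h1 h2 h3) intervalIntegrable_const h4
    rwa [intervalIntegral.integral_const, smul_eq_mul] at this
  have i1 := hle (s := -δ) (t := -r) (N := N₀) le_rfl (by linarith) (by linarith)
    fun x hx => hout x ⟨hx.1, by linarith [hx.2]⟩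
  have i2 := hle (s := -r) (t := r) (by linarith) (by linarith) (by linarith) hin
  have i3 := hle (s := r) (t := δ) (N := N₀) (by linarith) (by linarith) le_rfl
    fun x hx => hout x ⟨by linarith [hx.1], hx.2⟩
  rw [← intervalIntegral.integral_add_adjacent_intervals (b := r) (hi le_rfl (by linarith)
    (by linarith)) (hi (by linarith) (by linarith) le_rfl),
    ← intervalIntegral.integral_add_adjacent_intervals (b := -r) (hi le_rfl (by linarith)
    (by linarith)) (hi (by linarith) (by linarith) (by linarith))]
  have h8 : (r - -r) * (N₀ - k * (δ ^ 4 / 4) / r ^ 2) = 2 * r * N₀ - 2 * (k * (δ ^ 4 / 4) / r) := by field_simp; ring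
  have h9 : δ * N₀ < k * (δ ^ 4 / 4) / r := by rw [lt_div_iff₀ hr0]; linarith
  rw [h8] at i2
  linarith

namespace IsProfile

variable {u u₁ u₂ u₃ : ℝ → ℝ} {β μ : ℝ}

/-- An accumulation point would again be such a point, but quadratic growth of `u - μ` isolates it.
-/
theorem finite_minimum_points (h : IsProfile a b u u₁ u₂ u₃) (hμ : ∀ y ∈ Icc a b, μ ≤ u y) :
    {y ∈ Icc a b | u y = μ ∧ u₁ y = 0}.Finite := by
  by_contra hinf
  set T := {y ∈ Icc a b | u y = μ ∧ u₁ y = 0} with hT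
  have hTsub : T ⊆ Icc a b := fun y hy => hy.1
  obtain ⟨x, hx, hacc⟩ := Set.Infinite.exists_accPt_of_subset_isCompact hinf isCompact_Icc hTsub
  have hclosed : IsClosed T := by
    have h1 := h.continuousOn.preimage_isClosed_of_isClosed isClosed_Icc (isClosed_singleton (x := μ))
    have h2 := h.deriv₂.continuousOn.preimage_isClosed_of_isClosed isClosed_Icc
      (isClosed_singleton (x := (0 : ℝ)))
    convert h1.inter h2 using 1
    ext y
    simp only [hT, mem_ofPred_eq, mem_inter_iff, mem_preimage, mem_singleton_iff]
    tauto
  have hxT : x ∈ T := by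
    rw [← hclosed.closure_eq, mem_closure_iff_clusterPt]
    exact hacc.clusterPt
  obtain ⟨δ, hδ, hd⟩ := h.quadratic_lower hμ hx hxT.2.1 hxT.2.2
  have hκ := h.second_pos hμ hx hxT.2.1 hxT.2.2
  rw [accPt_iff_frequently] at hacc
  obtain ⟨y, ⟨hyx, hyT⟩, hyδ⟩ := (hacc.and_eventually (Metric.ball_mem_nhds x hδ)).exists
  have h1 := hd y hyT.1 hyδ
  rw [hyT.2.1, sub_self] at h1
  have h2 : 0 < |y - x| := abs_pos.2 (sub_ne_zero.2 hyx)
  have : 0 < u₂ x / 4 * |y - x| ^ 2 := by positivity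
  linarith

/-- Near an interior minimum point with `u'' < β` the solutions have a zero once `c` is close to
the minimum. -/
theorem eventually_exists_sin_eq_zero (h : IsProfile a b u u₁ u₂ u₃) (hμ : ∀ y ∈ Icc a b, μ ≤ u y)
    {p : ℝ} (hp : p ∈ Ioo a b) (hup : u p = μ) (hβ : u₂ p < β) {δ₀ : ℝ} (hδ₀ : 0 < δ₀) (l : ℝ) :
    ∀ᶠ c in 𝓝[<] μ, ∀ θ, IsPruefer a b (pot u u₂ β c) l θ →
      ∃ z ∈ Ioc a b, |z - p| < δ₀ ∧ Real.sin (θ z) = 0 := by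
  have hp' := Ioo_subset_Icc_self hp
  obtain ⟨L, hL, hT⟩ := h.exists_taylor
  have hu1 := h.deriv_eq_zero hμ hp hup
  have hκ := h.second_pos hμ hp' hup hu1
  -- a small interval about `p`
  obtain ⟨δ, hδ, hδ₀', hδa, hδb, hδ1, hδL⟩ : ∃ δ > 0, δ < δ₀ ∧ δ < p - a ∧ δ < b - p ∧ δ < 1 ∧
      L * δ < (β - u₂ p) / 2 := by
    have h1 : ∀ {w : ℝ}, 0 < w → ∀ᶠ δ in 𝓝[>] (0 : ℝ), δ < w := fun hw =>
      mem_nhdsWithin_of_mem_nhds (Iio_mem_nhds hw)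
    obtain ⟨δ, ⟨h1, h2, h3, h4, h5⟩, h6⟩ := (((h1 hδ₀).and ((h1 (sub_pos.2 hp.1)).and
      ((h1 (sub_pos.2 hp.2)).and ((h1 one_pos).and
      (h1 (div_pos (show 0 < (β - u₂ p) / 2 by linarith) hL)))))).and self_mem_nhdsWithin).exists
    refine ⟨δ, h6, h1, h2, h3, h4, ?_⟩
    rw [lt_div_iff₀ hL] at h5
    linarith
  set k := (β - u₂ p) / 2 with hk
  have hk0 : 0 < k := by rw [hk]; linarith
  set K := u₂ p / 2 + L with hK
  have hK0 : 0 < K := by positivity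
  set N₀ := 4 * δ ^ 2 + |l| * δ ^ 4 with hN₀
  have hN₀0 : 0 < N₀ := by positivity
  set J := k / (K + 1) * (δ ^ 4 / 4) with hJ
  have hJ0 : 0 < J := by positivity
  -- it suffices that `√(μ - c)` is small
  have hev : ∀ᶠ c in 𝓝[<] μ, c < μ ∧ √(μ - c) < δ / 2 ∧ √(μ - c) < J / (δ * N₀) := by
    have hlim : Tendsto (fun c => √(μ - c)) (𝓝[<] μ) (𝓝 0) := by
      have : Continuous fun c => √(μ - c) := by fun_prop
      simpa using (this.tendsto μ).mono_left nhdsWithin_le_nhds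
    filter_upwards [self_mem_nhdsWithin, hlim.eventually (Iio_mem_nhds (half_pos hδ)),
      hlim.eventually (Iio_mem_nhds (show 0 < J / (δ * N₀) by positivity))] with c h1 h2 h3
    exact ⟨h1, h2, h3⟩
  filter_upwards [hev] with c ⟨hc, hr1, hr2⟩ θ hθ
  -- The scale at which `x²` and `μ - c` balance: for `|x| ≤ r` one has `u - c ≤ (K + 1) r²`, so the
  -- well has depth at least `k/((K + 1) r²)`.
  set r := √(μ - c) with hr
  have hr0 : 0 < r := Real.sqrt_pos.2 (sub_pos.2 hc)
  have hrsq : r ^ 2 = μ - c := Real.sq_sqrt (sub_pos.2 hc).le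
  have hm : ∀ x ∈ Icc (-δ) δ, p + 1 * x ∈ Icc a b := fun x hx =>
    ⟨by linarith [hx.1], by linarith [hx.2]⟩
  by_contra! hcon
  obtain ⟨g, hg⟩ := hθ.exists_riccati (s := -δ) (t := δ) (c := p) (τ := 1) (by norm_num) hm
    fun x hx => hcon _ ⟨by linarith [hx.1], by linarith [hx.2]⟩ (by
      rw [one_mul, add_sub_cancel_left]; exact (abs_le.2 hx).trans_lt hδ₀')
  have hmc : ContinuousOn (fun x : ℝ => p + 1 * x) (Icc (-δ) δ) := by fun_prop
  have hV' : ContinuousOn (fun x => pot u u₂ β c (p + 1 * x)) (Icc (-δ) δ) :=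
    (h.continuousOn_pot_of_lt hμ hc).comp hmc hm
  have hV : ContinuousOn (fun x => pot u u₂ β c (p + 1 * x) - l) (Icc (-δ) δ) :=
    hV'.sub continuousOn_const
  have hφ : HasDerivOn (-δ) δ (fun x => δ ^ 2 - x ^ 2) (fun x => -(2 * x)) := fun x _ => by
    have := (((hasDerivAt_id' x).fun_pow 2).const_sub (δ ^ 2)).hasDerivWithinAt (s := Icc (-δ) δ)
    exact this.congr_deriv (by norm_num)
  have hform := hg.integral_nonneg_of_riccati (V := fun x => pot u u₂ β c (p + 1 * x) - l)
    (by linarith) hV hφ (by fun_prop) (by ring) (by ring)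
  have hpot : ∀ x ∈ Icc (-δ) δ, pot u u₂ β c (p + 1 * x) ≤ 0 ∧
      (|x| ≤ r → pot u u₂ β c (p + 1 * x) ≤ -(k / (K + 1) / r ^ 2)) := by
    intro x hx
    have hxδ : |x| ≤ δ := abs_le.2 hx
    obtain ⟨t2, -, t0, -⟩ := hT p hp' _ (hm x hx)
    have h0 := hμ _ (hm x hx)
    rw [hu1, hup] at t0
    rw [one_mul, add_sub_cancel_left] at t0 t2
    rw [one_mul] at h0 ⊢
    have t2 := (abs_le.1 t2).2
    have t0 := (abs_le.1 t0).2
    have hLx : L * |x| ≤ L * δ := by gcongr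
    have hnum : u₂ (p + x) - β ≤ -k := by rw [hk] at hδL ⊢; linarith
    have hv : 0 < u (p + x) - c := by linarith
    refine ⟨div_nonpos_of_nonpos_of_nonneg (by linarith) hv.le, fun hxr => ?_⟩
    have h3 : |x| ^ 3 ≤ |x| ^ 2 := pow_le_pow_of_le_one (abs_nonneg x) (by linarith) (by norm_num)
    have h4 : |x| ^ 2 ≤ r ^ 2 := by gcongr
    have h5 : u (p + x) - c ≤ (K + 1) * r ^ 2 := by
      have e : x ^ 2 = |x| ^ 2 := (sq_abs x).symm
      rw [e] at t0
      have : L * |x| ^ 3 ≤ L * |x| ^ 2 := by gcongr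
      have : K * |x| ^ 2 ≤ K * r ^ 2 := by gcongr
      nlinarith
    rw [pot, div_div, ← neg_div, div_le_div_iff₀ hv (by positivity)]
    nlinarith [mul_le_mul_of_nonneg_left h5 hk0.le,
      mul_le_mul_of_nonneg_right hnum (show 0 ≤ (K + 1) * r ^ 2 by positivity)]
  refine absurd hform (not_le.2 (integral_neg_of_concentrated hδ hr0 hr1.le (by positivity) hV'
    (fun x hx => (hpot x hx).1) (fun x hx => (hpot x (by
      constructor <;> linarith [hx.1, hx.2])).2 (abs_le.2 hx)) ?_))
  rwa [lt_div_iff₀ (by positivity), mul_comm] at hr2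

end IsProfile

/-! ### Eigenvalue asymptotics at the minimum -/

section Asymptotics

variable {y₁ y₂ : ℝ} {u u₁ u₃ : ℝ → ℝ} {β μ : ℝ}

/-- At any fixed level `l`, each of `n` such points attracts a zero once `c` is close to `μ`.
Separation of the points makes these zeros distinct, so `λ_n ≤ l`. -/
theorem tendsto_eig_atBot_of_le_ncard (h : IsProfile y₁ y₂ u u₁ (d2 y₁ y₂ u) u₃)
    (hμ : ∀ y ∈ Icc y₁ y₂, μ ≤ u y) {n : ℕ} (hn : 1 ≤ n)
    (hnm : n ≤ {p ∈ Ioo y₁ y₂ | u p = μ ∧ d2 y₁ y₂ u p - β < 0}.ncard) :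
    Tendsto (eig y₁ y₂ u β n) (𝓝[<] μ) atBot := by
  classical
  obtain ⟨T, hTsub, hTn⟩ := Set.exists_subset_card_eq hnm
  -- An infinite set has `ncard` zero, so `n ≥ 1` gives finiteness.
  have hTfin : T.Finite := Set.finite_of_ncard_pos (by omega)
  -- the points are separated
  obtain ⟨δ, hδ, hsep⟩ : ∃ δ > 0, ∀ p ∈ T, ∀ p' ∈ T, p ≠ p' → 2 * δ ≤ |p - p'| := by
    have : ∀ᶠ δ in 𝓝[>] (0 : ℝ), ∀ p ∈ T, ∀ p' ∈ T, p ≠ p' → 2 * δ ≤ |p - p'| := by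
      rw [eventually_all_finite hTfin]
      intro p _
      rw [eventually_all_finite hTfin]
      intro p' _
      by_cases hpp : p = p'
      · simp [hpp]
      have h0 : 0 < |p - p'| := abs_pos.2 (sub_ne_zero.2 hpp)
      filter_upwards [mem_nhdsWithin_of_mem_nhds (Iio_mem_nhds (half_pos h0))] with δ hδ _
      rw [mem_Iio] at hδ
      linarith
    obtain ⟨δ, h1, h2⟩ := (this.and self_mem_nhdsWithin).exists
    exact ⟨δ, h2, h1⟩
  rw [tendsto_atBot]
  intro l
  have hev : ∀ᶠ c in 𝓝[<] μ, ∀ p ∈ T, ∀ θ, IsPruefer y₁ y₂ (pot u (d2 y₁ y₂ u) β c) l θ →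
      ∃ z ∈ Ioc y₁ y₂, |z - p| < δ ∧ Real.sin (θ z) = 0 := by
    rw [eventually_all_finite hTfin]
    intro p hp
    obtain ⟨h1, h2, h3⟩ := hTsub hp
    exact h.eventually_exists_sin_eq_zero hμ h1 h2 (by linarith) hδ l
  filter_upwards [hev, self_mem_nhdsWithin] with c hz hc
  have hq := h.continuousOn_pot_of_lt (β := β) hμ hc
  refine eig_le_of_isPruefer h.lt hq hn fun θ hθ => ?_
  choose! z hz1 hz2 hz3 using fun p hp => hz p hp θ hθ
  have hinj : Set.InjOn z (hTfin.toFinset : Set ℝ) := by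
    intro p hp p' hp' hpp
    rw [Finite.coe_toFinset] at hp hp'
    by_contra hne
    have h1 := hsep p hp p' hp' hne
    have h2 := hz2 p hp
    have h3 := hz2 p' hp'
    rw [hpp] at h2
    have := abs_sub_le p (z p') p'
    rw [abs_sub_comm p (z p')] at this
    linarith
  have := hθ.card_mul_pi_le h.lt hq (hTfin.toFinset.image z) fun x hx => by
    obtain ⟨p, hp, rfl⟩ := Finset.mem_image.1 hx
    rw [Finite.mem_toFinset] at hp
    exact ⟨hz1 p hp, hz3 p hp⟩
  rwa [Finset.card_image_of_injOn hinj, ← Set.ncard_eq_toFinset_card T hTfin, hTn] at this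

theorem tendsto_eig_atBot_of_supercritical (h : IsProfile y₁ y₂ u u₁ (d2 y₁ y₂ u) u₃)
    (hμ : ∀ y ∈ Icc y₁ y₂, μ ≤ u y) {p : ℝ} (hp : p ∈ Icc y₁ y₂) (hup : u p = μ) (h1 : u₁ p = 0)
    (hβ : 9 / 8 * d2 y₁ y₂ u p < β) {n : ℕ} (hn : 1 ≤ n) :
    Tendsto (eig y₁ y₂ u β n) (𝓝[<] μ) atBot := by
  obtain ⟨γ, hγ, δ, hδ, H⟩ := h.pot_supercritical hμ hp hup h1 hβ
  rw [tendsto_atBot]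
  intro l
  -- Then `γ = 1/4 + 2σ²`: one `σ²` drives the oscillation, the other absorbs the level `l` on `x ≤
  -- r`, where `|l| r² ≤ σ²`.
  set σ := √((γ - 1 / 4) / 2) with hσ
  have hσ0 : 0 < σ := Real.sqrt_pos.2 (by linarith)
  have hσ2 : σ ^ 2 = (γ - 1 / 4) / 2 := Real.sq_sqrt (by linarith)
  -- choose the side on which there is room
  obtain ⟨τ, hτ, R, hR, hm⟩ : ∃ τ : ℝ, τ ^ 2 = 1 ∧ ∃ R > 0, ∀ x, 0 < x → x ≤ R →
      p + τ * x ∈ Ioc y₁ y₂ := by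
    rcases hp.2.eq_or_lt with hpb | hpb
    · exact ⟨-1, by norm_num, (y₂ - y₁) / 2, by linarith [h.lt], fun x h0 hx =>
        ⟨by linarith [h.lt], by linarith⟩⟩
    · exact ⟨1, by norm_num, y₂ - p, by linarith, fun x h0 hx => ⟨by linarith [hp.1], by linarith⟩⟩
  obtain ⟨r, hr0, hrR, hrδ, hrl⟩ : ∃ r > 0, r ≤ R ∧ r ≤ δ ∧ |l| * r ^ 2 ≤ σ ^ 2 := by
    have hw : 0 < σ / (|l| + 1) := by positivity
    refine ⟨min (min R δ) (min 1 (σ / (|l| + 1)) * min 1 σ),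
      lt_min (lt_min hR hδ) (mul_pos (lt_min one_pos hw) (lt_min one_pos hσ0)),
      (min_le_left _ _).trans (min_le_left _ _), (min_le_left _ _).trans (min_le_right _ _), ?_⟩
    set r := min (min R δ) (min 1 (σ / (|l| + 1)) * min 1 σ)
    have hr0 : 0 < r := lt_min (lt_min hR hδ) (mul_pos (lt_min one_pos hw) (lt_min one_pos hσ0))
    have hr1 : r ≤ min 1 (σ / (|l| + 1)) * min 1 σ := min_le_right _ _
    have e1 : min 1 (σ / (|l| + 1)) * min 1 σ ≤ σ / (|l| + 1) * 1 :=
      mul_le_mul (min_le_right _ _) (min_le_left _ _) (lt_min one_pos hσ0).le hw.le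
    have e2 : min 1 (σ / (|l| + 1)) * min 1 σ ≤ 1 * σ :=
      mul_le_mul (min_le_left _ _) (min_le_right _ _) (lt_min one_pos hσ0).le zero_le_one
    have h2 : r * (|l| + 1) ≤ σ := by
      rw [← le_div_iff₀ (by positivity)]; linarith
    have h3 : r ≤ σ := by linarith
    nlinarith [abs_nonneg l]
  -- The inner radius leaves logarithmic room for `n` zeros; only now is `c` taken close to `μ`.
  obtain ⟨ε, hε, Hε⟩ := H (r * Real.exp (-(2 * n * (Real.pi / σ)))) (by positivity)
  filter_upwards [Ioo_mem_nhdsLT (show μ - ε < μ by linarith)] with c hc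
  have hq := h.continuousOn_pot_of_lt (β := β) hμ hc.2
  refine eig_le_of_isPruefer h.lt hq hn fun θ hθ => ?_
  have hpos : ∀ x ∈ Icc (r * Real.exp (-(2 * n * (Real.pi / σ)))) r, 0 < x := fun x hx =>
    lt_of_lt_of_le (by positivity) hx.1
  have hmem : ∀ x ∈ Icc (r * Real.exp (-(2 * n * (Real.pi / σ)))) r, p + τ * x ∈ Ioc y₁ y₂ :=
    fun x hx => hm x (hpos x hx) (hx.2.trans hrR)
  refine hθ.mul_pi_le_of_hardy h.lt hq hτ hr0 hσ0 n hmem fun x hx => ?_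
  have hx0 := hpos x hx
  have habs : |p + τ * x - p| = x := by
    rw [add_sub_cancel_left, abs_mul, (pow_eq_one_iff_of_nonneg (abs_nonneg τ) two_ne_zero).1 (by rw [sq_abs, hτ]), one_mul, abs_of_pos hx0]
  have h2 := Hε c hc.2 hc.1 _ (Ioc_subset_Icc_self (hmem x hx)) (by rw [habs]; exact hx.1)
    (by rw [habs]; exact hx.2.trans hrδ)
  rw [habs] at h2
  have h3 : -l ≤ σ ^ 2 / x ^ 2 := by
    rw [le_div_iff₀ (by positivity)]
    have : x ^ 2 ≤ r ^ 2 := by have := hx.2; gcongr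
    nlinarith [neg_le_abs l, abs_nonneg l, sq_nonneg x]
  have h4 : -γ / x ^ 2 + σ ^ 2 / x ^ 2 = -(1 / 4 + σ ^ 2) / x ^ 2 := by
    rw [← add_div]; congr 1; linarith
  linarith

theorem exists_neg_le_eig (h : IsProfile y₁ y₂ u u₁ (d2 y₁ y₂ u) u₃)
    (hμ : ∀ y ∈ Icc y₁ y₂, μ ≤ u y)
    (hβ : ∀ y ∈ Icc y₁ y₂, u₁ y = 0 → u y = μ → β ≤ 9 / 8 * d2 y₁ y₂ u y) :
    ∃ C, ∀ c < μ, -C ≤ eig y₁ y₂ u β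
      ({p ∈ Ioo y₁ y₂ | u p = μ ∧ d2 y₁ y₂ u p - β < 0}.ncard + 1) c := by
  obtain ⟨C, -, hC⟩ := h.exists_form_bound hμ hβ
  have hfin : {p ∈ Ioo y₁ y₂ | u p = μ ∧ d2 y₁ y₂ u p - β < 0}.Finite :=
    (h.finite_minimum_points hμ).subset fun p hp =>
      ⟨Ioo_subset_Icc_self hp.1, hp.2.1, h.deriv_eq_zero hμ hp.1 hp.2.1⟩
  refine ⟨C, fun c hc => neg_le_eig_of_form_bound h.lt (h.continuousOn_pot_of_lt hμ hc)
    hfin.toFinset C (fun φ φ' h1 h2 h3 h4 h5 => hC c hc φ φ' h1 h2 h3 h4 fun x hx1 hx2 hx3 =>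
      h5 x (hfin.mem_toFinset.2 ⟨hx1, hx2, hx3⟩)) ?_⟩
  rw [Set.ncard_eq_toFinset_card _ hfin]

theorem exists_eig_nonneg (h : IsProfile y₁ y₂ u u₁ (d2 y₁ y₂ u) u₃)
    (hμ : ∀ y ∈ Icc y₁ y₂, μ ≤ u y)
    (hβ : ∀ y ∈ Icc y₁ y₂, u₁ y = 0 → u y = μ → β ≤ 9 / 8 * d2 y₁ y₂ u y) (m : ℕ) :
    ∃ N, m < N ∧ ∀ c < μ, 0 ≤ eig y₁ y₂ u β N c := by
  obtain ⟨F, hF⟩ := h.exists_finset_form_nonneg hμ hβ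
  -- `F.card + 1` would suffice for the sign; the maximum with `m` secures `m < N`, and the
  -- eigenvalues increase with the index.
  refine ⟨max F.card m + 1, by omega, fun c hc => ?_⟩
  rw [← neg_zero]
  refine neg_le_eig_of_form_bound h.lt (h.continuousOn_pot_of_lt hμ hc) F 0
    (fun φ φ' h1 h2 _ _ h5 => ?_) (by omega)
  simpa using hF c hc φ φ' h1 h2 h5

end Asymptotics

/-! ### Reflection exchanging minimum and maximum -/

section Reflection

variable {y₁ y₂ : ℝ} {u : ℝ → ℝ} {β : ℝ}

theorem d1_neg (y : ℝ) : d1 y₁ y₂ (fun x => -u x) y = -d1 y₁ y₂ u y := derivWithin.fun_neg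

theorem d2_neg (y : ℝ) : d2 y₁ y₂ (fun x => -u x) y = -d2 y₁ y₂ u y :=
  iteratedDerivWithin_fun_neg u

theorem H1.neg (hu : H1 y₁ y₂ u) : H1 y₁ y₂ fun x => -u x := by
  obtain ⟨⟨g, hc, hg, hint⟩, hnd⟩ := hu
  refine ⟨⟨fun x => -g x, hc.neg, hg.neg, fun y hy => ?_⟩, fun y hy h1 h2 => ?_⟩
  · rw [iteratedDerivWithin_fun_neg, iteratedDerivWithin_fun_neg, intervalIntegral.integral_neg,
      hint y hy]
    ring
  · rw [d1_neg, neg_eq_zero] at h1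
    rw [d2_neg, neg_eq_zero] at h2
    exact hnd y hy h1 h2

/-- Changing the signs of `u`, `β` and `c` together flips numerator and denominator, leaving the
potential unchanged. -/
theorem isEigenvalue_neg (c l : ℝ) :
    IsEigenvalue y₁ y₂ (fun x => -u x) (-β) (-c) l ↔ IsEigenvalue y₁ y₂ u β c l := by
  have : ∀ y, (d2 y₁ y₂ (fun x => -u x) y - -β) / (-u y - -c) = (d2 y₁ y₂ u y - β) / (u y - c) := by
    intro y
    rw [d2_neg, ← neg_div_neg_eq]
    congr 1 <;> ring
  simp only [IsEigenvalue, this]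

theorem eig_neg (n : ℕ) (c : ℝ) :
    eig y₁ y₂ (fun x => -u x) (-β) n (-c) = eig y₁ y₂ u β n c := by
  simp only [eig, isEigenvalue_neg]

theorem tendsto_eig_of_neg {n : ℕ} {M : ℝ}
    (h : Tendsto (eig y₁ y₂ (fun x => -u x) (-β) n) (𝓝[<] (-M)) atBot) :
    Tendsto (eig y₁ y₂ u β n) (𝓝[>] M) atBot := by
  have h1 : Tendsto (fun c : ℝ => -c) (𝓝[>] M) (𝓝[<] (-M)) := tendsto_neg_nhdsGT
  exact (h.comp h1).congr fun c => eig_neg n c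

end Reflection

/-! ### Translation of the extended-real conditions -/

section Extrema

variable {y₁ y₂ : ℝ} {u : ℝ → ℝ} {β : ℝ}

theorem uMin_le (hc : ContinuousOn u (Icc y₁ y₂)) : ∀ y ∈ Icc y₁ y₂, uMin y₁ y₂ u ≤ u y :=
  fun _ hy => csInf_le (isCompact_Icc.image_of_continuousOn hc).bddBelow (mem_image_of_mem u hy)

theorem le_uMax (hc : ContinuousOn u (Icc y₁ y₂)) : ∀ y ∈ Icc y₁ y₂, u y ≤ uMax y₁ y₂ u :=
  fun _ hy => le_csSup (isCompact_Icc.image_of_continuousOn hc).bddAbove (mem_image_of_mem u hy)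

theorem le_of_le_kappaPlus (h : (β : EReal) ≤ ((9 / 8 : ℝ) : EReal) * kappaPlus y₁ y₂ u) :
    ∀ y ∈ Icc y₁ y₂, d1 y₁ y₂ u y = 0 → u y = uMin y₁ y₂ u → β ≤ 9 / 8 * d2 y₁ y₂ u y := by
  intro y hy h1 h2
  have h3 : kappaPlus y₁ y₂ u ≤ (d2 y₁ y₂ u y : EReal) := iInf₂_le y ⟨hy, h1, h2⟩
  have h4 := h.trans (mul_le_mul_of_nonneg_left h3 (EReal.coe_nonneg.2 (by norm_num)))
  exact_mod_cast h4

/-- Attainment of the infimum is not needed: if every value is at least `8β/9`, so is the infimum,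
including the empty case where it is `⊤`. -/
theorem exists_of_kappaPlus_lt (h : ((9 / 8 : ℝ) : EReal) * kappaPlus y₁ y₂ u < (β : EReal)) :
    ∃ y ∈ Icc y₁ y₂, d1 y₁ y₂ u y = 0 ∧ u y = uMin y₁ y₂ u ∧ 9 / 8 * d2 y₁ y₂ u y < β := by
  by_contra! hcon
  refine absurd h (not_lt.2 ?_)
  have h1 : ((8 / 9 * β : ℝ) : EReal) ≤ kappaPlus y₁ y₂ u := by
    refine le_iInf₂ fun y hy => ?_
    rw [EReal.coe_le_coe_iff]
    linarith [hcon y hy.1 hy.2.1 hy.2.2]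
  have h2 := mul_le_mul_of_nonneg_left h1 (EReal.coe_nonneg.2 (show (0 : ℝ) ≤ 9 / 8 by norm_num))
  refine le_trans (le_of_eq ?_) h2
  rw [← EReal.coe_mul]
  congr 1
  ring

theorem le_of_kappaMinus_le (h : ((9 / 8 : ℝ) : EReal) * kappaMinus y₁ y₂ u ≤ (β : EReal)) :
    ∀ y ∈ Icc y₁ y₂, d1 y₁ y₂ u y = 0 → u y = uMax y₁ y₂ u → 9 / 8 * d2 y₁ y₂ u y ≤ β := by
  intro y hy h1 h2
  have h3 : (d2 y₁ y₂ u y : EReal) ≤ kappaMinus y₁ y₂ u :=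
    le_iSup₂ (f := fun y (_ : y ∈ {y ∈ Icc y₁ y₂ | d1 y₁ y₂ u y = 0 ∧ u y = uMax y₁ y₂ u}) =>
      (d2 y₁ y₂ u y : EReal)) y ⟨hy, h1, h2⟩
  have h4 := (mul_le_mul_of_nonneg_left h3
    (EReal.coe_nonneg.2 (show (0 : ℝ) ≤ 9 / 8 by norm_num))).trans h
  exact_mod_cast h4

theorem exists_of_lt_kappaMinus (h : (β : EReal) < ((9 / 8 : ℝ) : EReal) * kappaMinus y₁ y₂ u) :
    ∃ y ∈ Icc y₁ y₂, d1 y₁ y₂ u y = 0 ∧ u y = uMax y₁ y₂ u ∧ β < 9 / 8 * d2 y₁ y₂ u y := by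
  by_contra! hcon
  refine absurd h (not_lt.2 ?_)
  have h1 : kappaMinus y₁ y₂ u ≤ ((8 / 9 * β : ℝ) : EReal) := by
    refine iSup₂_le fun y hy => ?_
    rw [EReal.coe_le_coe_iff]
    linarith [hcon y hy.1 hy.2.1 hy.2.2]
  have h2 := mul_le_mul_of_nonneg_left h1 (EReal.coe_nonneg.2 (show (0 : ℝ) ≤ 9 / 8 by norm_num))
  refine le_trans h2 (le_of_eq ?_)
  rw [← EReal.coe_mul]
  congr 1
  ring

/-- A single real value keeps the infimum below `⊤`, and the uniform bound keeps it above `⊥`. -/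
theorem neg_iInf_finite {S : Set ℝ} (hS : S.Nonempty) {f : ℝ → ℝ} {C : ℝ}
    (hf : ∀ c ∈ S, -C ≤ f c) :
    ⊥ < -(⨅ c ∈ S, (f c : EReal)) ∧ -(⨅ c ∈ S, (f c : EReal)) < ⊤ := by
  obtain ⟨c₀, hc₀⟩ := hS
  have h1 : ⨅ c ∈ S, (f c : EReal) ≤ f c₀ := iInf₂_le c₀ hc₀
  have h2 : ((-C : ℝ) : EReal) ≤ ⨅ c ∈ S, (f c : EReal) :=
    le_iInf₂ fun c hc => EReal.coe_le_coe_iff.2 (hf c hc)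
  constructor
  · rw [bot_lt_iff_ne_bot, Ne, EReal.neg_eq_bot_iff]
    exact (h1.trans_lt (EReal.coe_lt_top _)).ne
  · rw [lt_top_iff_ne_top, Ne, EReal.neg_eq_top_iff]
    exact ((EReal.bot_lt_coe _).trans_le h2).ne'

end Extrema

end RayleighKuo

theorem mainTheorem4 (y₁ y₂ : ℝ) (hy : y₁ < y₂) (u : ℝ → ℝ) (hu : H1 y₁ y₂ u) (β : ℝ) :
    -- the eigenvalues form an infinite increasing sequence, of which `eig n` is the `n`-th term
    (∀ c : ℝ, c < uMin y₁ y₂ u ∨ uMax y₁ y₂ u < c →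
      ∃ e : ℕ → ℝ, StrictMono e ∧ Set.range e = {μ | IsEigenvalue y₁ y₂ u β c μ} ∧
        ∀ n, eig y₁ y₂ u β (n + 1) c = e n) ∧
    -- (1)
    (0 < β → (β : EReal) ≤ ((9 / 8 : ℝ) : EReal) * kappaPlus y₁ y₂ u →
      (∀ n : ℕ, 1 ≤ n → n ≤ mBeta y₁ y₂ u β →
        Tendsto (eig y₁ y₂ u β n) (𝓝[<] (uMin y₁ y₂ u)) atBot) ∧
      (⊥ < MBeta y₁ y₂ u β ∧ MBeta y₁ y₂ u β < ⊤) ∧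
      ∃ N : ℕ, mBeta y₁ y₂ u β < N ∧
        0 ≤ ⨅ c ∈ Iio (uMin y₁ y₂ u), (eig y₁ y₂ u β N c : EReal)) ∧
    -- (2)
    (((9 / 8 : ℝ) : EReal) * kappaMinus y₁ y₂ u ≤ (β : EReal) → β < 0 →
      (∀ n : ℕ, 1 ≤ n → n ≤ mBeta y₁ y₂ u β →
        Tendsto (eig y₁ y₂ u β n) (𝓝[>] (uMax y₁ y₂ u)) atBot) ∧
      (⊥ < MBeta y₁ y₂ u β ∧ MBeta y₁ y₂ u β < ⊤) ∧
      ∃ N : ℕ, mBeta y₁ y₂ u β < N ∧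
        0 ≤ ⨅ c ∈ Ioi (uMax y₁ y₂ u), (eig y₁ y₂ u β N c : EReal)) ∧
    -- (3)
    (((9 / 8 : ℝ) : EReal) * kappaPlus y₁ y₂ u < (β : EReal) →
      ∀ n : ℕ, 1 ≤ n → Tendsto (eig y₁ y₂ u β n) (𝓝[<] (uMin y₁ y₂ u)) atBot) ∧
    -- (4)
    ((β : EReal) < ((9 / 8 : ℝ) : EReal) * kappaMinus y₁ y₂ u →
      ∀ n : ℕ, 1 ≤ n → Tendsto (eig y₁ y₂ u β n) (𝓝[>] (uMax y₁ y₂ u)) atBot) := by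
  have h := hu.isProfile hy
  have h' := hu.neg.isProfile hy
  have hmin := uMin_le h.continuousOn
  have hmax := le_uMax h.continuousOn
  -- Parts (2) and (4) are the minimum statements for `-u` with parameter `-β` and lower bound
  -- `-u_max`.
  have hmax' : ∀ y ∈ Icc y₁ y₂, -uMax y₁ y₂ u ≤ -u y := fun y hy => neg_le_neg (hmax y hy)
  refine ⟨fun c hc => ?_, fun hβ0 hβ => ?_, fun hβ hβ0 => ?_, fun hβ n hn => ?_, fun hβ n hn => ?_⟩
  · have hne : ∀ y ∈ Icc y₁ y₂, u y ≠ c := by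
      intro y hy
      rcases hc with hc | hc
      · exact (hc.trans_le (hmin y hy)).ne'
      · exact ((hmax y hy).trans_lt hc).ne
    obtain ⟨e, he, hr, heig, -⟩ := exists_eig_seq hy (h.continuousOn_pot (β := β) hne)
    exact ⟨e, he, hr, heig⟩
  · have hβ' := le_of_le_kappaPlus hβ
    have hm : mBeta y₁ y₂ u β =
        {a ∈ Ioo y₁ y₂ | u a = uMin y₁ y₂ u ∧ d2 y₁ y₂ u a - β < 0}.ncard := if_pos hβ0
    refine ⟨fun n hn hnm => tendsto_eig_atBot_of_le_ncard h hmin hn (hm ▸ hnm), ?_, ?_⟩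
    · obtain ⟨C, hC⟩ := exists_neg_le_eig h hmin hβ'
      rw [← hm] at hC
      rw [MBeta, if_pos hβ0]
      exact neg_iInf_finite nonempty_Iio hC
    · obtain ⟨N, hN, h0⟩ := exists_eig_nonneg h hmin hβ' (mBeta y₁ y₂ u β)
      exact ⟨N, hN, le_iInf₂ fun c hc => EReal.coe_nonneg.2 (h0 c hc)⟩
  · have hβ' : ∀ y ∈ Icc y₁ y₂, d1 y₁ y₂ (fun x => -u x) y = 0 → -u y = -uMax y₁ y₂ u →
        -β ≤ 9 / 8 * d2 y₁ y₂ (fun x => -u x) y := by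
      intro y hy h1 h2
      rw [d1_neg, neg_eq_zero] at h1
      rw [d2_neg]
      linarith [le_of_kappaMinus_le hβ y hy h1 (neg_injective h2)]
    have hm : mBeta y₁ y₂ u β = {a ∈ Ioo y₁ y₂ | -u a = -uMax y₁ y₂ u ∧
        d2 y₁ y₂ (fun x => -u x) a - -β < 0}.ncard := by
      rw [mBeta, if_neg hβ0.not_gt]
      congr 1
      ext a
      simp only [mem_ofPred_eq, d2_neg, neg_inj]
      refine and_congr_right fun _ => and_congr_right fun _ => ?_
      constructor <;> intro h <;> linarith
    refine ⟨fun n hn hnm => tendsto_eig_of_neg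
      (tendsto_eig_atBot_of_le_ncard h' hmax' hn (hm ▸ hnm)), ?_, ?_⟩
    · obtain ⟨C, hC⟩ := exists_neg_le_eig h' hmax' hβ'
      rw [← hm] at hC
      rw [MBeta, if_neg hβ0.not_gt]
      refine neg_iInf_finite nonempty_Ioi (C := C) fun c hc => ?_
      rw [← eig_neg]
      exact hC (-c) (neg_lt_neg hc)
    · obtain ⟨N, hN, h0⟩ := exists_eig_nonneg h' hmax' hβ' (mBeta y₁ y₂ u β)
      refine ⟨N, hN, le_iInf₂ fun c hc => EReal.coe_nonneg.2 ?_⟩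
      rw [← eig_neg]
      exact h0 (-c) (neg_lt_neg hc)
  · obtain ⟨p, hp, h1, h2, h3⟩ := exists_of_kappaPlus_lt hβ
    exact tendsto_eig_atBot_of_supercritical h hmin hp h2 h1 h3 hn
  · obtain ⟨p, hp, h1, h2, h3⟩ := exists_of_lt_kappaMinus hβ
    refine tendsto_eig_of_neg (tendsto_eig_atBot_of_supercritical h' hmax' hp (neg_inj.2 h2)
      (by rw [d1_neg, h1, neg_zero]) (by rw [d2_neg]; linarith) hn)
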